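/- All manifolds are finite-dimensional, Hausdorff and without boundary, and everything is $C^\infty$. Let $E\to M$ and $F\to N$ be Lie algebroids of finite rank with anchors $\rho_E,\rho_F$, let $\nu:M\to N$ be a smooth map (for instance a fibre bundle), and let $\pi:E\to F$ be a fibrewise surjective vector bundle map over $\nu$ that is a morphism of Lie algebroids, i.e. $\pi^*d\omega=d\pi^*\omega$ for all forms $\omega$ on $F$. Put $\mathcal L_m\pi=\mathrm{Lin}(F_{\nu(m)},E_m)$ and $\mathcal J_m\pi=\{w\in\mathcal L_m\pi:\pi\circ w=\mathrm{id}\}$; thus $\mathcal J\pi=\bigcup_m\mathcal J_m\pi$ is an affine subbundle of the vector bundle $\mathcal L\pi\to M$. A section $\theta$ of $\mathcal L^*\pi$ is a smooth field of linear maps $\theta_m:E_m\to F_{\nu(m)}$; it defines the function $\hat\theta(w)=\mathrm{tr}(\theta_m\circ w)$, $w\in\mathcal J_m\pi$, on $\mathcal J\pi$. The flow of a section $\sigma$ of a Lie algebroid $E$ is the local flow on $E$ of the vector field $X_\sigma^C$ on $E$ that projects to $\rho_E(\sigma)$ and satisfies $X_\sigma^C(\hat\alpha)=\widehat{d_\sigma\alpha}$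 for every section $\alpha$ of $E^*$, where $d_\sigma=i_\sigma d+d\,i_\sigma$ and $\hat\alpha$ is the fibrewise linear function on $E$ defined by $\alpha$. Let $\sigma$ be a section of $E$ projectable over a section $\eta$ of $F$, i.e. $\pi\circ\sigma=\eta\circ\nu$. Let $\Psi_s$ be the flow of $\sigma$, with base map $\psi_s$, and $\Phi_s$ the flow of $\eta$. The complete lift $X_\sigma^{(1)}$ of $\sigma$ is the vector field on $\mathcal J\pi$ that generates the local flow $w\mapsto\Psi_s\circ w\circ\Phi_{-s}$. For a section $\theta$ of $\mathcal L^*\pi$ let $d_\sigma\theta$ be the section of $\mathcal L^*\pi$ with $$(d_\sigma\theta)_m(a)=\frac{d}{ds}\Big|_{s=0}\Phi_{-s}\bigl(\theta_{\psi_s(m)}(\Psi_s(a))\bigr),\qquad a\in E_m .$$ Then the complete lift $X_\sigma^{(1)}$ exists, and it is the unique vector field $X$ on $\mathcal J\pi$ such that $X$ projects to the vector field $\rho_E(\sigma)$ on $M$, and $X(\hat\theta)=\widehat{d_\sigma\theta}$ on $\mathcal J\pi$ for every section $\theta$ of $\mathcal L^*\pi$ (where $d_\sigma\theta$ exists for every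 such $\theta$). -/

import Mathlib

open Bundle Filter Topology Set
open scoped Manifold ContDiff Bundle

noncomputable section

/-! ### Fibres of a pullback bundle -/

instance pullbackFiberAddCommGroup {M N : Type*} (ν : M → N) (F : N → Type*)
    [∀ n, AddCommGroup (F n)] (m : M) : AddCommGroup ((ν *ᵖ F) m) :=
  inferInstanceAs (AddCommGroup (F (ν m)))

instance pullbackFiberIsTopologicalAddGroup {M N : Type*} (ν : M → N) (F : N → Type*)
    [∀ n, AddCommGroup (F n)] [∀ n, TopologicalSpace (F n)] [∀ n, IsTopologicalAddGroup (F n)]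
    (m : M) : IsTopologicalAddGroup ((ν *ᵖ F) m) :=
  inferInstanceAs (IsTopologicalAddGroup (F (ν m)))

instance pullbackFiberContinuousSMul {M N : Type*} (ν : M → N) (F : N → Type*)
    [∀ n, AddCommGroup (F n)] [∀ n, Module ℝ (F n)] [∀ n, TopologicalSpace (F n)]
    [∀ n, ContinuousSMul ℝ (F n)] (m : M) : ContinuousSMul ℝ ((ν *ᵖ F) m) :=
  inferInstanceAs (ContinuousSMul ℝ (F (ν m)))

/-! ### Local flows of vector fields -/

/-- `FlowsTo I X s p q`: the local flow of the vector field `X` is defined at `p` up to time `s`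
(which may be negative) and takes `p` to `q` in time `s`. -/
def FlowsTo {V H P : Type*} [NormedAddCommGroup V] [NormedSpace ℝ V] [TopologicalSpace H]
    (I : ModelWithCorners ℝ V H) [TopologicalSpace P] [ChartedSpace H P]
    (X : ∀ p : P, TangentSpace I p) (s : ℝ) (p q : P) : Prop :=
  ∃ (γ : ℝ → P) (a b : ℝ), (0 : ℝ) ∈ Ioo a b ∧ s ∈ Ioo a b ∧
    IsMIntegralCurveOn γ X (Ioo a b) ∧ γ 0 = p ∧ γ s = q

/-! ### Lie algebroids -/

section LieAlgebroid

variable {VM : Type*} [NormedAddCommGroup VM] [NormedSpace ℝ VM]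
  {M : Type*} [TopologicalSpace M] [ChartedSpace VM M]
  {VE : Type*} [NormedAddCommGroup VE] [NormedSpace ℝ VE]
  {E : M → Type*} [∀ m, AddCommGroup (E m)] [∀ m, Module ℝ (E m)]
  [∀ m, TopologicalSpace (E m)] [∀ m, IsTopologicalAddGroup (E m)]
  [∀ m, ContinuousSMul ℝ (E m)] [TopologicalSpace (TotalSpace VE E)]
  [FiberBundle VE E] [VectorBundle ℝ VE E]

/-- The derivative `v f` of a function `f` on `M` along a tangent vector `v` at `m`. -/
def dirDeriv (f : M → ℝ) (m : M) (v : TangentSpace 𝓘(ℝ, VM) m) : ℝ :=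
  mfderiv 𝓘(ℝ, VM) 𝓘(ℝ, ℝ) f m v

variable (VM M VE E) in
/-- A Lie algebroid structure on the vector bundle `E` over `M`. -/
structure LieAlgebroid [IsManifold 𝓘(ℝ, VM) ∞ M] where
  /-- the anchor, a smooth vector bundle map `E → TM` over the identity -/
  anchor : ContMDiffSection 𝓘(ℝ, VM) (VE →L[ℝ] VM) ∞
    (fun m : M => E m →L[ℝ] TangentSpace 𝓘(ℝ, VM) m)
  /-- the bracket of sections -/
  bracket : ContMDiffSection 𝓘(ℝ, VM) VE ∞ E →ₗ[ℝ] ContMDiffSection 𝓘(ℝ, VM) VE ∞ E →ₗ[ℝ]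
    ContMDiffSection 𝓘(ℝ, VM) VE ∞ E
  bracket_self : ∀ σ, bracket σ σ = 0
  jacobi : ∀ σ τ υ,
    bracket σ (bracket τ υ) = bracket (bracket σ τ) υ + bracket τ (bracket σ υ)
  leibniz : ∀ (σ τ fτ : ContMDiffSection 𝓘(ℝ, VM) VE ∞ E) (f : M → ℝ),
    ContMDiff 𝓘(ℝ, VM) 𝓘(ℝ, ℝ) ∞ f → (∀ m, fτ m = f m • τ m) →
    ∀ m, bracket σ fτ m = f m • bracket σ τ m + dirDeriv f m (anchor m (σ m)) • τ m

variable (E) in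
/-- A field of alternating `p`-linear forms on the fibres of `E` (not necessarily smooth). -/
abbrev FormField (p : ℕ) : Type _ := ∀ m : M, E m [⋀^Fin p]→ₗ[ℝ] ℝ

variable (VM VE) in
/-- `α` is a smooth `p`-form on `E`, i.e. a smooth section of `⋀^p E*`: it takes smooth functions
as values on smooth sections. -/
def IsSmoothForm {p : ℕ} (α : FormField E p) : Prop :=
  ∀ σ : Fin p → ContMDiffSection 𝓘(ℝ, VM) VE ∞ E,
    ContMDiff 𝓘(ℝ, VM) 𝓘(ℝ, ℝ) ∞ fun m => α m fun i => σ i m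

/-- The contraction `i_σ α`. -/
def contract {p : ℕ} (σ : ContMDiffSection 𝓘(ℝ, VM) VE ∞ E) (α : FormField E (p + 1)) :
    FormField E p :=
  fun m => (α m).curryLeft (σ m)

namespace LieAlgebroid

variable [IsManifold 𝓘(ℝ, VM) ∞ M] [ContMDiffVectorBundle ∞ VE E 𝓘(ℝ, VM)]
  (A : LieAlgebroid VM M VE E)

/-- The vector field `ρ(σ)` on `M`. -/
def anchorField (σ : ContMDiffSection 𝓘(ℝ, VM) VE ∞ E) (m : M) : TangentSpace 𝓘(ℝ, VM) m :=
  A.anchor m (σ m)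

/-- The terms `∑_{i<j} (-1)^(i+j) α([σ_i, σ_j], σ_0, …, σ̂_i, …, σ̂_j, …, σ_p)` of the exterior
differential of a `p`-form (there are none if `p = 0`). -/
def bracketSum : ∀ {p : ℕ} (_ : FormField E p)
    (_ : Fin (p + 1) → ContMDiffSection 𝓘(ℝ, VM) VE ∞ E), M → ℝ
  | 0, _, _ => fun _ => 0
  | p + 1, α, σ => fun m => ∑ j : Fin (p + 2), ∑ i : Fin (p + 1), if i.castSucc < j then
      (-1 : ℝ) ^ ((i : ℕ) + (j : ℕ)) *
        α m (Fin.cons (A.bracket (σ i.castSucc) (σ j) m)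
          (i.removeNth (j.removeNth fun k => σ k m)))
      else 0

/-- `α'` is the exterior differential `dα` of the `p`-form `α`. -/
def IsExtDeriv {p : ℕ} (α : FormField E p) (α' : FormField E (p + 1)) : Prop :=
  ∀ (σ : Fin (p + 1) → ContMDiffSection 𝓘(ℝ, VM) VE ∞ E) (m : M),
    α' m (fun i => σ i m) =
      (∑ i : Fin (p + 1), (-1 : ℝ) ^ (i : ℕ) *
        dirDeriv (fun x => α x (i.removeNth fun k => σ k x)) m (A.anchorField (σ i) m)) +
      A.bracketSum α σ m

/-- `α'` is the Lie derivative `d_σ α = i_σ dα + d i_σ α` of the form `α`, of degree at least 1. -/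
def IsLieDerivForm {p : ℕ} (σ : ContMDiffSection 𝓘(ℝ, VM) VE ∞ E)
    (α α' : FormField E (p + 1)) : Prop :=
  ∃ (dα : FormField E (p + 2)) (diα : FormField E (p + 1)),
    A.IsExtDeriv α dα ∧ A.IsExtDeriv (contract σ α) diα ∧
      ∀ m, α' m = contract σ dα m + diα m

/-- `X` is the complete lift `X_σ^C` of the section `σ`: the smooth vector field on the total space
of `E` that projects to `ρ(σ)` and satisfies `X(θ̂) = (d_σ θ)^` for every 1-form `θ` on `E`, where
`θ̂` is the fibrewise linear function on `E` defined by `θ`. -/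
def IsLift (σ : ContMDiffSection 𝓘(ℝ, VM) VE ∞ E)
    (X : ∀ a : TotalSpace VE E, TangentSpace (𝓘(ℝ, VM).prod 𝓘(ℝ, VE)) a) : Prop :=
  ContMDiff (𝓘(ℝ, VM).prod 𝓘(ℝ, VE)) (𝓘(ℝ, VM).prod 𝓘(ℝ, VE)).tangent ∞
      (fun a => (⟨a, X a⟩ : TangentBundle (𝓘(ℝ, VM).prod 𝓘(ℝ, VE)) (TotalSpace VE E))) ∧
    (∀ a : TotalSpace VE E,
      mfderiv (𝓘(ℝ, VM).prod 𝓘(ℝ, VE)) 𝓘(ℝ, VM) (TotalSpace.proj : TotalSpace VE E → M) a (X a) =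
        A.anchorField σ a.proj) ∧
    ∀ θ : FormField E 1, IsSmoothForm VM VE θ → ∃ θ' : FormField E 1, A.IsLieDerivForm σ θ θ' ∧
      ∀ a : TotalSpace VE E,
        mfderiv (𝓘(ℝ, VM).prod 𝓘(ℝ, VE)) 𝓘(ℝ, ℝ)
          (fun b : TotalSpace VE E => θ b.proj ![b.2]) a (X a) = θ' a.proj ![a.2]

/-- The flow `Φ_s` of the section `σ`, i.e. the local flow of its complete lift to `E`:
`A.SectionFlowsTo σ s a b` means that `Φ_s(a)` is defined and equal to `b`. -/
def SectionFlowsTo (σ : ContMDiffSection 𝓘(ℝ, VM) VE ∞ E) (s : ℝ) (a b : TotalSpace VE E) :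
    Prop :=
  ∃ X, A.IsLift σ X ∧ FlowsTo (𝓘(ℝ, VM).prod 𝓘(ℝ, VE)) X s a b

end LieAlgebroid

end LieAlgebroid

/-! ### Morphisms, jets and complete lifts -/

section Jets

variable {VM : Type*} [NormedAddCommGroup VM] [NormedSpace ℝ VM]
  {M : Type*} [TopologicalSpace M] [ChartedSpace VM M]
  {VE : Type*} [NormedAddCommGroup VE] [NormedSpace ℝ VE]
  {E : M → Type*} [∀ m, AddCommGroup (E m)] [∀ m, Module ℝ (E m)]
  [∀ m, TopologicalSpace (E m)] [∀ m, IsTopologicalAddGroup (E m)]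
  [∀ m, ContinuousSMul ℝ (E m)] [TopologicalSpace (TotalSpace VE E)]
  [FiberBundle VE E] [VectorBundle ℝ VE E]
  {VN : Type*} [NormedAddCommGroup VN] [NormedSpace ℝ VN]
  {N : Type*} [TopologicalSpace N] [ChartedSpace VN N]
  {VF : Type*} [NormedAddCommGroup VF] [NormedSpace ℝ VF]
  {F : N → Type*} [∀ n, AddCommGroup (F n)] [∀ n, Module ℝ (F n)]
  [∀ n, TopologicalSpace (F n)] [∀ n, IsTopologicalAddGroup (F n)]
  [∀ n, ContinuousSMul ℝ (F n)] [TopologicalSpace (TotalSpace VF F)]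
  [FiberBundle VF F] [VectorBundle ℝ VF F]

/-- Smooth fields of linear maps `E_m → F_{ν(m)}`: on the one hand these are the smooth vector
bundle maps `E → F` over `ν`, on the other hand the smooth sections of `ℒ*π`, the bundle dual to
`ℒπ` through the pairing `⟨θ, w⟩ = tr (θ ∘ w)`. -/
abbrev BundleMapOver (VE : Type*) [NormedAddCommGroup VE] [NormedSpace ℝ VE]
    (E : M → Type*) [∀ m, AddCommGroup (E m)] [∀ m, Module ℝ (E m)]
    [∀ m, TopologicalSpace (E m)] [∀ m, IsTopologicalAddGroup (E m)]
    [∀ m, ContinuousSMul ℝ (E m)] [TopologicalSpace (TotalSpace VE E)]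
    [FiberBundle VE E] [VectorBundle ℝ VE E]
    (VF : Type*) [NormedAddCommGroup VF] [NormedSpace ℝ VF]
    (F : N → Type*) [∀ n, AddCommGroup (F n)] [∀ n, Module ℝ (F n)]
    [∀ n, TopologicalSpace (F n)] [∀ n, IsTopologicalAddGroup (F n)]
    [∀ n, ContinuousSMul ℝ (F n)] [TopologicalSpace (TotalSpace VF F)]
    [FiberBundle VF F] [VectorBundle ℝ VF F]
    (ν : ContMDiffMap 𝓘(ℝ, VM) 𝓘(ℝ, VN) M N ∞) : Type _ :=
  ContMDiffSection 𝓘(ℝ, VM) (VE →L[ℝ] VF) ∞ (fun m : M => E m →L[ℝ] ((ν : M → N) *ᵖ F) m)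

/-- The linear map `E_m → F_{ν(m)}` given by `θ` at the point `m`. -/
def fiberMap {ν : ContMDiffMap 𝓘(ℝ, VM) 𝓘(ℝ, VN) M N ∞} (θ : BundleMapOver VE E VF F ν)
    (m : M) : E m →L[ℝ] F (ν m) := θ m

/-- The pullback `π*α` of a form field on `F`. -/
def pullbackForm {ν : ContMDiffMap 𝓘(ℝ, VM) 𝓘(ℝ, VN) M N ∞} (pr : BundleMapOver VE E VF F ν)
    {p : ℕ} (α : FormField F p) : FormField E p :=
  fun m => (α (ν m)).compLinearMap (fiberMap pr m : E m →ₗ[ℝ] F (ν m))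

/-- `pr` is a morphism of Lie algebroids: `π* dα = d π*α` for all forms `α`. -/
def IsLieAlgebroidMorphism [IsManifold 𝓘(ℝ, VM) ∞ M] [IsManifold 𝓘(ℝ, VN) ∞ N]
    (A : LieAlgebroid VM M VE E) (B : LieAlgebroid VN N VF F)
    {ν : ContMDiffMap 𝓘(ℝ, VM) 𝓘(ℝ, VN) M N ∞} (pr : BundleMapOver VE E VF F ν) : Prop :=
  ∀ (p : ℕ) (α : FormField F p) (dα : FormField F (p + 1)), IsSmoothForm VN VF α →
    B.IsExtDeriv α dα → A.IsExtDeriv (pullbackForm pr α) (pullbackForm pr dα)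

/-- The section `σ` of `E` is projectable over the section `η` of `F`. -/
def ProjectsOver {ν : ContMDiffMap 𝓘(ℝ, VM) 𝓘(ℝ, VN) M N ∞} (pr : BundleMapOver VE E VF F ν)
    (σ : ContMDiffSection 𝓘(ℝ, VM) VE ∞ E) (η : ContMDiffSection 𝓘(ℝ, VN) VF ∞ F) : Prop :=
  ∀ m, fiberMap pr m (σ m) = η (ν m)

/-- The total space of the vector bundle `ℒπ → M`, with fibre `{w : F_{ν(m)} → E_m linear}`. -/
abbrev LBundle (VE : Type*) [NormedAddCommGroup VE] [NormedSpace ℝ VE]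
    (E : M → Type*) [∀ m, AddCommGroup (E m)] [∀ m, Module ℝ (E m)]
    [∀ m, TopologicalSpace (E m)]
    (VF : Type*) [NormedAddCommGroup VF] [NormedSpace ℝ VF]
    (F : N → Type*) [∀ n, AddCommGroup (F n)] [∀ n, Module ℝ (F n)]
    [∀ n, TopologicalSpace (F n)]
    (ν : ContMDiffMap 𝓘(ℝ, VM) 𝓘(ℝ, VN) M N ∞) : Type _ :=
  TotalSpace (VF →L[ℝ] VE) (fun m : M => ((ν : M → N) *ᵖ F) m →L[ℝ] E m)

/-- The model with corners of the manifold `ℒπ`. -/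
abbrev modelL (VM VE VF : Type*) [NormedAddCommGroup VM] [NormedSpace ℝ VM]
    [NormedAddCommGroup VE] [NormedSpace ℝ VE] [NormedAddCommGroup VF] [NormedSpace ℝ VF] :
    ModelWithCorners ℝ (VM × (VF →L[ℝ] VE)) (ModelProd VM (VF →L[ℝ] VE)) :=
  𝓘(ℝ, VM).prod 𝓘(ℝ, VF →L[ℝ] VE)

variable {ν : ContMDiffMap 𝓘(ℝ, VM) 𝓘(ℝ, VN) M N ∞}
  [IsManifold 𝓘(ℝ, VM) ∞ M] [IsManifold 𝓘(ℝ, VN) ∞ N]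
  [ContMDiffVectorBundle ∞ VE E 𝓘(ℝ, VM)] [ContMDiffVectorBundle ∞ VF F 𝓘(ℝ, VN)]

/-- The linear map `F_{ν(m)} → E_m` that an element of `ℒ_mπ` is. -/
def LBundle.map (w : LBundle VE E VF F ν) : F (ν w.proj) →L[ℝ] E w.proj := w.2

/-- The jet manifold `𝒥π`, an embedded submanifold (an affine subbundle) of `ℒπ`:
`𝒥_mπ = {w ∈ ℒ_mπ | π ∘ w = id}`. -/
def jetSet (pr : BundleMapOver VE E VF F ν) : Set (LBundle VE E VF F ν) :=
  {w | ∀ b : F (ν w.proj), fiberMap pr w.proj (LBundle.map w b) = b}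

/-- The tangent space at `w` to a submanifold `S` of `ℒπ`: the velocities at `w` of the curves
in `S`. -/
def IsTangentTo (S : Set (LBundle VE E VF F ν)) (w : LBundle VE E VF F ν)
    (v : TangentSpace (modelL VM VE VF) w) : Prop :=
  ∃ (γ : ℝ → LBundle VE E VF F ν) (h : γ 0 = w), (∀ᶠ s in 𝓝 (0 : ℝ), γ s ∈ S) ∧
    HasMFDerivAt 𝓘(ℝ, ℝ) (modelL VM VE VF) γ 0 ((1 : ℝ →L[ℝ] ℝ).smulRight (h ▸ v))

/-- `X` restricts to a smooth vector field on `𝒥π`. Only the values of `X` on `𝒥π` matter. -/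
def IsJetVectorField (pr : BundleMapOver VE E VF F ν)
    (X : ∀ w : LBundle VE E VF F ν, TangentSpace (modelL VM VE VF) w) : Prop :=
  ContMDiffOn (modelL VM VE VF) (modelL VM VE VF).tangent ∞
      (fun w => (⟨w, X w⟩ : TangentBundle (modelL VM VE VF) (LBundle VE E VF F ν))) (jetSet pr) ∧
    ∀ w ∈ jetSet pr, IsTangentTo (jetSet pr) w (X w)

/-- `w' = Ψ_s ∘ w ∘ Φ_{-s}`, where `Ψ` is the flow of the section `σ` of `E` and `Φ` the flow of
the section `η` of `F`. -/
def IsTransport (A : LieAlgebroid VM M VE E) (B : LieAlgebroid VN N VF F)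
    (σ : ContMDiffSection 𝓘(ℝ, VM) VE ∞ E) (η : ContMDiffSection 𝓘(ℝ, VN) VF ∞ F)
    (s : ℝ) (w w' : LBundle VE E VF F ν) : Prop :=
  ∀ b' : F (ν w'.proj), ∃ b : F (ν w.proj),
    B.SectionFlowsTo η (-s) ⟨ν w'.proj, b'⟩ ⟨ν w.proj, b⟩ ∧
    A.SectionFlowsTo σ s ⟨w.proj, LBundle.map w b⟩ ⟨w'.proj, LBundle.map w' b'⟩

/-- `X` is the complete lift `X_σ^{(1)}` of the section `σ` (projectable over `η`) to `𝒥π`: it is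
the vector field on `𝒥π` that generates the local flow `w ↦ Ψ_s ∘ w ∘ Φ_{-s}` of `𝒥π`. -/
def IsJetCompleteLift (A : LieAlgebroid VM M VE E) (B : LieAlgebroid VN N VF F)
    (pr : BundleMapOver VE E VF F ν)
    (σ : ContMDiffSection 𝓘(ℝ, VM) VE ∞ E) (η : ContMDiffSection 𝓘(ℝ, VN) VF ∞ F)
    (X : ∀ w : LBundle VE E VF F ν, TangentSpace (modelL VM VE VF) w) : Prop :=
  IsJetVectorField pr X ∧
    ∀ w ∈ jetSet pr, ∃ γ : ℝ → LBundle VE E VF F ν, γ 0 = w ∧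
      (∀ᶠ s in 𝓝 (0 : ℝ), γ s ∈ jetSet pr ∧ IsTransport A B σ η s w (γ s)) ∧
      IsMIntegralCurveAt γ X 0

/-- `θ'` is the Lie derivative `d_σ θ = (d/ds) Ψ_s*θ |_{s=0}` of the section `θ` of `ℒ*π`, where
`(Ψ_s*θ)_m = Φ_{-s} ∘ θ_{ψ_s(m)} ∘ Ψ_s` and `ψ_s` is the base map of `Ψ_s`. -/
def IsLieDerivL (A : LieAlgebroid VM M VE E) (B : LieAlgebroid VN N VF F)
    (σ : ContMDiffSection 𝓘(ℝ, VM) VE ∞ E) (η : ContMDiffSection 𝓘(ℝ, VN) VF ∞ F)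
    (θ θ' : BundleMapOver VE E VF F ν) : Prop :=
  ∀ (m : M) (a : E m), ∃ c : ℝ → F (ν m),
    (∀ᶠ s in 𝓝 (0 : ℝ), ∃ a' : TotalSpace VE E,
      A.SectionFlowsTo σ s ⟨m, a⟩ a' ∧
      B.SectionFlowsTo η (-s) ⟨ν a'.proj, fiberMap θ a'.proj a'.2⟩ ⟨ν m, c s⟩) ∧
    HasDerivAt c (fiberMap θ' m a) 0

/-- The function `θ̂(w) = tr (θ ∘ w)` defined by a section `θ` of `ℒ*π`. It is fibrewise linear on
`ℒπ` and fibrewise affine on `𝒥π`. -/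
def hatFunction (θ : BundleMapOver VE E VF F ν) (w : LBundle VE E VF F ν) : ℝ :=
  LinearMap.trace ℝ (F (ν w.proj))
    (fiberMap θ w.proj ∘L LBundle.map w : F (ν w.proj) →L[ℝ] F (ν w.proj))

/-- The vector field `X` on `𝒥π` projects to the vector field `ρ(σ)` on `M`. -/
def ProjectsToAnchor (A : LieAlgebroid VM M VE E) (pr : BundleMapOver VE E VF F ν)
    (σ : ContMDiffSection 𝓘(ℝ, VM) VE ∞ E)
    (X : ∀ w : LBundle VE E VF F ν, TangentSpace (modelL VM VE VF) w) : Prop :=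
  ∀ w ∈ jetSet pr,
    mfderiv (modelL VM VE VF) 𝓘(ℝ, VM) (TotalSpace.proj : LBundle VE E VF F ν → M) w (X w) =
      A.anchorField σ w.proj

/-- `X(θ̂) = (d_σ θ)^` on `𝒥π` for every section `θ` of `ℒ*π`. As `X` is tangent to `𝒥π`, the left
side, computed with the extension of `θ̂` to `ℒπ`, depends only on `θ̂` on `𝒥π`. -/
def ActsByLieDeriv (A : LieAlgebroid VM M VE E) (B : LieAlgebroid VN N VF F)
    (pr : BundleMapOver VE E VF F ν)
    (σ : ContMDiffSection 𝓘(ℝ, VM) VE ∞ E) (η : ContMDiffSection 𝓘(ℝ, VN) VF ∞ F)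
    (X : ∀ w : LBundle VE E VF F ν, TangentSpace (modelL VM VE VF) w) : Prop :=
  ∀ θ : BundleMapOver VE E VF F ν, ∃ θ' : BundleMapOver VE E VF F ν,
    IsLieDerivL A B σ η θ θ' ∧
    ∀ w ∈ jetSet pr,
      mfderiv (modelL VM VE VF) 𝓘(ℝ, ℝ) (hatFunction θ) w (X w) = hatFunction θ' w

end Jets

end

/-!
Everything is read in vector bundle trivializations `e` of `E` near `m` and `f` of `F` near `ν m`.

The bracket with `σ` is a derivation of the sections of `E` over the vector field `ξ = ρ(σ)`, so in
`e` it is `τ ↦ ξ(τ) + Γ τ` with a smooth matrix `Γ` (`coord_derivation`, `christoffel`). Since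
`(d_σ α)(τ) = ξ(α(τ)) - α([σ, τ])`, the complete lift of `σ` to `E` has coordinates `(ξ, -Γ y)`
(`LieAlgebroid.liftVector_iff`); it therefore exists and is unique, and its flow is given by the
solutions of the linear equation `y' = -Γ y` along the integral curves of `ξ`. The same holds for
`η` on `F`, with a matrix `Δ`.

Applied to functions and to `1`-forms on `F`, the identity `π* d = d π*` says that `ν` maps `ρ(σ)` to
`ρ(η)` and that the matrix `P` of `π` satisfies `ξ(P) = P Γ - Δ P`
(`IsLieAlgebroidMorphism.mvfderiv_mapCoord`). Hence the base flows are `ν`-related, `π` intertwines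
the flows of `σ` and `η`, and the flow `w ↦ Ψ_s ∘ w ∘ Φ_{-s}` is defined on `ℒπ` and preserves `𝒥π`.
In coordinates it is `W ↦ a W b⁻¹` with `a' = -Γ a` and `b' = -Δ b`, so it is generated by
`(ξ, -Γ W + W Δ)` (`exists_transportCurve`). Flows are single-valued, so a curve of the form
`Ψ_s ∘ w ∘ Φ_{-s}` has this velocity in every trivialization
(`hasTransportCoord_of_hasMFDerivAt`). This makes the coordinate expressions fit together to one
smooth vector field, which is the complete lift, and identifies every complete lift with it.

For a section `θ` of `ℒ*π` with matrix `T`, differentiating `b⁻¹ T a` at `s = 0` shows that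
`d_σ θ` has matrix `ξ(T) - T Γ + Δ T` (`isLieDerivAt_iff`). As `θ̂ = tr (T W)` in coordinates, the
identity `X(θ̂) = (d_σ θ)^` is invariance of the trace under cyclic permutation. Finally, a vertical
vector `U` at `w` is determined by the numbers `tr (T U)`, and `T` can be prescribed at a point, so
the projection to `M` and the action on the functions `θ̂` determine a vector field on `𝒥π`.
-/

noncomputable section

set_option linter.unusedSectionVars false

/-! ### Cutoff functions, local frames and derivations of sections -/

section Frames

variable {VM : Type*} [NormedAddCommGroup VM] [NormedSpace ℝ VM]
  {M : Type*} [TopologicalSpace M] [ChartedSpace VM M]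
  {VE : Type*} [NormedAddCommGroup VE] [NormedSpace ℝ VE]
  {E : M → Type*} [∀ m, AddCommGroup (E m)] [∀ m, Module ℝ (E m)]
  [∀ m, TopologicalSpace (E m)] [TopologicalSpace (TotalSpace VE E)]
  [FiberBundle VE E] [VectorBundle ℝ VE E]

/-- The total space of a fibre bundle with Hausdorff base and fibre is Hausdorff; flows on it are
therefore single-valued. -/
theorem t2Space_totalSpace {B V : Type*} [TopologicalSpace B] [TopologicalSpace V] [T2Space B]
    [T2Space V] {Z : B → Type*} [∀ b, TopologicalSpace (Z b)] [TopologicalSpace (TotalSpace V Z)]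
    [FiberBundle V Z] : T2Space (TotalSpace V Z) := by
  refine ⟨fun a b hab => ?_⟩
  by_cases h : a.proj = b.proj
  · have ha : a ∈ (trivializationAt V Z a.proj).source := by simp
    have hb : b ∈ (trivializationAt V Z a.proj).source := by simp [h]
    have hne : trivializationAt V Z a.proj a ≠ trivializationAt V Z a.proj b := fun he =>
      hab ((trivializationAt V Z a.proj).injOn ha hb he)
    obtain ⟨u, v, hu, hv, hau, hbv, huv⟩ := t2_separation hne
    refine ⟨_, _, (trivializationAt V Z a.proj).toOpenPartialHomeomorph.isOpen_inter_preimage hu,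
      (trivializationAt V Z a.proj).toOpenPartialHomeomorph.isOpen_inter_preimage hv,
      ⟨ha, hau⟩, ⟨hb, hbv⟩, ?_⟩
    exact (huv.preimage (trivializationAt V Z a.proj)).mono inter_subset_right inter_subset_right
  · obtain ⟨u, v, hu, hv, hau, hbv, huv⟩ := t2_separation h
    exact ⟨_, _, hu.preimage (FiberBundle.continuous_proj V Z),
      hv.preimage (FiberBundle.continuous_proj V Z), hau, hbv, huv.preimage _⟩

variable (VM) in
/-- A smooth cutoff function at `m`: it is supported in `W` and equal to `1` on the open
neighbourhood `nhd` of `m`. -/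
structure Cutoff (m : M) (W : Set M) where
  /-- the function -/
  toFun : M → ℝ
  smooth : ContMDiff 𝓘(ℝ, VM) 𝓘(ℝ, ℝ) ∞ toFun
  /-- the open neighbourhood of `m` on which the function is `1` -/
  nhd : Set M
  isOpen : IsOpen nhd
  mem : m ∈ nhd
  eq_one : ∀ x ∈ nhd, toFun x = 1
  tsupport_subset : tsupport toFun ⊆ W

theorem Cutoff.nhd_subset {m : M} {W : Set M} (φ : Cutoff VM m W) : φ.nhd ⊆ W := fun x hx =>
  φ.tsupport_subset (subset_tsupport _ (by simp [φ.eq_one x hx]))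

theorem Cutoff.eventually_mem {m x : M} {W : Set M} (φ : Cutoff VM m W) (hx : x ∈ φ.nhd) :
    ∀ᶠ y in 𝓝 x, y ∈ φ.nhd := φ.isOpen.mem_nhds hx

theorem exists_cutoff [FiniteDimensional ℝ VM] [T2Space M] [IsManifold 𝓘(ℝ, VM) ∞ M] {m : M}
    {W : Set M} (hW : W ∈ 𝓝 m) : Nonempty (Cutoff VM m W) := by
  obtain ⟨φ, -, hφ⟩ := (SmoothBumpFunction.nhds_basis_tsupport (I := 𝓘(ℝ, VM)) m).mem_iff.1 hW
  obtain ⟨U, hU, hUo, hm⟩ := eventually_nhds_iff.1 φ.eventuallyEq_one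
  exact ⟨⟨φ, φ.contMDiff, U, hUo, hm, hU, hφ⟩⟩

variable [FiniteDimensional ℝ VE] [IsManifold 𝓘(ℝ, VM) ∞ M] [ContMDiffVectorBundle ∞ VE E 𝓘(ℝ, VM)]
variable (e : Trivialization VE (TotalSpace.proj : TotalSpace VE E → M)) [MemTrivializationAtlas e]

theorem contMDiffAt_continuousLinearMapAt (τ : ContMDiffSection 𝓘(ℝ, VM) VE ∞ E) {x : M}
    (hx : x ∈ e.baseSet) :
    ContMDiffAt 𝓘(ℝ, VM) 𝓘(ℝ, VE) ∞ (fun y => e.continuousLinearMapAt ℝ y (τ y)) x := by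
  have h := ((e.contMDiffAt_iff (f := fun y => (⟨y, τ y⟩ : TotalSpace VE E)) (n := ∞)
    (e.mem_source.2 hx)).1 (τ.contMDiff x)).2
  refine h.congr_of_eventuallyEq ?_
  filter_upwards [e.open_baseSet.mem_nhds hx] with y hy
  simp [Trivialization.coe_linearMapAt_of_mem _ hy]

theorem contMDiffAt_section_of_coord {s : ∀ x, E x} {x : M} (hx : x ∈ e.baseSet)
    (h : ContMDiffAt 𝓘(ℝ, VM) 𝓘(ℝ, VE) ∞ (fun y => e.continuousLinearMapAt ℝ y (s y)) x) :
    ContMDiffAt 𝓘(ℝ, VM) (𝓘(ℝ, VM).prod 𝓘(ℝ, VE)) ∞ (fun y => (⟨y, s y⟩ : TotalSpace VE E)) x := by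
  refine (e.contMDiffAt_iff (f := fun y => (⟨y, s y⟩ : TotalSpace VE E)) (n := ∞)
    (e.mem_source.2 hx)).2 ⟨contMDiffAt_id, h.congr_of_eventuallyEq ?_⟩
  filter_upwards [e.open_baseSet.mem_nhds hx] with y hy
  simp [Trivialization.coe_linearMapAt_of_mem _ hy]

variable {m : M} (φ : Cutoff VM m e.baseSet)

/-- The global section which near `m` is the constant `v` in the trivialization `e`. -/
def frameSection : VE →ₗ[ℝ] ContMDiffSection 𝓘(ℝ, VM) VE ∞ E where
  toFun v := ⟨fun x => φ.toFun x • e.symmL ℝ x v, by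
    refine ContMDiffOn.smul_section_of_tsupport φ.smooth.contMDiffOn e.open_baseSet
      φ.tsupport_subset fun x hx => ContMDiffAt.contMDiffWithinAt ?_
    refine contMDiffAt_section_of_coord e hx
      ((contMDiffAt_const (c := v)).congr_of_eventuallyEq ?_)
    filter_upwards [e.open_baseSet.mem_nhds hx] with y hy
    exact e.continuousLinearMapAt_symmL hy v⟩
  map_add' v w := by ext x; simp
  map_smul' c v := by ext x; simp [smul_comm c]

theorem frameSection_apply (v : VE) (x : M) :
    frameSection e φ v x = φ.toFun x • e.symmL ℝ x v := rfl

theorem frameSection_of_mem (v : VE) {x : M} (hx : x ∈ φ.nhd) :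
    frameSection e φ v x = e.symmL ℝ x v := by
  rw [frameSection_apply, φ.eq_one x hx, one_smul]

theorem coord_frameSection (v : VE) {x : M} (hx : x ∈ φ.nhd) :
    e.continuousLinearMapAt ℝ x (frameSection e φ v x) = v := by
  rw [frameSection_of_mem e φ v hx, e.continuousLinearMapAt_symmL (φ.nhd_subset hx)]

/-- The matrix of the operator `D` on sections, taken on the constant sections of the trivialization
`e` near `m`. If `D` is a derivation over a vector field `ξ`, then `D` is `ξ + christoffel e φ D`
in `e`. -/
def christoffel (D : ContMDiffSection 𝓘(ℝ, VM) VE ∞ E →ₗ[ℝ] ContMDiffSection 𝓘(ℝ, VM) VE ∞ E)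
    (x : M) : VE →L[ℝ] VE :=
  LinearMap.toContinuousLinearMap
    { toFun := fun v => e.continuousLinearMapAt ℝ x (D (frameSection e φ v) x)
      map_add' := fun v w => by simp
      map_smul' := fun c v => by simp }

variable (D : ContMDiffSection 𝓘(ℝ, VM) VE ∞ E →ₗ[ℝ] ContMDiffSection 𝓘(ℝ, VM) VE ∞ E)

theorem christoffel_apply (x : M) (v : VE) :
    christoffel e φ D x v = e.continuousLinearMapAt ℝ x (D (frameSection e φ v) x) := rfl

theorem contMDiffAt_clm_of_apply {W W' : Type*} [NormedAddCommGroup W] [NormedSpace ℝ W]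
    [FiniteDimensional ℝ W] [NormedAddCommGroup W'] [NormedSpace ℝ W']
    {T : M → W →L[ℝ] W'} {x : M}
    (h : ∀ v, ContMDiffAt 𝓘(ℝ, VM) 𝓘(ℝ, W') ∞ (fun y => T y v) x) :
    ContMDiffAt 𝓘(ℝ, VM) 𝓘(ℝ, W →L[ℝ] W') ∞ T x := by
  let b := Module.finBasis ℝ W
  have hT : T = fun y => ∑ i, (ContinuousLinearMap.smulRightL ℝ W W'
      (LinearMap.toContinuousLinearMap (b.coord i))) (T y (b i)) := by
    ext y w
    conv_lhs => rw [← b.sum_repr w]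
    simp only [map_sum, map_smul]
    simp
  rw [hT]
  refine contMDiffAt_finsetSum fun i _ => ?_
  exact (ContinuousLinearMap.contMDiff _).contMDiffAt.comp x (h (b i))

theorem contMDiffAt_christoffel {x : M} (hx : x ∈ e.baseSet) :
    ContMDiffAt 𝓘(ℝ, VM) 𝓘(ℝ, VE →L[ℝ] VE) ∞ (christoffel e φ D) x :=
  contMDiffAt_clm_of_apply fun v => contMDiffAt_continuousLinearMapAt e (D (frameSection e φ v)) hx

section VectorValuedDerivative

variable {V H P : Type*} [NormedAddCommGroup V] [NormedSpace ℝ V] [TopologicalSpace H]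
  {I : ModelWithCorners ℝ V H} [TopologicalSpace P] [ChartedSpace H P]
  {W W' : Type*} [NormedAddCommGroup W] [NormedSpace ℝ W]
  [NormedAddCommGroup W'] [NormedSpace ℝ W']

theorem mvfderiv_congr {f g : P → W} {x : P} (h : f =ᶠ[𝓝 x] g) (v : TangentSpace I x) :
    mvfderiv I f x v = mvfderiv I g x v :=
  DFunLike.congr_fun (F := V →L[ℝ] W) (h.mfderiv_eq (I := I) (I' := 𝓘(ℝ, W))) v

theorem mvfderiv_clm_comp (L : W →L[ℝ] W') {f : P → W} {x : P}
    (hf : MDifferentiableAt I 𝓘(ℝ, W) f x) (v : TangentSpace I x) :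
    mvfderiv I (fun y => L (f y)) x v = L (mvfderiv I f x v) := by
  have h := ((L.hasMFDerivAt (x := f x)).comp x hf.hasMFDerivAt).mfderiv
  exact DFunLike.congr_fun (F := V →L[ℝ] W') h v

theorem mvfderiv_clm_apply {T : P → W →L[ℝ] W'} {f : P → W} {x : P}
    (hT : MDifferentiableAt I 𝓘(ℝ, W →L[ℝ] W') T x)
    (hf : MDifferentiableAt I 𝓘(ℝ, W) f x) (v : TangentSpace I x) :
    mvfderiv I (fun y => T y (f y)) x v =
      T x (mvfderiv I f x v) + mvfderiv I T x v (f x) := by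
  have hb := (isBoundedBilinearMap_apply (𝕜 := ℝ) (E := W) (F := W')).hasFDerivAt (T x, f x)
  have hp : HasMFDerivAt I 𝓘(ℝ, (W →L[ℝ] W') × W) (fun y => (T y, f y)) x
      (ContinuousLinearMap.prod (M₁ := V) (M₂ := W →L[ℝ] W') (M₃ := W)
        (mfderiv I 𝓘(ℝ, W →L[ℝ] W') T x) (mfderiv I 𝓘(ℝ, W) f x)) := by
    rw [modelWithCornersSelf_prod, ← chartedSpaceSelf_prod]
    exact hT.hasMFDerivAt.prodMk hf.hasMFDerivAt
  have h := (HasMFDerivAt.comp x hb.hasMFDerivAt hp).mfderiv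
  exact DFunLike.congr_fun (F := V →L[ℝ] W') h v

end VectorValuedDerivative

theorem dirDeriv_eq_mvfderiv (f : M → ℝ) (x : M) (v : TangentSpace 𝓘(ℝ, VM) x) :
    dirDeriv f x v = mvfderiv 𝓘(ℝ, VM) f x v := rfl

theorem ContMDiffSection.sum_apply {ι : Type*} (t : Finset ι)
    (s : ι → ContMDiffSection 𝓘(ℝ, VM) VE ∞ E) (x : M) : (∑ i ∈ t, s i) x = ∑ i ∈ t, s i x := by
  have := map_sum (ContMDiffSection.coeAddHom 𝓘(ℝ, VM) VE ∞ E) s t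
  exact (congrFun this x).trans (by simp)

/-- In the trivialization `e` a derivation `D` of sections over the vector field `ξ` is
`τ ↦ ξ(τ) + Γ τ`. -/
theorem coord_derivation (ξ : ∀ x : M, TangentSpace 𝓘(ℝ, VM) x)
    (hD : ∀ (τ fτ : ContMDiffSection 𝓘(ℝ, VM) VE ∞ E) (f : M → ℝ),
      ContMDiff 𝓘(ℝ, VM) 𝓘(ℝ, ℝ) ∞ f → (∀ m, fτ m = f m • τ m) →
      ∀ m, D fτ m = f m • D τ m + dirDeriv f m (ξ m) • τ m)
    (τ : ContMDiffSection 𝓘(ℝ, VM) VE ∞ E) {x : M} (hx : x ∈ φ.nhd) :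
    e.continuousLinearMapAt ℝ x (D τ x) =
      mvfderiv 𝓘(ℝ, VM) (fun y => e.continuousLinearMapAt ℝ y (τ y)) x (ξ x) +
        christoffel e φ D x (e.continuousLinearMapAt ℝ x (τ x)) := by
  let b := Module.finBasis ℝ VE
  let c : Fin (Module.finrank ℝ VE) → VE →L[ℝ] ℝ := fun i =>
    LinearMap.toContinuousLinearMap (b.coord i)
  let g : Fin (Module.finrank ℝ VE) → M → ℝ := fun i y =>
    φ.toFun y * c i (e.continuousLinearMapAt ℝ y (τ y))
  have hg : ∀ i, ContMDiff 𝓘(ℝ, VM) 𝓘(ℝ, ℝ) ∞ (g i) := fun i => by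
    refine contMDiff_of_tsupport (I := 𝓘(ℝ, VM)) fun y hy => ?_
    have hy' : y ∈ e.baseSet := φ.tsupport_subset (closure_mono (by
      intro z hz
      simp only [Function.mem_support, g] at hz ⊢
      exact left_ne_zero_of_mul hz) hy)
    refine (φ.smooth y).mul ?_
    exact (c i).contMDiff.contMDiffAt.comp y (contMDiffAt_continuousLinearMapAt e τ hy')
  let gs : Fin (Module.finrank ℝ VE) → ContMDiffSection 𝓘(ℝ, VM) VE ∞ E := fun i =>
    ⟨fun y => g i y • frameSection e φ (b i) y, (hg i).smul_section (frameSection e φ (b i)).contMDiff⟩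
  -- `τ` is expanded in the frame after multiplication by `φ ^ 2`: one factor makes the coefficients
  -- `g i` global, the other one is contained in the frame sections.
  let s : ContMDiffSection 𝓘(ℝ, VM) VE ∞ E :=
    ⟨fun y => (φ.toFun y * φ.toFun y) • τ y, (φ.smooth.mul φ.smooth).smul_section τ.contMDiff⟩
  have hs : s = ∑ i, gs i := by
    ext y
    rw [ContMDiffSection.sum_apply]
    by_cases hy : y ∈ e.baseSet
    · have h1 := b.sum_repr (e.continuousLinearMapAt ℝ y (τ y))
      have h2 := congrArg (e.symmL ℝ y) h1
      rw [e.symmL_continuousLinearMapAt hy, map_sum] at h2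
      change (φ.toFun y * φ.toFun y) • τ y = _
      conv_lhs => rw [← h2, Finset.smul_sum]
      refine Finset.sum_congr rfl fun i _ => ?_
      change _ = (φ.toFun y * b.repr (e.continuousLinearMapAt ℝ y (τ y)) i) •
        (φ.toFun y • e.symmL ℝ y (b i))
      rw [map_smul, smul_smul, smul_smul]
      ring_nf
    · have h0 : φ.toFun y = 0 := image_eq_zero_of_notMem_tsupport fun h => hy (φ.tsupport_subset h)
      change (φ.toFun y * φ.toFun y) • τ y = ∑ i, (φ.toFun y * _) • _
      simp [h0]
  have hφ1 : (fun y => φ.toFun y * φ.toFun y) =ᶠ[𝓝 x] fun _ => 1 := by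
    filter_upwards [φ.eventually_mem hx] with y hy
    simp [φ.eq_one y hy]
  have h1 : D s x = D τ x := by
    rw [hD τ s (fun y => φ.toFun y * φ.toFun y) (φ.smooth.mul φ.smooth) (fun _ => rfl) x,
      dirDeriv_eq_mvfderiv, mvfderiv_congr hφ1, φ.eq_one x hx, mvfderiv_const]
    simp
  have h2 : D s x = ∑ i, (g i x • D (frameSection e φ (b i)) x +
      dirDeriv (g i) x (ξ x) • frameSection e φ (b i) x) := by
    rw [hs, map_sum, ContMDiffSection.sum_apply]
    exact Finset.sum_congr rfl fun i _ => hD _ _ _ (hg i) (fun _ => rfl) x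
  have hco : ∀ y ∈ φ.nhd, e.continuousLinearMapAt ℝ y (τ y) = ∑ i, g i y • b i := fun y hy => by
    simp only [g, φ.eq_one y hy, one_mul]
    exact (b.sum_repr _).symm
  have h3 : mvfderiv 𝓘(ℝ, VM) (fun y => e.continuousLinearMapAt ℝ y (τ y)) x (ξ x) =
      ∑ i, dirDeriv (g i) x (ξ x) • b i := by
    have hd : MDifferentiableAt 𝓘(ℝ, VM) 𝓘(ℝ, VE)
        (fun y => e.continuousLinearMapAt ℝ y (τ y)) x :=
      (contMDiffAt_continuousLinearMapAt e τ (φ.nhd_subset hx)).mdifferentiableAt (by simp)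
    conv_lhs => rw [← b.sum_repr (mvfderiv 𝓘(ℝ, VM) _ x (ξ x))]
    refine Finset.sum_congr rfl fun i _ => ?_
    congr 1
    have h4 := mvfderiv_clm_comp (c i) hd (ξ x)
    refine h4.symm.trans ?_
    rw [dirDeriv_eq_mvfderiv]
    refine mvfderiv_congr ?_ _
    filter_upwards [φ.eventually_mem hx] with y hy
    simp [g, φ.eq_one y hy]
  rw [← h1, h2, h3, hco x hx, map_sum, map_sum, ← Finset.sum_add_distrib]
  refine Finset.sum_congr rfl fun i _ => ?_
  rw [map_add, map_smul, map_smul, map_smul, coord_frameSection e φ _ hx, christoffel_apply, add_comm]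

end Frames

/-! ### Forms of low degree and their differentials -/

section Forms

variable {VM : Type*} [NormedAddCommGroup VM] [NormedSpace ℝ VM] [FiniteDimensional ℝ VM]
  {M : Type*} [TopologicalSpace M] [T2Space M] [ChartedSpace VM M] [IsManifold 𝓘(ℝ, VM) ∞ M]
  {VE : Type*} [NormedAddCommGroup VE] [NormedSpace ℝ VE] [FiniteDimensional ℝ VE]
  {E : M → Type*} [∀ m, AddCommGroup (E m)] [∀ m, Module ℝ (E m)]
  [∀ m, TopologicalSpace (E m)] [∀ m, IsTopologicalAddGroup (E m)]
  [∀ m, ContinuousSMul ℝ (E m)] [TopologicalSpace (TotalSpace VE E)]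
  [FiberBundle VE E] [VectorBundle ℝ VE E] [ContMDiffVectorBundle ∞ VE E 𝓘(ℝ, VM)]

/-- A cutoff function supported in the domain of the preferred trivialization at `m`. -/
def stdCutoff (VM VE : Type*) [NormedAddCommGroup VM] [NormedSpace ℝ VM] [FiniteDimensional ℝ VM]
    {M : Type*} [TopologicalSpace M] [T2Space M] [ChartedSpace VM M] [IsManifold 𝓘(ℝ, VM) ∞ M]
    [NormedAddCommGroup VE] [NormedSpace ℝ VE]
    (E : M → Type*) [∀ m, AddCommGroup (E m)] [∀ m, Module ℝ (E m)]
    [∀ m, TopologicalSpace (E m)] [TopologicalSpace (TotalSpace VE E)]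
    [FiberBundle VE E] [VectorBundle ℝ VE E] (m : M) :
    Cutoff VM m (trivializationAt VE E m).baseSet :=
  Classical.choice (exists_cutoff
    ((trivializationAt VE E m).open_baseSet.mem_nhds (FiberBundle.mem_baseSet_trivializationAt' m)))

variable (VM VE E) in
/-- A linear choice of global sections through the vectors of the fibre at `m`. -/
def extendSection (m : M) : E m →ₗ[ℝ] ContMDiffSection 𝓘(ℝ, VM) VE ∞ E :=
  frameSection (trivializationAt VE E m) (stdCutoff VM VE E m) ∘ₗ
    ((trivializationAt VE E m).continuousLinearMapAt ℝ m : E m →ₗ[ℝ] VE)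

theorem extendSection_self (m : M) (a : E m) : extendSection VM VE E m a m = a := by
  have hm := FiberBundle.mem_baseSet_trivializationAt' (F := VE) (E := E) m
  change frameSection _ _ _ m = a
  rw [frameSection_of_mem _ _ _ (stdCutoff VM VE E m).mem]
  exact Trivialization.symmL_continuousLinearMapAt _ hm a

/-- A `1`-form as a field of linear functionals. -/
def formLin (θ : FormField E 1) (m : M) : E m →ₗ[ℝ] ℝ :=
  (AlternatingMap.ofSubsingleton ℝ (E m) ℝ (0 : Fin 1)).symm (θ m)

theorem formLin_apply (θ : FormField E 1) (m : M) (a : E m) : formLin θ m a = θ m fun _ => a := rfl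

theorem form_one_apply (θ : FormField E 1) (m : M) (v : Fin 1 → E m) : θ m v = formLin θ m (v 0) := by
  rw [formLin_apply]
  congr 1
  ext i
  rw [Subsingleton.elim i 0]

/-- The field of linear functionals `l` as a `1`-form. -/
def formOfLin (l : ∀ m, E m →ₗ[ℝ] ℝ) : FormField E 1 := fun m =>
  AlternatingMap.ofSubsingleton ℝ (E m) ℝ (0 : Fin 1) (l m)

@[simp] theorem formLin_formOfLin (l : ∀ m, E m →ₗ[ℝ] ℝ) (m : M) :
    formLin (formOfLin l) m = l m := by
  simp [formLin, formOfLin]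

theorem isSmoothForm_one_iff {θ : FormField E 1} : IsSmoothForm VM VE θ ↔
    ∀ τ : ContMDiffSection 𝓘(ℝ, VM) VE ∞ E,
      ContMDiff 𝓘(ℝ, VM) 𝓘(ℝ, ℝ) ∞ fun m => formLin θ m (τ m) := by
  constructor
  · intro h τ
    exact h fun _ => τ
  · intro h σ
    simp only [form_one_apply]
    exact h (σ 0)

section Coord

variable (e : Trivialization VE (TotalSpace.proj : TotalSpace VE E → M)) [MemTrivializationAtlas e]
  {m : M} (φ : Cutoff VM m e.baseSet)

/-- The coefficients of a `1`-form in the trivialization `e`, near `m`. -/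
def formCoord (θ : FormField E 1) (x : M) : VE →L[ℝ] ℝ :=
  LinearMap.toContinuousLinearMap
    { toFun := fun v => formLin θ x (frameSection e φ v x)
      map_add' := fun v w => by simp
      map_smul' := fun c v => by simp }

theorem formCoord_apply (θ : FormField E 1) (x : M) (v : VE) :
    formCoord e φ θ x v = formLin θ x (frameSection e φ v x) := rfl

theorem contMDiff_formCoord {θ : FormField E 1} (hθ : IsSmoothForm VM VE θ) :
    ContMDiff 𝓘(ℝ, VM) 𝓘(ℝ, VE →L[ℝ] ℝ) ∞ (formCoord e φ θ) := fun x =>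
  contMDiffAt_clm_of_apply fun v => isSmoothForm_one_iff.1 hθ (frameSection e φ v) x

theorem formLin_eq_formCoord (θ : FormField E 1) {x : M} (hx : x ∈ φ.nhd) (a : E x) :
    formLin θ x a = formCoord e φ θ x (e.continuousLinearMapAt ℝ x a) := by
  rw [formCoord_apply, frameSection_of_mem e φ _ hx, e.symmL_continuousLinearMapAt (φ.nhd_subset hx)]

theorem dirDeriv_formLin {θ : FormField E 1} (hθ : IsSmoothForm VM VE θ)
    (τ : ContMDiffSection 𝓘(ℝ, VM) VE ∞ E) {x : M} (hx : x ∈ φ.nhd) (w : TangentSpace 𝓘(ℝ, VM) x) :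
    dirDeriv (fun y => formLin θ y (τ y)) x w =
      formCoord e φ θ x (mvfderiv 𝓘(ℝ, VM) (fun y => e.continuousLinearMapAt ℝ y (τ y)) x w) +
        mvfderiv 𝓘(ℝ, VM) (formCoord e φ θ) x w (e.continuousLinearMapAt ℝ x (τ x)) := by
  rw [← mvfderiv_clm_apply ((contMDiff_formCoord e φ hθ x).mdifferentiableAt (by simp))
    ((contMDiffAt_continuousLinearMapAt e τ (φ.nhd_subset hx)).mdifferentiableAt (by simp)),
    dirDeriv_eq_mvfderiv]
  refine mvfderiv_congr ?_ w
  filter_upwards [φ.eventually_mem hx] with y hy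
  exact formLin_eq_formCoord e φ θ hy _

/-- The `1`-form which near `m` is the constant functional `l` in the trivialization `e`. -/
def coframe (l : VE →L[ℝ] ℝ) : FormField E 1 :=
  formOfLin fun x => φ.toFun x • (l.comp (e.continuousLinearMapAt ℝ x) : E x →L[ℝ] ℝ).toLinearMap

theorem formLin_coframe (l : VE →L[ℝ] ℝ) (x : M) (a : E x) :
    formLin (coframe e φ l) x a = φ.toFun x * l (e.continuousLinearMapAt ℝ x a) := by
  simp [coframe]

theorem isSmoothForm_coframe (l : VE →L[ℝ] ℝ) : IsSmoothForm VM VE (coframe e φ l) := by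
  refine isSmoothForm_one_iff.2 fun τ => ?_
  simp only [formLin_coframe]
  refine contMDiff_of_tsupport (I := 𝓘(ℝ, VM)) fun y hy => ?_
  have hy' : y ∈ e.baseSet := φ.tsupport_subset (closure_mono (by
    intro z hz
    simp only [Function.mem_support] at hz ⊢
    exact left_ne_zero_of_mul hz) hy)
  refine (φ.smooth y).mul ?_
  exact l.contMDiff.contMDiffAt.comp y (contMDiffAt_continuousLinearMapAt e τ hy')

theorem formLin_coframe_of_mem (l : VE →L[ℝ] ℝ) {x : M} (hx : x ∈ φ.nhd) (a : E x) :
    formLin (coframe e φ l) x a = l (e.continuousLinearMapAt ℝ x a) := by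
  rw [formLin_coframe, φ.eq_one x hx, one_mul]

end Coord

namespace LieAlgebroid

variable (A : LieAlgebroid VM M VE E)

theorem bracket_antisymm (σ τ : ContMDiffSection 𝓘(ℝ, VM) VE ∞ E) :
    A.bracket σ τ = - A.bracket τ σ := by
  have h := A.bracket_self (σ + τ)
  simp only [map_add, LinearMap.add_apply, A.bracket_self, zero_add, add_zero] at h
  exact eq_neg_of_add_eq_zero_right h

theorem coord_bracket (e : Trivialization VE (TotalSpace.proj : TotalSpace VE E → M))
    [MemTrivializationAtlas e] {m : M} (φ : Cutoff VM m e.baseSet)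
    (σ τ : ContMDiffSection 𝓘(ℝ, VM) VE ∞ E) {x : M} (hx : x ∈ φ.nhd) :
    e.continuousLinearMapAt ℝ x (A.bracket σ τ x) =
      mvfderiv 𝓘(ℝ, VM) (fun y => e.continuousLinearMapAt ℝ y (τ y)) x (A.anchorField σ x) +
        christoffel e φ (A.bracket σ) x (e.continuousLinearMapAt ℝ x (τ x)) :=
  coord_derivation e φ (A.bracket σ) (A.anchorField σ) (A.leibniz σ) τ hx

/-- The values of the exterior differential of a `1`-form on a pair of sections. -/
def dPair (θ : FormField E 1) (σ τ : ContMDiffSection 𝓘(ℝ, VM) VE ∞ E) (m : M) : ℝ :=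
  dirDeriv (fun x => formLin θ x (τ x)) m (A.anchorField σ m) -
    dirDeriv (fun x => formLin θ x (σ x)) m (A.anchorField τ m) - formLin θ m (A.bracket σ τ m)

variable {A} {θ : FormField E 1} (hθ : IsSmoothForm VM VE θ)

theorem dPair_antisymm (σ τ : ContMDiffSection 𝓘(ℝ, VM) VE ∞ E) (m : M) :
    A.dPair θ σ τ m = - A.dPair θ τ σ m := by
  simp only [dPair, A.bracket_antisymm σ τ, ContMDiffSection.coe_neg, Pi.neg_apply, map_neg]
  ring

include hθ

theorem dPair_add_right (σ τ τ' : ContMDiffSection 𝓘(ℝ, VM) VE ∞ E) (m : M) :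
    A.dPair θ σ (τ + τ') m = A.dPair θ σ τ m + A.dPair θ σ τ' m := by
  have h : ∀ τ : ContMDiffSection 𝓘(ℝ, VM) VE ∞ E,
      MDifferentiableAt 𝓘(ℝ, VM) 𝓘(ℝ, ℝ) (fun x => formLin θ x (τ x)) m := fun τ =>
    (isSmoothForm_one_iff.1 hθ τ m).mdifferentiableAt (by simp)
  have h3 : ∀ v : TangentSpace 𝓘(ℝ, VM) m, dirDeriv (fun x => formLin θ x ((τ + τ') x)) m v =
      dirDeriv (fun x => formLin θ x (τ x)) m v + dirDeriv (fun x => formLin θ x (τ' x)) m v := by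
    intro v
    have h4 : (fun x => formLin θ x ((τ + τ') x)) =
      (fun x => formLin θ x (τ x)) + fun x => formLin θ x (τ' x) := by ext x; simp
    rw [h4]
    exact DFunLike.congr_fun (mvfderiv_add (h τ) (h τ')) v
  have h5 : A.anchorField (τ + τ') m = A.anchorField τ m + A.anchorField τ' m :=
    map_add (A.anchor m) _ _
  simp only [dPair]
  rw [h3, h5]
  simp only [map_add, ContMDiffSection.coe_add, Pi.add_apply]
  simp only [dirDeriv_eq_mvfderiv, map_add]
  ring

theorem dPair_smul_right (c : ℝ) (σ τ : ContMDiffSection 𝓘(ℝ, VM) VE ∞ E) (m : M) :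
    A.dPair θ σ (c • τ) m = c * A.dPair θ σ τ m := by
  have h : ∀ τ : ContMDiffSection 𝓘(ℝ, VM) VE ∞ E,
      MDifferentiableAt 𝓘(ℝ, VM) 𝓘(ℝ, ℝ) (fun x => formLin θ x (τ x)) m := fun τ =>
    (isSmoothForm_one_iff.1 hθ τ m).mdifferentiableAt (by simp)
  have h3 : ∀ v : TangentSpace 𝓘(ℝ, VM) m, dirDeriv (fun x => formLin θ x ((c • τ) x)) m v =
      c * dirDeriv (fun x => formLin θ x (τ x)) m v := by
    intro v
    have h4 : (fun x => formLin θ x ((c • τ) x)) =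
      fun x => (c • ContinuousLinearMap.id ℝ ℝ) (formLin θ x (τ x)) := by ext x; simp
    rw [h4]
    exact mvfderiv_clm_comp (c • ContinuousLinearMap.id ℝ ℝ) (h τ) v
  have h5 : A.anchorField (c • τ) m = c • A.anchorField τ m := map_smul (A.anchor m) _ _
  simp only [dPair]
  rw [h3, h5]
  simp only [map_smul, ContMDiffSection.coe_smul, Pi.smul_apply, smul_eq_mul]
  simp only [dirDeriv_eq_mvfderiv, map_smul, smul_eq_mul]
  ring

/-- `dPair` is tensorial: differentiating `θ(τ)` and applying the Leibniz rule to `[σ, τ]` produce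
the same term. -/
theorem dPair_eq_zero (σ : ContMDiffSection 𝓘(ℝ, VM) VE ∞ E) {τ : ContMDiffSection 𝓘(ℝ, VM) VE ∞ E}
    {m : M} (hτ : τ m = 0) : A.dPair θ σ τ m = 0 := by
  have hm := (stdCutoff VM VE E m).mem
  rw [dPair, dirDeriv_formLin _ (stdCutoff VM VE E m) hθ τ hm,
    formLin_eq_formCoord _ (stdCutoff VM VE E m) θ hm, A.coord_bracket _ _ σ τ hm]
  simp only [anchorField, hτ, map_zero, add_zero]
  rw [dirDeriv_eq_mvfderiv, map_zero, sub_zero]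
  exact sub_self (G := ℝ) _

theorem dPair_congr {σ σ' τ τ' : ContMDiffSection 𝓘(ℝ, VM) VE ∞ E} {m : M} (hσ : σ m = σ' m)
    (hτ : τ m = τ' m) : A.dPair θ σ τ m = A.dPair θ σ' τ' m := by
  have key : ∀ (σ τ τ' : ContMDiffSection 𝓘(ℝ, VM) VE ∞ E), τ m = τ' m →
      A.dPair θ σ τ m = A.dPair θ σ τ' m := fun σ τ τ' h => by
    have h0 := dPair_eq_zero (A := A) hθ σ (τ := τ + (-1 : ℝ) • τ') (m := m) (by simp [h])
    rw [dPair_add_right hθ, dPair_smul_right hθ] at h0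
    linarith
  rw [key σ τ τ' hτ, dPair_antisymm, key τ' σ σ' hσ, ← dPair_antisymm]

variable (A) in
/-- The exterior differential of a smooth `1`-form. Its values on vectors are computed with sections
through them; by `dPair_congr` the choice does not matter. -/
def dForm : FormField E 2 := fun m =>
  { toFun := fun v => A.dPair θ (extendSection VM VE E m (v 0)) (extendSection VM VE E m (v 1)) m
    map_update_add' := fun v i a b => by
      have h : ∀ (σ σ' τ : ContMDiffSection 𝓘(ℝ, VM) VE ∞ E),
          A.dPair θ (σ + σ') τ m = A.dPair θ σ τ m + A.dPair θ σ' τ m := fun σ σ' τ => by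
        rw [dPair_antisymm, dPair_add_right hθ, dPair_antisymm σ, dPair_antisymm σ']; ring
      fin_cases i
      · simp [h]
      · simp [dPair_add_right hθ]
    map_update_smul' := fun v i c a => by
      have h : ∀ (σ τ : ContMDiffSection 𝓘(ℝ, VM) VE ∞ E),
          A.dPair θ (c • σ) τ m = c * A.dPair θ σ τ m := fun σ τ => by
        rw [dPair_antisymm, dPair_smul_right hθ, dPair_antisymm σ]; ring
      fin_cases i
      · simp [h]
      · simp [dPair_smul_right hθ]
    map_eq_zero_of_eq' := fun v i j hv hij => by
      have h01 : v 0 = v 1 := by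
        fin_cases i <;> fin_cases j <;> first | exact absurd rfl hij | exact hv | exact hv.symm
      have := dPair_antisymm (A := A) (θ := θ) (extendSection VM VE E m (v 0))
        (extendSection VM VE E m (v 0)) m
      rw [← h01]
      linarith }

theorem dForm_apply (σ : Fin 2 → ContMDiffSection 𝓘(ℝ, VM) VE ∞ E) (m : M) :
    A.dForm hθ m (fun i => σ i m) = A.dPair θ (σ 0) (σ 1) m :=
  dPair_congr hθ (extendSection_self m _) (extendSection_self m _)

omit hθ in
theorem isExtDeriv_one_iff {θ : FormField E 1} {θ' : FormField E 2} : A.IsExtDeriv θ θ' ↔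
    ∀ (σ : Fin 2 → ContMDiffSection 𝓘(ℝ, VM) VE ∞ E) (m : M),
      θ' m (fun i => σ i m) = A.dPair θ (σ 0) (σ 1) m := by
  refine forall_congr' fun σ => forall_congr' fun m => ?_
  have h : ((∑ i : Fin (1 + 1), (-1 : ℝ) ^ (i : ℕ) *
        dirDeriv (fun x => θ x (i.removeNth fun k => σ k x)) m (A.anchorField (σ i) m)) +
      A.bracketSum θ σ m) = A.dPair θ (σ 0) (σ 1) m := by
    simp [bracketSum, dPair, form_one_apply, Fin.sum_univ_two, Fin.removeNth]
    ring
  rw [h]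

theorem isExtDeriv_dForm : A.IsExtDeriv θ (A.dForm hθ) :=
  isExtDeriv_one_iff.2 (dForm_apply hθ)

omit hθ in
theorem isExtDeriv_zero_iff {g : FormField E 0} {θ' : FormField E 1} : A.IsExtDeriv g θ' ↔
    ∀ (τ : ContMDiffSection 𝓘(ℝ, VM) VE ∞ E) (m : M),
      formLin θ' m (τ m) = dirDeriv (fun x => g x ![]) m (A.anchorField τ m) := by
  have h : ∀ (σ : Fin 1 → ContMDiffSection 𝓘(ℝ, VM) VE ∞ E) (m : M),
      ((∑ i : Fin (0 + 1), (-1 : ℝ) ^ (i : ℕ) *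
        dirDeriv (fun x => g x (i.removeNth fun k => σ k x)) m (A.anchorField (σ i) m)) +
      A.bracketSum g σ m) = dirDeriv (fun x => g x ![]) m (A.anchorField (σ 0) m) := by
    intro σ m
    simp [bracketSum]
    have h : (fun x => g x (Fin.tail fun k => σ k x)) = fun x => g x ![] :=
      funext fun x => congrArg _ (Subsingleton.elim _ _)
    rw [h]
  constructor
  · intro H τ m
    have := H (fun _ => τ) m
    rw [h] at this
    exact this
  · intro H σ m
    rw [h, ← H, form_one_apply]

/-- `(d_σ θ)(τ) = ρ(σ)(θ(τ)) - θ([σ, τ])`. -/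
theorem isLieDerivForm_apply {σ : ContMDiffSection 𝓘(ℝ, VM) VE ∞ E} {θ' : FormField E 1}
    (h : A.IsLieDerivForm σ θ θ') (τ : ContMDiffSection 𝓘(ℝ, VM) VE ∞ E) (m : M) :
    formLin θ' m (τ m) = dirDeriv (fun x => formLin θ x (τ x)) m (A.anchorField σ m) -
      formLin θ m (A.bracket σ τ m) := by
  obtain ⟨dα, diα, h1, h2, h3⟩ := h
  have h4 := isExtDeriv_one_iff.1 h1 ![σ, τ] m
  have h5 := isExtDeriv_zero_iff.1 h2 τ m
  have h6 : contract σ dα m (fun _ => τ m) = dα m (fun i => (![σ, τ] : Fin 2 → _) i m) := by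
    simp only [contract, AlternatingMap.curryLeft_apply_apply]
    congr 1
    ext i
    fin_cases i <;> rfl
  have h7 : (fun x => contract σ θ x ![]) = fun x => formLin θ x (σ x) := by
    ext x
    simp only [contract, AlternatingMap.curryLeft_apply_apply]
    exact form_one_apply θ x _
  rw [formLin_apply, h3, AlternatingMap.add_apply, h6, h4, ← formLin_apply, h5, h7]
  simp only [dPair, Matrix.cons_val_zero, Matrix.cons_val_one]
  ring

omit hθ in
theorem exists_isExtDeriv_zero (g : FormField E 0) : ∃ θ', A.IsExtDeriv g θ' :=
  ⟨formOfLin fun m => (mvfderiv 𝓘(ℝ, VM) (fun x => g x ![]) m ∘L A.anchor m).toLinearMap,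
    isExtDeriv_zero_iff.2 fun τ m => by simp; rfl⟩

theorem exists_isLieDerivForm (σ : ContMDiffSection 𝓘(ℝ, VM) VE ∞ E) :
    ∃ θ', A.IsLieDerivForm σ θ θ' := by
  obtain ⟨diα, h⟩ := exists_isExtDeriv_zero (A := A) (contract σ θ)
  exact ⟨fun m => contract σ (A.dForm hθ) m + diα m, A.dForm hθ, diα, isExtDeriv_dForm hθ, h,
    fun _ => rfl⟩

end LieAlgebroid

end Forms

/-! ### Vector fields and curves on total spaces in coordinates -/

section ProductVectorField

variable {VM : Type*} [NormedAddCommGroup VM] [NormedSpace ℝ VM]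
  {M : Type*} [TopologicalSpace M] [ChartedSpace VM M] [IsManifold 𝓘(ℝ, VM) ∞ M]
  {G : Type*} [NormedAddCommGroup G] [NormedSpace ℝ G]

/-- A vector field on `M × G` over a smooth vector field on `M` is smooth if its component in the
vector space `G` is. -/
theorem contMDiffAt_vectorField_prod {ξ : ∀ x : M, TangentSpace 𝓘(ℝ, VM) x}
    (hξ : ContMDiff 𝓘(ℝ, VM) 𝓘(ℝ, VM).tangent ∞ fun x => (⟨x, ξ x⟩ : TangentBundle 𝓘(ℝ, VM) M))
    {u : M → G → G} {q : M × G}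
    (hu : ContMDiffAt (𝓘(ℝ, VM).prod 𝓘(ℝ, G)) 𝓘(ℝ, G) ∞ (fun p : M × G => u p.1 p.2) q) :
    ContMDiffAt (𝓘(ℝ, VM).prod 𝓘(ℝ, G)) (𝓘(ℝ, VM).prod 𝓘(ℝ, G)).tangent ∞
      (fun p => (⟨p, ((ξ p.1, u p.1 p.2) : VM × G)⟩ :
        TangentBundle (𝓘(ℝ, VM).prod 𝓘(ℝ, G)) (M × G))) q := by
  have h1 : ContMDiffAt (𝓘(ℝ, VM).prod 𝓘(ℝ, G)) 𝓘(ℝ, VM).tangent ∞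
      (fun p : M × G => (⟨p.1, ξ p.1⟩ : TangentBundle 𝓘(ℝ, VM) M)) q :=
    (hξ q.1).comp q contMDiffAt_fst
  have h2 : ContMDiffAt (𝓘(ℝ, VM).prod 𝓘(ℝ, G)) 𝓘(ℝ, G).tangent ∞
      (fun p : M × G => (⟨p.2, u p.1 p.2⟩ : TangentBundle 𝓘(ℝ, G) G)) q := by
    refine contMDiffAt_totalSpace.2 ⟨contMDiffAt_snd, ?_⟩
    convert! hu using 1
    ext p
    simp
  exact (contMDiff_equivTangentBundleProd_symm (I := 𝓘(ℝ, VM)) (M := M) (I' := 𝓘(ℝ, G))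
    (M' := G) (n := ∞)).contMDiffAt.comp _ (h1.prodMk h2)

/-- Local existence of a solution of a differential equation in `G` with parameter moving along a
vector field on `M`. -/
theorem exists_curve_prod [CompleteSpace VM] [CompleteSpace G]
    {ξ : ∀ x : M, TangentSpace 𝓘(ℝ, VM) x}
    (hξ : ContMDiff 𝓘(ℝ, VM) 𝓘(ℝ, VM).tangent ∞ fun x => (⟨x, ξ x⟩ : TangentBundle 𝓘(ℝ, VM) M))
    {u : M → G → G} {q : M × G}
    (hu : ContMDiffAt (𝓘(ℝ, VM).prod 𝓘(ℝ, G)) 𝓘(ℝ, G) ∞ (fun p : M × G => u p.1 p.2) q) :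
    ∃ (x : ℝ → M) (g : ℝ → G), x 0 = q.1 ∧ g 0 = q.2 ∧ ∀ᶠ s in 𝓝 (0 : ℝ),
      HasMFDerivAt 𝓘(ℝ, ℝ) 𝓘(ℝ, VM) x s ((1 : ℝ →L[ℝ] ℝ).smulRight (ξ (x s))) ∧
        HasDerivAt g (u (x s) (g s)) s := by
  have : IsManifold (𝓘(ℝ, VM).prod 𝓘(ℝ, G)) 1 (M × G) := IsManifold.of_le (n := ∞) (by simp)
  obtain ⟨γ, h0, hγ⟩ := exists_isMIntegralCurveAt_of_contMDiffAt_boundaryless (t₀ := 0)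
    ((contMDiffAt_vectorField_prod hξ hu).of_le (by simp))
  refine ⟨fun s => (γ s).1, fun s => (γ s).2, congrArg Prod.fst h0,
    congrArg Prod.snd h0, ?_⟩
  filter_upwards [hγ] with s hs
  have h1 := (hasMFDerivAt_fst (I := 𝓘(ℝ, VM)) (I' := 𝓘(ℝ, G)) (γ s)).comp s hs
  have h2 := (hasMFDerivAt_snd (I := 𝓘(ℝ, VM)) (I' := 𝓘(ℝ, G)) (γ s)).comp s hs
  refine ⟨h1.congr_mfderiv (ContinuousLinearMap.ext_ring (M₁ := VM) rfl), ?_⟩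
  have h3 : HasFDerivAt (fun s => (γ s).2)
      ((1 : ℝ →L[ℝ] ℝ).smulRight (u (γ s).1 (γ s).2)) s :=
    hasMFDerivAt_iff_hasFDerivAt.1 (h2.congr_mfderiv (ContinuousLinearMap.ext_ring (M₁ := G) rfl))
  exact h3.hasDerivAt.congr_deriv (by simp)

end ProductVectorField

section TotalSpaceCoordinates

variable {VM : Type*} [NormedAddCommGroup VM] [NormedSpace ℝ VM] [FiniteDimensional ℝ VM]
  {M : Type*} [TopologicalSpace M] [ChartedSpace VM M] [IsManifold 𝓘(ℝ, VM) ∞ M]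
  {VE : Type*} [NormedAddCommGroup VE] [NormedSpace ℝ VE] [FiniteDimensional ℝ VE]
  {E : M → Type*} [∀ m, AddCommGroup (E m)] [∀ m, Module ℝ (E m)]
  [∀ m, TopologicalSpace (E m)] [TopologicalSpace (TotalSpace VE E)]
  [FiberBundle VE E] [VectorBundle ℝ VE E] [ContMDiffVectorBundle ∞ VE E 𝓘(ℝ, VM)]
  (e : Trivialization VE (TotalSpace.proj : TotalSpace VE E → M)) [MemTrivializationAtlas e]

/-- The fibre coordinate of a point of the total space in the trivialization `e`. -/
def fiberCoord (a : TotalSpace VE E) : VE := e.continuousLinearMapAt ℝ a.proj a.2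

theorem fiberCoord_eq {a : TotalSpace VE E} (ha : a.proj ∈ e.baseSet) : fiberCoord e a = (e a).2 := by
  simp [fiberCoord, Trivialization.coe_linearMapAt_of_mem _ ha]

theorem trivialization_apply {a : TotalSpace VE E} (ha : a.proj ∈ e.baseSet) :
    e a = (a.proj, fiberCoord e a) := by
  rw [fiberCoord_eq e ha]
  exact Prod.ext (e.coe_fst' ha) rfl

theorem eventually_proj_mem {U : Set M} (hU : IsOpen U) {a : TotalSpace VE E} (ha : a.proj ∈ U) :
    ∀ᶠ b in 𝓝 a, b.proj ∈ U :=
  (FiberBundle.continuous_proj VE E).continuousAt.preimage_mem_nhds (hU.mem_nhds ha)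

theorem contMDiffAt_fiberCoord {a : TotalSpace VE E} (ha : a.proj ∈ e.baseSet) :
    ContMDiffAt (𝓘(ℝ, VM).prod 𝓘(ℝ, VE)) 𝓘(ℝ, VE) ∞ (fiberCoord e) a := by
  have h := ((e.contMDiffAt_iff (n := ∞) (IB := 𝓘(ℝ, VM)) (IM := 𝓘(ℝ, VM).prod 𝓘(ℝ, VE))
    (f := id) (x₀ := a) (e.mem_source.2 ha)).1 contMDiffAt_id).2
  refine h.congr_of_eventuallyEq ?_
  filter_upwards [eventually_proj_mem e.open_baseSet ha] with b hb
  exact fiberCoord_eq e hb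

theorem mdifferentiableAt_fiberCoord {a : TotalSpace VE E} (ha : a.proj ∈ e.baseSet) :
    MDifferentiableAt (𝓘(ℝ, VM).prod 𝓘(ℝ, VE)) 𝓘(ℝ, VE) (fiberCoord e) a :=
  (contMDiffAt_fiberCoord (VM := VM) e ha).mdifferentiableAt (by simp)

variable (VM) in
theorem mdifferentiable_trivialization :
    e.toOpenPartialHomeomorph.MDifferentiable (𝓘(ℝ, VM).prod 𝓘(ℝ, VE)) (𝓘(ℝ, VM).prod 𝓘(ℝ, VE)) :=
  have : ContMDiffVectorBundle 1 VE E 𝓘(ℝ, VM) := ContMDiffVectorBundle.of_le (n := ∞) (by simp)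
  Trivialization.mdifferentiable E e

theorem mfderiv_trivialization {a : TotalSpace VE E} (ha : a.proj ∈ e.baseSet)
    (v : TangentSpace (𝓘(ℝ, VM).prod 𝓘(ℝ, VE)) a) :
    (mfderiv (𝓘(ℝ, VM).prod 𝓘(ℝ, VE)) (𝓘(ℝ, VM).prod 𝓘(ℝ, VE)) e a v : VM × VE) =
      (mfderiv (𝓘(ℝ, VM).prod 𝓘(ℝ, VE)) 𝓘(ℝ, VM) (TotalSpace.proj : TotalSpace VE E → M) a v,
        mvfderiv (𝓘(ℝ, VM).prod 𝓘(ℝ, VE)) (fiberCoord e) a v) := by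
  have h1 : MDifferentiableAt (𝓘(ℝ, VM).prod 𝓘(ℝ, VE)) 𝓘(ℝ, VM)
      (TotalSpace.proj : TotalSpace VE E → M) a :=
    (contMDiffAt_proj E (n := ∞)).mdifferentiableAt (by simp)
  have h2 := h1.hasMFDerivAt.prodMk (mdifferentiableAt_fiberCoord (VM := VM) e ha).hasMFDerivAt
  have h3 : (e : TotalSpace VE E → M × VE) =ᶠ[𝓝 a] fun b => (b.proj, fiberCoord e b) := by
    filter_upwards [eventually_proj_mem e.open_baseSet ha] with b hb
    exact trivialization_apply e hb
  have h4 := (h2.congr_of_eventuallyEq h3).mfderiv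
  exact DFunLike.congr_fun (F := VM × VE →L[ℝ] VM × VE) h4 v

theorem exists_vector_of_coord {a : TotalSpace VE E} (ha : a.proj ∈ e.baseSet)
    (p : TangentSpace 𝓘(ℝ, VM) a.proj) (u : VE) :
    ∃ v : TangentSpace (𝓘(ℝ, VM).prod 𝓘(ℝ, VE)) a,
      mfderiv (𝓘(ℝ, VM).prod 𝓘(ℝ, VE)) 𝓘(ℝ, VM) (TotalSpace.proj : TotalSpace VE E → M) a v = p ∧
        mvfderiv (𝓘(ℝ, VM).prod 𝓘(ℝ, VE)) (fiberCoord e) a v = u := by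
  obtain ⟨v, hv⟩ := ((mdifferentiable_trivialization VM e).mfderiv_bijective
    (e.mem_source.2 ha)).2 ((p, u) : VM × VE)
  have h := (mfderiv_trivialization e ha v).symm.trans hv
  exact ⟨v, congrArg Prod.fst h, congrArg Prod.snd h⟩

theorem vector_ext_coord {a : TotalSpace VE E} (ha : a.proj ∈ e.baseSet)
    {v w : TangentSpace (𝓘(ℝ, VM).prod 𝓘(ℝ, VE)) a}
    (h1 : mfderiv (𝓘(ℝ, VM).prod 𝓘(ℝ, VE)) 𝓘(ℝ, VM) (TotalSpace.proj : TotalSpace VE E → M) a v =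
      mfderiv (𝓘(ℝ, VM).prod 𝓘(ℝ, VE)) 𝓘(ℝ, VM) (TotalSpace.proj : TotalSpace VE E → M) a w)
    (h2 : mvfderiv (𝓘(ℝ, VM).prod 𝓘(ℝ, VE)) (fiberCoord e) a v =
      mvfderiv (𝓘(ℝ, VM).prod 𝓘(ℝ, VE)) (fiberCoord e) a w) : v = w :=
  ((mdifferentiable_trivialization VM e).mfderiv_bijective (e.mem_source.2 ha)).1
    ((mfderiv_trivialization e ha v).trans
      ((Prod.ext h1 h2).trans (mfderiv_trivialization e ha w).symm))

/-- A vector field on the total space is smooth if its coordinates are. -/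
theorem contMDiffAt_vectorField_of_coord {ξ : ∀ x : M, TangentSpace 𝓘(ℝ, VM) x}
    (hξ : ContMDiff 𝓘(ℝ, VM) 𝓘(ℝ, VM).tangent ∞ fun x => (⟨x, ξ x⟩ : TangentBundle 𝓘(ℝ, VM) M))
    {X : ∀ a : TotalSpace VE E, TangentSpace (𝓘(ℝ, VM).prod 𝓘(ℝ, VE)) a}
    {u : M → VE → VE} {a : TotalSpace VE E} (ha : a.proj ∈ e.baseSet)
    (hu : ContMDiffAt (𝓘(ℝ, VM).prod 𝓘(ℝ, VE)) 𝓘(ℝ, VE) ∞ (fun p : M × VE => u p.1 p.2)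
      (a.proj, fiberCoord e a))
    (hX : ∀ᶠ b in 𝓝 a,
      mfderiv (𝓘(ℝ, VM).prod 𝓘(ℝ, VE)) 𝓘(ℝ, VM) (TotalSpace.proj : TotalSpace VE E → M) b (X b) =
        ξ b.proj ∧
      mvfderiv (𝓘(ℝ, VM).prod 𝓘(ℝ, VE)) (fiberCoord e) b (X b) = u b.proj (fiberCoord e b)) :
    ContMDiffAt (𝓘(ℝ, VM).prod 𝓘(ℝ, VE)) (𝓘(ℝ, VM).prod 𝓘(ℝ, VE)).tangent ∞
      (fun b => (⟨b, X b⟩ : TangentBundle (𝓘(ℝ, VM).prod 𝓘(ℝ, VE)) (TotalSpace VE E))) a := by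
  let V : ∀ p : M × VE, TangentSpace (𝓘(ℝ, VM).prod 𝓘(ℝ, VE)) p := fun p =>
    ((ξ p.1, u p.1 p.2) : VM × VE)
  have hV : ContMDiffAt (𝓘(ℝ, VM).prod 𝓘(ℝ, VE)) (𝓘(ℝ, VM).prod 𝓘(ℝ, VE)).tangent ∞
      (fun p => (⟨p, V p⟩ : TangentBundle (𝓘(ℝ, VM).prod 𝓘(ℝ, VE)) (M × VE))) (e a) := by
    rw [trivialization_apply e ha]
    exact contMDiffAt_vectorField_prod hξ hu
  have hinv : ∀ b : TotalSpace VE E, b.proj ∈ e.baseSet →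
      (mfderiv (𝓘(ℝ, VM).prod 𝓘(ℝ, VE)) (𝓘(ℝ, VM).prod 𝓘(ℝ, VE)) e b).IsInvertible := fun b hb =>
    ⟨(mdifferentiable_trivialization VM e).mfderiv (e.mem_source.2 hb), rfl⟩
  have hsm := ContMDiffAt.mpullback_vectorField_preimage (n := ∞) hV
    ((e.contMDiffOn (IB := 𝓘(ℝ, VM)) (n := ∞)).contMDiffAt
      (e.open_source.mem_nhds (e.mem_source.2 ha))) (hinv a ha) (by simp)
  refine hsm.congr_of_eventuallyEq ?_
  filter_upwards [hX, eventually_proj_mem e.open_baseSet ha] with b hb hb'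
  congr 1
  rw [VectorField.mpullback_apply]
  have h5 : mfderiv (𝓘(ℝ, VM).prod 𝓘(ℝ, VE)) (𝓘(ℝ, VM).prod 𝓘(ℝ, VE)) e b (X b) = V (e b) := by
    refine (mfderiv_trivialization e hb' (X b)).trans ?_
    rw [hb.1, hb.2]
    change _ = ((ξ (e b).1, u (e b).1 (e b).2) : VM × VE)
    rw [trivialization_apply e hb']
    rfl
  rw [← h5]
  exact ((hinv b hb').inverse_apply_eq.2 rfl).symm

/-- The curve in the total space with base curve `x` and fibre coordinate `y`. -/
theorem hasMFDerivAt_curve_of_coord {x : ℝ → M} {y : ℝ → VE} {s : ℝ} (hs : x s ∈ e.baseSet)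
    {p : TangentSpace 𝓘(ℝ, VM) (x s)} {u : VE}
    (hx : HasMFDerivAt 𝓘(ℝ, ℝ) 𝓘(ℝ, VM) x s ((1 : ℝ →L[ℝ] ℝ).smulRight p)) (hy : HasDerivAt y u s)
    {v : TangentSpace (𝓘(ℝ, VM).prod 𝓘(ℝ, VE)) (⟨x s, e.symmL ℝ (x s) (y s)⟩ : TotalSpace VE E)}
    (h1 : mfderiv (𝓘(ℝ, VM).prod 𝓘(ℝ, VE)) 𝓘(ℝ, VM) (TotalSpace.proj : TotalSpace VE E → M) _ v = p)
    (h2 : mvfderiv (𝓘(ℝ, VM).prod 𝓘(ℝ, VE)) (fiberCoord e) _ v = u) :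
    HasMFDerivAt 𝓘(ℝ, ℝ) (𝓘(ℝ, VM).prod 𝓘(ℝ, VE))
      (fun t => (⟨x t, e.symmL ℝ (x t) (y t)⟩ : TotalSpace VE E)) s
      ((1 : ℝ →L[ℝ] ℝ).smulRight v) := by
  have hsymm : ∀ z ∈ e.baseSet, ∀ w : VE,
      (⟨z, e.symmL ℝ z w⟩ : TotalSpace VE E) = e.toOpenPartialHomeomorph.symm (z, w) := by
    intro z hz w
    rw [e.symmL_apply hz, ← e.mk_symm hz]
  have hea : e.toOpenPartialHomeomorph (⟨x s, e.symmL ℝ (x s) (y s)⟩ : TotalSpace VE E) =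
      (x s, y s) := by
    change e _ = _
    rw [trivialization_apply e hs]
    exact Prod.ext rfl (e.continuousLinearMapAt_symmL hs (y s))
  have hc := hx.prodMk hy.hasFDerivAt.hasMFDerivAt
  have hd := (mdifferentiable_trivialization VM e).mdifferentiableAt_symm (x := (x s, y s))
    (e.mem_target.2 hs)
  have hcomp := hd.hasMFDerivAt.comp s hc
  have heq : (fun t => (⟨x t, e.symmL ℝ (x t) (y t)⟩ : TotalSpace VE E)) =ᶠ[𝓝 s]
      e.toOpenPartialHomeomorph.symm ∘ fun t => (x t, y t) := by
    filter_upwards [hx.continuousAt.preimage_mem_nhds (e.open_baseSet.mem_nhds hs)] with t ht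
    exact hsymm _ ht _
  have hfin := hcomp.congr_of_eventuallyEq heq
  have h3 := (mfderiv_trivialization e hs v).trans (Prod.ext h1 h2 : _ = ((p, u) : VM × VE))
  have h4 := (mdifferentiable_trivialization VM e).symm_comp_deriv
    (x := (⟨x s, e.symmL ℝ (x s) (y s)⟩ : TotalSpace VE E)) (e.mem_source.2 hs)
  have h5 := DFunLike.congr_fun (F := VM × VE →L[ℝ] VM × VE) h4 v
  refine hfin.congr_mfderiv (ContinuousLinearMap.ext_ring (M₁ := VM × VE) ?_)
  rw [hea] at h5
  have h6 : (mfderiv (𝓘(ℝ, VM).prod 𝓘(ℝ, VE)) (𝓘(ℝ, VM).prod 𝓘(ℝ, VE))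
      e.toOpenPartialHomeomorph.symm (x s, y s) : VM × VE → VM × VE) (p, u) = v := by
    rw [← h3]
    exact h5
  change (mfderiv (𝓘(ℝ, VM).prod 𝓘(ℝ, VE)) (𝓘(ℝ, VM).prod 𝓘(ℝ, VE))
      e.toOpenPartialHomeomorph.symm (x s, y s) : VM × VE → VM × VE) ((1 : ℝ) • p, (1 : ℝ) • u) =
    ((1 : ℝ) • v : VM × VE)
  simp only [one_smul]
  exact h6

end TotalSpaceCoordinates

/-! ### The complete lift of a section and its flow -/

section LocalFlow

variable {V H P : Type*} [NormedAddCommGroup V] [NormedSpace ℝ V] [CompleteSpace V]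
  [TopologicalSpace H] {I : ModelWithCorners ℝ V H} [TopologicalSpace P] [ChartedSpace H P]
  [IsManifold I ∞ P] [BoundarylessManifold I P] [T2Space P]

/-- The local flow of a smooth vector field on a Hausdorff manifold is single-valued. -/
theorem FlowsTo.unique {X : ∀ p : P, TangentSpace I p}
    (hX : ContMDiff I I.tangent ∞ fun p => (⟨p, X p⟩ : TangentBundle I P)) {s : ℝ} {p q q' : P}
    (h : FlowsTo I X s p q) (h' : FlowsTo I X s p q') : q = q' := by
  obtain ⟨γ, a, b, h0, hs, hγ, rfl, rfl⟩ := h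
  obtain ⟨γ', a', b', h0', hs', hγ', h1, rfl⟩ := h'
  have hsub : Ioo (max a a') (min b b') = Ioo a b ∩ Ioo a' b' := Ioo_inter_Ioo.symm
  have : IsManifold I 1 P := IsManifold.of_le (n := ∞) (by simp)
  refine isMIntegralCurveOn_Ioo_eqOn_of_contMDiff_boundaryless (v := X) (a := max a a')
    (b := min b b') (t₀ := 0) (hsub ▸ ⟨h0, h0'⟩) (hX.of_le (by simp))
    (hγ.mono (hsub ▸ inter_subset_left)) (hγ'.mono (hsub ▸ inter_subset_right)) h1.symm
    (hsub ▸ ⟨hs, hs'⟩)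

end LocalFlow

section CompleteLift

variable {VM : Type*} [NormedAddCommGroup VM] [NormedSpace ℝ VM] [FiniteDimensional ℝ VM]
  {M : Type*} [TopologicalSpace M] [T2Space M] [ChartedSpace VM M] [IsManifold 𝓘(ℝ, VM) ∞ M]
  {VE : Type*} [NormedAddCommGroup VE] [NormedSpace ℝ VE] [FiniteDimensional ℝ VE]
  {E : M → Type*} [∀ m, AddCommGroup (E m)] [∀ m, Module ℝ (E m)]
  [∀ m, TopologicalSpace (E m)] [∀ m, IsTopologicalAddGroup (E m)]
  [∀ m, ContinuousSMul ℝ (E m)] [TopologicalSpace (TotalSpace VE E)]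
  [FiberBundle VE E] [VectorBundle ℝ VE E] [ContMDiffVectorBundle ∞ VE E 𝓘(ℝ, VM)]

theorem mdifferentiableAt_totalSpace_proj (a : TotalSpace VE E) :
    MDifferentiableAt (𝓘(ℝ, VM).prod 𝓘(ℝ, VE)) 𝓘(ℝ, VM)
      (TotalSpace.proj : TotalSpace VE E → M) a :=
  (contMDiffAt_proj E (n := ∞)).mdifferentiableAt (by simp)

theorem mvfderiv_comp_proj {W : Type*} [NormedAddCommGroup W] [NormedSpace ℝ W] {T : M → W}
    {a : TotalSpace VE E} (hT : MDifferentiableAt 𝓘(ℝ, VM) 𝓘(ℝ, W) T a.proj)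
    (v : TangentSpace (𝓘(ℝ, VM).prod 𝓘(ℝ, VE)) a) :
    mvfderiv (𝓘(ℝ, VM).prod 𝓘(ℝ, VE)) (fun b : TotalSpace VE E => T b.proj) a v =
      mvfderiv 𝓘(ℝ, VM) T a.proj (mfderiv (𝓘(ℝ, VM).prod 𝓘(ℝ, VE)) 𝓘(ℝ, VM)
        (TotalSpace.proj : TotalSpace VE E → M) a v) := by
  have h := (hT.hasMFDerivAt.comp a (mdifferentiableAt_totalSpace_proj a).hasMFDerivAt).mfderiv
  exact DFunLike.congr_fun (F := VM × VE →L[ℝ] W) h v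

section Coord

variable (e : Trivialization VE (TotalSpace.proj : TotalSpace VE E → M)) [MemTrivializationAtlas e]
  {m : M} (φ : Cutoff VM m e.baseSet)

theorem mvfderiv_formLin {θ : FormField E 1} (hθ : IsSmoothForm VM VE θ) {a : TotalSpace VE E}
    (ha : a.proj ∈ φ.nhd) (v : TangentSpace (𝓘(ℝ, VM).prod 𝓘(ℝ, VE)) a) :
    mvfderiv (𝓘(ℝ, VM).prod 𝓘(ℝ, VE)) (fun b : TotalSpace VE E => formLin θ b.proj b.2) a v =
      formCoord e φ θ a.proj (mvfderiv (𝓘(ℝ, VM).prod 𝓘(ℝ, VE)) (fiberCoord e) a v) +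
        mvfderiv 𝓘(ℝ, VM) (formCoord e φ θ) a.proj (mfderiv (𝓘(ℝ, VM).prod 𝓘(ℝ, VE)) 𝓘(ℝ, VM)
          (TotalSpace.proj : TotalSpace VE E → M) a v) (fiberCoord e a) := by
  have hT : MDifferentiableAt 𝓘(ℝ, VM) 𝓘(ℝ, VE →L[ℝ] ℝ) (formCoord e φ θ) a.proj :=
    (contMDiff_formCoord e φ hθ a.proj).mdifferentiableAt (by simp)
  rw [← mvfderiv_comp_proj hT, ← mvfderiv_clm_apply
    (T := fun b : TotalSpace VE E => formCoord e φ θ b.proj) (hT.comp a (mdifferentiableAt_totalSpace_proj a))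
    (mdifferentiableAt_fiberCoord e (φ.nhd_subset ha))]
  refine mvfderiv_congr ?_ v
  filter_upwards [eventually_proj_mem φ.isOpen ha] with b hb
  exact formLin_eq_formCoord e φ θ hb _

namespace LieAlgebroid

variable (A : LieAlgebroid VM M VE E) (σ : ContMDiffSection 𝓘(ℝ, VM) VE ∞ E)

/-- In coordinates the Lie derivative of a `1`-form `θ` is `ξ(θ) - θ ∘ Γ`. -/
theorem formLin_lieDeriv {θ θ' : FormField E 1} (hθ : IsSmoothForm VM VE θ)
    (h : A.IsLieDerivForm σ θ θ') {x : M} (hx : x ∈ φ.nhd) (a : E x) :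
    formLin θ' x a =
      mvfderiv 𝓘(ℝ, VM) (formCoord e φ θ) x (A.anchorField σ x) (e.continuousLinearMapAt ℝ x a) -
        formCoord e φ θ x (christoffel e φ (A.bracket σ) x (e.continuousLinearMapAt ℝ x a)) := by
  set y := e.continuousLinearMapAt ℝ x a with hy
  have ha : frameSection e φ y x = a := by
    rw [frameSection_of_mem e φ _ hx, hy, e.symmL_continuousLinearMapAt (φ.nhd_subset hx)]
  have h1 := isLieDerivForm_apply (A := A) hθ h (frameSection e φ y) x
  have hc : (fun z => e.continuousLinearMapAt ℝ z (frameSection e φ y z)) =ᶠ[𝓝 x] fun _ => y := by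
    filter_upwards [φ.eventually_mem hx] with z hz using coord_frameSection e φ y hz
  rw [ha, dirDeriv_formLin e φ hθ _ hx, mvfderiv_congr hc, mvfderiv_const,
    formLin_eq_formCoord e φ θ hx (A.bracket σ _ x), ← christoffel_apply, ha] at h1
  change _ = formCoord e φ θ x 0 + _ - _ at h1
  rw [map_zero, zero_add] at h1
  exact h1

/-- The characterization of the complete lift at a point, read in the trivialization `e`. -/
theorem liftVector_iff {a : TotalSpace VE E} (ha : a.proj ∈ φ.nhd)
    {v : TangentSpace (𝓘(ℝ, VM).prod 𝓘(ℝ, VE)) a}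
    (hv : mfderiv (𝓘(ℝ, VM).prod 𝓘(ℝ, VE)) 𝓘(ℝ, VM) (TotalSpace.proj : TotalSpace VE E → M) a v =
      A.anchorField σ a.proj) :
    (∀ θ : FormField E 1, IsSmoothForm VM VE θ → ∃ θ' : FormField E 1, A.IsLieDerivForm σ θ θ' ∧
      mfderiv (𝓘(ℝ, VM).prod 𝓘(ℝ, VE)) 𝓘(ℝ, ℝ)
          (fun b : TotalSpace VE E => θ b.proj ![b.2]) a v = θ' a.proj ![a.2]) ↔
      mvfderiv (𝓘(ℝ, VM).prod 𝓘(ℝ, VE)) (fiberCoord e) a v =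
        - christoffel e φ (A.bracket σ) a.proj (fiberCoord e a) := by
  have key : ∀ (θ θ' : FormField E 1), IsSmoothForm VM VE θ → A.IsLieDerivForm σ θ θ' →
      ((mfderiv (𝓘(ℝ, VM).prod 𝓘(ℝ, VE)) 𝓘(ℝ, ℝ)
          (fun b : TotalSpace VE E => θ b.proj ![b.2]) a v = θ' a.proj ![a.2]) ↔
        formCoord e φ θ a.proj (mvfderiv (𝓘(ℝ, VM).prod 𝓘(ℝ, VE)) (fiberCoord e) a v) =
        formCoord e φ θ a.proj (- christoffel e φ (A.bracket σ) a.proj (fiberCoord e a))) := by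
    intro θ θ' hθ hθ'
    have h1 := mvfderiv_formLin e φ hθ ha v
    have h2 := A.formLin_lieDeriv e φ σ hθ hθ' ha a.2
    rw [hv] at h1
    have h3 : (fun b : TotalSpace VE E => θ b.proj ![b.2]) = fun b => formLin θ b.proj b.2 := by
      ext b
      exact form_one_apply θ _ _
    have h4 : θ' a.proj ![a.2] = formLin θ' a.proj a.2 := form_one_apply θ' _ _
    rw [h3, h4, h2]
    change mvfderiv _ _ a v = (_ : ℝ) ↔ _
    rw [h1, map_neg]
    constructor <;> intro h
    · simp only [fiberCoord] at h ⊢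
      linarith
    · simp only [fiberCoord] at h ⊢
      linarith
  constructor
  · intro h
    refine (SeparatingDual.eq_iff_forall_dual_eq (R := ℝ)).2 fun l => ?_
    have hl := isSmoothForm_coframe e φ l
    obtain ⟨θ', h1, h2⟩ := h _ hl
    have h3 := (key _ θ' hl h1).1 h2
    have h4 : ∀ w, formCoord e φ (coframe e φ l) a.proj w = l w := fun w => by
      rw [formCoord_apply, formLin_coframe_of_mem e φ l ha, coord_frameSection e φ w ha]
    rwa [h4, h4] at h3
  · intro h θ hθ
    obtain ⟨θ', hθ'⟩ := exists_isLieDerivForm (A := A) hθ σ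
    exact ⟨θ', hθ', (key θ θ' hθ hθ').2 (by rw [h])⟩

variable {A σ} in
theorem IsLift.coord {X : ∀ a : TotalSpace VE E, TangentSpace (𝓘(ℝ, VM).prod 𝓘(ℝ, VE)) a}
    (h : A.IsLift σ X) {a : TotalSpace VE E} (ha : a.proj ∈ φ.nhd) :
    mvfderiv (𝓘(ℝ, VM).prod 𝓘(ℝ, VE)) (fiberCoord e) a (X a) =
        - christoffel e φ (A.bracket σ) a.proj (fiberCoord e a) :=
  (A.liftVector_iff e φ σ ha (h.2.1 a)).1 fun θ hθ => by
    obtain ⟨θ', h1, h2⟩ := h.2.2 θ hθ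
    exact ⟨θ', h1, h2 a⟩

end LieAlgebroid

end Coord

namespace LieAlgebroid

variable (A : LieAlgebroid VM M VE E) (σ : ContMDiffSection 𝓘(ℝ, VM) VE ∞ E)

theorem contMDiff_anchorField : ContMDiff 𝓘(ℝ, VM) 𝓘(ℝ, VM).tangent ∞
    fun x => (⟨x, A.anchorField σ x⟩ : TangentBundle 𝓘(ℝ, VM) M) :=
  ContMDiff.clm_bundle_apply (b := fun x : M => x) A.anchor.contMDiff σ.contMDiff

variable {A σ} in
theorem IsLift.unique {X X' : ∀ a : TotalSpace VE E, TangentSpace (𝓘(ℝ, VM).prod 𝓘(ℝ, VE)) a}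
    (h : A.IsLift σ X) (h' : A.IsLift σ X') : X = X' := by
  funext a
  have hm := (stdCutoff VM VE E a.proj).mem
  exact vector_ext_coord (trivializationAt VE E a.proj)
    (FiberBundle.mem_baseSet_trivializationAt' a.proj)
    ((h.2.1 a).trans (h'.2.1 a).symm)
    ((h.coord _ (stdCutoff VM VE E a.proj) hm).trans
      (h'.coord _ (stdCutoff VM VE E a.proj) hm).symm)

variable {σ} in
theorem exists_liftVector (a : TotalSpace VE E) :
    ∃ v : TangentSpace (𝓘(ℝ, VM).prod 𝓘(ℝ, VE)) a,
      mfderiv (𝓘(ℝ, VM).prod 𝓘(ℝ, VE)) 𝓘(ℝ, VM) (TotalSpace.proj : TotalSpace VE E → M) a v =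
        A.anchorField σ a.proj ∧
      ∀ θ : FormField E 1, IsSmoothForm VM VE θ → ∃ θ' : FormField E 1, A.IsLieDerivForm σ θ θ' ∧
        mfderiv (𝓘(ℝ, VM).prod 𝓘(ℝ, VE)) 𝓘(ℝ, ℝ)
          (fun b : TotalSpace VE E => θ b.proj ![b.2]) a v = θ' a.proj ![a.2] := by
  obtain ⟨v, h1, h2⟩ := exists_vector_of_coord (trivializationAt VE E a.proj)
    (a := a) (FiberBundle.mem_baseSet_trivializationAt' a.proj) (A.anchorField σ a.proj)
    (- christoffel (trivializationAt VE E a.proj) (stdCutoff VM VE E a.proj) (A.bracket σ) a.proj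
      (fiberCoord (trivializationAt VE E a.proj) a))
  exact ⟨v, h1, (A.liftVector_iff _ (stdCutoff VM VE E a.proj) σ
    (stdCutoff VM VE E a.proj).mem h1).2 h2⟩

theorem exists_isLift : ∃ X, A.IsLift σ X := by
  choose X hX1 hX3 using A.exists_liftVector (σ := σ)
  refine ⟨X, fun a => ?_, hX1, fun θ hθ => ?_⟩
  · have hb := FiberBundle.mem_baseSet_trivializationAt' (F := VE) (E := E) a.proj
    refine contMDiffAt_vectorField_of_coord (trivializationAt VE E a.proj)
      (A.contMDiff_anchorField σ)
      (u := fun x y => - christoffel (trivializationAt VE E a.proj)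
        (stdCutoff VM VE E a.proj) (A.bracket σ) x y) hb ?_ ?_
    · have hΓ : ContMDiffAt (𝓘(ℝ, VM).prod 𝓘(ℝ, VE)) 𝓘(ℝ, VE →L[ℝ] VE) ∞
          (christoffel (trivializationAt VE E a.proj) (stdCutoff VM VE E a.proj) (A.bracket σ) ∘
            Prod.fst) (a.proj, fiberCoord (trivializationAt VE E a.proj) a) :=
        ContMDiffAt.comp (I' := 𝓘(ℝ, VM)) _ (contMDiffAt_christoffel (trivializationAt VE E a.proj)
          (stdCutoff VM VE E a.proj) (A.bracket σ) hb) contMDiffAt_fst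
      exact (hΓ.clm_apply contMDiffAt_snd).neg
    · filter_upwards [eventually_proj_mem (stdCutoff VM VE E a.proj).isOpen
        (stdCutoff VM VE E a.proj).mem] with b hb
      exact ⟨hX1 b, (A.liftVector_iff (trivializationAt VE E a.proj)
        (stdCutoff VM VE E a.proj) σ hb (hX1 b)).1 (hX3 b)⟩
  · obtain ⟨θ', hθ'⟩ := exists_isLieDerivForm (A := A) hθ σ
    refine ⟨θ', hθ', fun a => ?_⟩
    obtain ⟨θ'', h1, h2⟩ := hX3 a θ hθ
    refine h2.trans ((form_one_apply θ'' _ _).trans (Eq.trans ?_ (form_one_apply θ' _ _).symm))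
    have hm := (stdCutoff VM VE E a.proj).mem
    exact (A.formLin_lieDeriv (trivializationAt VE E a.proj) (stdCutoff VM VE E a.proj) σ hθ h1 hm
      a.2).trans (A.formLin_lieDeriv (trivializationAt VE E a.proj) (stdCutoff VM VE E a.proj) σ hθ
        hθ' hm a.2).symm

variable {A σ}

theorem IsLift.sectionFlowsTo_iff
    {X : ∀ a : TotalSpace VE E, TangentSpace (𝓘(ℝ, VM).prod 𝓘(ℝ, VE)) a} (h : A.IsLift σ X)
    {s : ℝ} {a b : TotalSpace VE E} :
    A.SectionFlowsTo σ s a b ↔ FlowsTo (𝓘(ℝ, VM).prod 𝓘(ℝ, VE)) X s a b :=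
  ⟨fun ⟨_, h1, h2⟩ => h.unique h1 ▸ h2, fun h1 => ⟨X, h, h1⟩⟩

theorem SectionFlowsTo.unique {s : ℝ} {a b b' : TotalSpace VE E} (h : A.SectionFlowsTo σ s a b)
    (h' : A.SectionFlowsTo σ s a b') : b = b' := by
  obtain ⟨X, hX, h1⟩ := h
  have : T2Space (TotalSpace VE E) := t2Space_totalSpace
  exact h1.unique hX.1 (hX.sectionFlowsTo_iff.1 h')

theorem SectionFlowsTo.proj {s : ℝ} {a b : TotalSpace VE E} (h : A.SectionFlowsTo σ s a b) :
    FlowsTo 𝓘(ℝ, VM) (A.anchorField σ) s a.proj b.proj := by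
  obtain ⟨X, hX, γ, c, d, h0, hs, hγ, rfl, rfl⟩ := h
  refine ⟨fun t => (γ t).proj, c, d, h0, hs, fun t ht => ?_, rfl, rfl⟩
  have h1 := (mdifferentiableAt_totalSpace_proj (VM := VM) (γ t)).hasMFDerivAt.comp_hasMFDerivWithinAt t (hγ t ht)
  refine h1.congr_mfderiv (ContinuousLinearMap.ext_ring (M₁ := VM) ?_)
  change (mfderiv (𝓘(ℝ, VM).prod 𝓘(ℝ, VE)) 𝓘(ℝ, VM) (TotalSpace.proj : TotalSpace VE E → M) (γ t) :
    VM × VE → VM) ((1 : ℝ) • X (γ t)) = ((1 : ℝ) • A.anchorField σ (γ t).proj : VM)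
  rw [one_smul, one_smul]
  exact hX.2.1 (γ t)

end LieAlgebroid

end CompleteLift

/-! ### Morphisms of Lie algebroids in coordinates -/

section TangentVectors

variable {VN : Type*} [NormedAddCommGroup VN] [NormedSpace ℝ VN] [FiniteDimensional ℝ VN]
  {N : Type*} [TopologicalSpace N] [T2Space N] [ChartedSpace VN N] [IsManifold 𝓘(ℝ, VN) ∞ N]

/-- Tangent vectors are separated by globally defined smooth functions. -/
theorem tangentVector_ext {n : N} {u v : TangentSpace 𝓘(ℝ, VN) n}
    (h : ∀ g : N → ℝ, ContMDiff 𝓘(ℝ, VN) 𝓘(ℝ, ℝ) ∞ g → dirDeriv g n u = dirDeriv g n v) :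
    u = v := by
  obtain ⟨φ⟩ := exists_cutoff (VM := VN) (chart_source_mem_nhds VN n)
  have hinj := (isInvertible_mfderiv_extChartAt (I := 𝓘(ℝ, VN)) (mem_extChartAt_source n)).injective
  refine hinj ((SeparatingDual.eq_iff_forall_dual_eq (R := ℝ) (V := VN)).2 fun l => ?_)
  have hs : ∀ y ∈ (chartAt VN n).source,
      ContMDiffAt 𝓘(ℝ, VN) 𝓘(ℝ, ℝ) ∞ (fun y => l (extChartAt 𝓘(ℝ, VN) n y)) y := fun y hy =>
    l.contMDiff.contMDiffAt.comp y (contMDiffAt_extChartAt' hy)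
  have hg : ContMDiff 𝓘(ℝ, VN) 𝓘(ℝ, ℝ) ∞ fun y => φ.toFun y * l (extChartAt 𝓘(ℝ, VN) n y) := by
    refine contMDiff_of_tsupport (I := 𝓘(ℝ, VN)) fun y hy => ?_
    refine (φ.smooth y).mul (hs y (φ.tsupport_subset (closure_mono (fun z hz => ?_) hy)))
    exact left_ne_zero_of_mul hz
  have h1 : ∀ w : TangentSpace 𝓘(ℝ, VN) n,
      dirDeriv (fun y => φ.toFun y * l (extChartAt 𝓘(ℝ, VN) n y)) n w =
        l (mfderiv 𝓘(ℝ, VN) 𝓘(ℝ, VN) (extChartAt 𝓘(ℝ, VN) n) n w) := fun w => by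
    refine Eq.trans ?_ (mvfderiv_clm_comp l (mdifferentiableAt_extChartAt (mem_chart_source VN n)) w)
    refine mvfderiv_congr ?_ w
    filter_upwards [φ.eventually_mem φ.mem] with y hy
    rw [φ.eq_one y hy, one_mul]
  have h2 := h _ hg
  rw [h1, h1] at h2
  exact h2

end TangentVectors

section BundleMaps

variable {VM : Type*} [NormedAddCommGroup VM] [NormedSpace ℝ VM] [FiniteDimensional ℝ VM]
  {M : Type*} [TopologicalSpace M] [T2Space M] [ChartedSpace VM M] [IsManifold 𝓘(ℝ, VM) ∞ M]
  {VN : Type*} [NormedAddCommGroup VN] [NormedSpace ℝ VN] [FiniteDimensional ℝ VN]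
  {N : Type*} [TopologicalSpace N] [T2Space N] [ChartedSpace VN N] [IsManifold 𝓘(ℝ, VN) ∞ N]
  {VE : Type*} [NormedAddCommGroup VE] [NormedSpace ℝ VE] [FiniteDimensional ℝ VE]
  {E : M → Type*} [∀ m, AddCommGroup (E m)] [∀ m, Module ℝ (E m)]
  [∀ m, TopologicalSpace (E m)] [∀ m, IsTopologicalAddGroup (E m)]
  [∀ m, ContinuousSMul ℝ (E m)] [TopologicalSpace (TotalSpace VE E)]
  [FiberBundle VE E] [VectorBundle ℝ VE E] [ContMDiffVectorBundle ∞ VE E 𝓘(ℝ, VM)]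
  {VF : Type*} [NormedAddCommGroup VF] [NormedSpace ℝ VF] [FiniteDimensional ℝ VF]
  {F : N → Type*} [∀ n, AddCommGroup (F n)] [∀ n, Module ℝ (F n)]
  [∀ n, TopologicalSpace (F n)] [∀ n, IsTopologicalAddGroup (F n)]
  [∀ n, ContinuousSMul ℝ (F n)] [TopologicalSpace (TotalSpace VF F)]
  [FiberBundle VF F] [VectorBundle ℝ VF F] [ContMDiffVectorBundle ∞ VF F 𝓘(ℝ, VN)]
  {ν : ContMDiffMap 𝓘(ℝ, VM) 𝓘(ℝ, VN) M N ∞}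

instance pullback_memTrivializationAtlas
    (f : Trivialization VF (TotalSpace.proj : TotalSpace VF F → N)) [MemTrivializationAtlas f] :
    MemTrivializationAtlas (f.pullback ν) := ⟨⟨f, ‹_›, rfl⟩⟩

section Coord

variable (e : Trivialization VE (TotalSpace.proj : TotalSpace VE E → M)) [MemTrivializationAtlas e]
  (f : Trivialization VF (TotalSpace.proj : TotalSpace VF F → N)) [MemTrivializationAtlas f]

/-- The matrix of `θ` in the trivializations `e` and `f`. -/
def mapCoord (θ : BundleMapOver VE E VF F ν) (x : M) : VE →L[ℝ] VF :=
  f.continuousLinearMapAt ℝ (ν x) ∘L fiberMap θ x ∘L e.symmL ℝ x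

theorem mapCoord_apply (θ : BundleMapOver VE E VF F ν) (x : M) (v : VE) :
    mapCoord e f θ x v = f.continuousLinearMapAt ℝ (ν x) (fiberMap θ x (e.symmL ℝ x v)) := rfl

theorem mapCoord_coord (θ : BundleMapOver VE E VF F ν) {x : M} (hx : x ∈ e.baseSet) (a : E x) :
    mapCoord e f θ x (e.continuousLinearMapAt ℝ x a) =
      f.continuousLinearMapAt ℝ (ν x) (fiberMap θ x a) := by
  rw [mapCoord_apply, e.symmL_continuousLinearMapAt hx]

theorem contMDiffAt_mapCoord (θ : BundleMapOver VE E VF F ν) {x : M} (hx : x ∈ e.baseSet)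
    (hνx : ν x ∈ f.baseSet) : ContMDiffAt 𝓘(ℝ, VM) 𝓘(ℝ, VE →L[ℝ] VF) ∞ (mapCoord e f θ) x := by
  refine contMDiffAt_clm_of_apply fun v => ?_
  obtain ⟨φ⟩ := exists_cutoff (VM := VM) (e.open_baseSet.mem_nhds hx)
  have h1 : ContMDiff 𝓘(ℝ, VM) (𝓘(ℝ, VM).prod 𝓘(ℝ, VF)) ∞
      (fun y : M => (⟨y, θ y (frameSection e φ v y)⟩ : TotalSpace VF ((ν : M → N) *ᵖ F))) :=
    ContMDiff.clm_bundle_apply (b := fun x : M => x) θ.contMDiff (frameSection e φ v).contMDiff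
  have hs : (⟨x, θ x (frameSection e φ v x)⟩ : TotalSpace VF ((ν : M → N) *ᵖ F)) ∈
      (f.pullback ν).source := (f.pullback ν).mem_source.2 hνx
  have h2 := (((f.pullback ν).contMDiffAt_iff (n := ∞) (x₀ := x)
    (f := fun y : M => (⟨y, θ y (frameSection e φ v y)⟩ : TotalSpace VF ((ν : M → N) *ᵖ F))) hs).1
    (h1 x)).2
  refine h2.congr_of_eventuallyEq ?_
  filter_upwards [φ.eventually_mem φ.mem, ν.contMDiff.continuous.continuousAt.preimage_mem_nhds
    (f.open_baseSet.mem_nhds hνx)] with y hy hy'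
  rw [mapCoord_apply, ← frameSection_of_mem e φ v hy]
  simp [Trivialization.coe_linearMapAt_of_mem _ hy']
  rfl

end Coord

variable {A : LieAlgebroid VM M VE E} {B : LieAlgebroid VN N VF F} {pr : BundleMapOver VE E VF F ν}

/-- A morphism intertwines the anchors: this is `π* d = d π*` on functions. -/
theorem IsLieAlgebroidMorphism.mfderiv_anchor (h : IsLieAlgebroidMorphism A B pr) (m : M) (a : E m) :
    mfderiv 𝓘(ℝ, VM) 𝓘(ℝ, VN) ν m (A.anchor m a) = B.anchor (ν m) (fiberMap pr m a) := by
  refine tangentVector_ext fun g hg => ?_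
  let G : FormField F 0 := fun n => AlternatingMap.constOfIsEmpty ℝ (F n) (Fin 0) (g n)
  obtain ⟨dG, hdG⟩ := LieAlgebroid.exists_isExtDeriv_zero (A := B) G
  have h1 := LieAlgebroid.isExtDeriv_zero_iff.1 (h 0 G dG (fun _ => hg) hdG)
    (extendSection VM VE E m a) m
  have h2 := LieAlgebroid.isExtDeriv_zero_iff.1 hdG
    (extendSection VN VF F (ν m) (fiberMap pr m a)) (ν m)
  simp only [LieAlgebroid.anchorField, extendSection_self] at h1 h2
  have h3 : formLin (pullbackForm pr dG) m a = formLin dG (ν m) (fiberMap pr m a) := by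
    rw [formLin_apply, formLin_apply]; rfl
  have h4 : dirDeriv (fun x => pullbackForm pr G x ![]) m (A.anchor m a) =
      dirDeriv g (ν m) (mfderiv 𝓘(ℝ, VM) 𝓘(ℝ, VN) ν m (A.anchor m a)) := by
    have h5 := ((hg (ν m)).mdifferentiableAt (by simp)).hasMFDerivAt.comp m
      ((ν.contMDiff m).mdifferentiableAt (by simp)).hasMFDerivAt
    exact DFunLike.congr_fun (F := VM →L[ℝ] ℝ) h5.mfderiv _
  rw [← h4, ← h1, h3, h2]
  rfl

variable {σ : ContMDiffSection 𝓘(ℝ, VM) VE ∞ E} {η : ContMDiffSection 𝓘(ℝ, VN) VF ∞ F}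

theorem IsLieAlgebroidMorphism.mfderiv_anchorField (h : IsLieAlgebroidMorphism A B pr)
    (hση : ProjectsOver pr σ η) (m : M) :
    mfderiv 𝓘(ℝ, VM) 𝓘(ℝ, VN) ν m (A.anchorField σ m) = B.anchorField η (ν m) := by
  rw [LieAlgebroid.anchorField, h.mfderiv_anchor, hση]
  rfl

theorem formLin_pullbackForm (α : FormField F 1) (m : M) (a : E m) :
    formLin (pullbackForm pr α) m a = formLin α (ν m) (fiberMap pr m a) := by
  rw [formLin_apply, formLin_apply]; rfl

/-- The matrix `P` of a morphism satisfies `ξ(P) = P Γ - Δ P`, i.e. it is parallel along `ρ(σ)`. This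
is `π* dα = d π*α` for the constant `1`-forms `α` of the trivialization `f`, evaluated on `σ` and a
constant section of `e`. -/
theorem IsLieAlgebroidMorphism.mvfderiv_mapCoord (h : IsLieAlgebroidMorphism A B pr)
    (hση : ProjectsOver pr σ η)
    (e : Trivialization VE (TotalSpace.proj : TotalSpace VE E → M)) [MemTrivializationAtlas e]
    (f : Trivialization VF (TotalSpace.proj : TotalSpace VF F → N)) [MemTrivializationAtlas f]
    {m : M} (φ : Cutoff VM m e.baseSet) {n : N} (χ : Cutoff VN n f.baseSet) {x : M}
    (hx : x ∈ φ.nhd) (hνx : ν x ∈ χ.nhd) (v : VE) :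
    mvfderiv 𝓘(ℝ, VM) (mapCoord e f pr) x (A.anchorField σ x) v =
      mapCoord e f pr x (christoffel e φ (A.bracket σ) x v) -
        christoffel f χ (B.bracket η) (ν x) (mapCoord e f pr x v) := by
  refine (SeparatingDual.eq_iff_forall_dual_eq (R := ℝ) (V := VF)).2 fun l => ?_
  have hl := isSmoothForm_coframe f χ l
  have h1 := h 1 _ _ hl (LieAlgebroid.isExtDeriv_dForm (A := B) hl)
  let τ := frameSection e φ v
  let υ := frameSection f χ (mapCoord e f pr x v)
  have hυ : υ (ν x) = fiberMap pr x (τ x) := by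
    simp only [υ, τ]
    rw [frameSection_of_mem f χ _ hνx, mapCoord_apply,
      f.symmL_continuousLinearMapAt (χ.nhd_subset hνx), frameSection_of_mem e φ v hx]
  have h2 := LieAlgebroid.isExtDeriv_one_iff.1 h1 ![σ, τ] x
  have h3 := LieAlgebroid.dForm_apply (A := B) hl ![η, υ] (ν x)
  have h4 : pullbackForm pr (B.dForm hl) x (fun i => (![σ, τ] : Fin 2 → _) i x) =
      B.dForm hl (ν x) (fun i => (![η, υ] : Fin 2 → _) i (ν x)) := by
    simp only [pullbackForm, AlternatingMap.compLinearMap_apply]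
    congr 1
    ext i
    fin_cases i
    · exact hση x
    · exact hυ.symm
  rw [h4, h3] at h2
  simp only [LieAlgebroid.dPair, Matrix.cons_val_zero, Matrix.cons_val_one] at h2
  simp only [formLin_pullbackForm] at h2
  have hσ' : (fun y => formLin (coframe f χ l) (ν y) (fiberMap pr y (σ y))) =
      (fun z => formLin (coframe f χ l) z (η z)) ∘ ν := by
    ext y
    rw [hση]
    rfl
  -- This derivative occurs in both differentials and cancels.
  have hd1 : dirDeriv (fun y => formLin (coframe f χ l) (ν y) (fiberMap pr y (σ y))) x
      (A.anchorField τ x) =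
      dirDeriv (fun z => formLin (coframe f χ l) z (η z)) (ν x) (B.anchorField υ (ν x)) := by
    have h5 := ((isSmoothForm_one_iff.1 hl η (ν x)).mdifferentiableAt
      (by simp)).hasMFDerivAt.comp x ((ν.contMDiff x).mdifferentiableAt (by simp)).hasMFDerivAt
    have h6 := h.mfderiv_anchor x (τ x)
    rw [hσ', LieAlgebroid.anchorField, LieAlgebroid.anchorField, hυ, ← h6]
    exact DFunLike.congr_fun (F := VM →L[ℝ] ℝ) h5.mfderiv _
  have hd2 : dirDeriv (fun y => formLin (coframe f χ l) (ν y) (fiberMap pr y (τ y))) x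
      (A.anchorField σ x) =
      l (mvfderiv 𝓘(ℝ, VM) (mapCoord e f pr) x (A.anchorField σ x) v) := by
    have hP := (contMDiffAt_mapCoord e f pr (φ.nhd_subset hx) (χ.nhd_subset hνx)).mdifferentiableAt
      (by simp : (∞ : WithTop ℕ∞) ≠ 0)
    refine Eq.trans ?_ (mvfderiv_clm_comp (l ∘L ContinuousLinearMap.apply ℝ VF v) hP _)
    refine mvfderiv_congr ?_ _
    filter_upwards [φ.eventually_mem hx, ν.contMDiff.continuous.continuousAt.preimage_mem_nhds
      (χ.eventually_mem hνx)] with y hy hy'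
    rw [formLin_coframe_of_mem f χ l hy', frameSection_of_mem e φ v hy]
    rfl
  have hd3 : dirDeriv (fun z => formLin (coframe f χ l) z (υ z)) (ν x) (B.anchorField η (ν x)) =
      0 := by
    rw [dirDeriv_eq_mvfderiv, mvfderiv_congr (g := fun _ => l (mapCoord e f pr x v)),
      mvfderiv_const]
    · rfl
    · filter_upwards [χ.eventually_mem hνx] with z hz
      rw [formLin_coframe_of_mem f χ l hz, coord_frameSection f χ _ hz]
  have h7 : formLin (coframe f χ l) (ν x) (fiberMap pr x (A.bracket σ τ x)) =
      l (mapCoord e f pr x (christoffel e φ (A.bracket σ) x v)) := by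
    rw [formLin_coframe_of_mem f χ l hνx, christoffel_apply,
      mapCoord_coord e f pr (φ.nhd_subset hx)]
  have h8 : formLin (coframe f χ l) (ν x) (B.bracket η υ (ν x)) =
      l (christoffel f χ (B.bracket η) (ν x) (mapCoord e f pr x v)) := by
    rw [formLin_coframe_of_mem f χ l hνx, christoffel_apply]
  rw [hd1, hd2, hd3, h7, h8] at h2
  rw [map_sub]
  linarith

end BundleMaps

/-! ### The flows of `σ` and `η` in coordinates -/

section FlowFrames

variable {VM : Type*} [NormedAddCommGroup VM] [NormedSpace ℝ VM] [FiniteDimensional ℝ VM]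
  {M : Type*} [TopologicalSpace M] [T2Space M] [ChartedSpace VM M] [IsManifold 𝓘(ℝ, VM) ∞ M]
  {VN : Type*} [NormedAddCommGroup VN] [NormedSpace ℝ VN] [FiniteDimensional ℝ VN]
  {N : Type*} [TopologicalSpace N] [T2Space N] [ChartedSpace VN N] [IsManifold 𝓘(ℝ, VN) ∞ N]
  {VE : Type*} [NormedAddCommGroup VE] [NormedSpace ℝ VE] [FiniteDimensional ℝ VE]
  {E : M → Type*} [∀ m, AddCommGroup (E m)] [∀ m, Module ℝ (E m)]
  [∀ m, TopologicalSpace (E m)] [∀ m, IsTopologicalAddGroup (E m)]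
  [∀ m, ContinuousSMul ℝ (E m)] [TopologicalSpace (TotalSpace VE E)]
  [FiberBundle VE E] [VectorBundle ℝ VE E] [ContMDiffVectorBundle ∞ VE E 𝓘(ℝ, VM)]
  {VF : Type*} [NormedAddCommGroup VF] [NormedSpace ℝ VF] [FiniteDimensional ℝ VF]
  {F : N → Type*} [∀ n, AddCommGroup (F n)] [∀ n, Module ℝ (F n)]
  [∀ n, TopologicalSpace (F n)] [∀ n, IsTopologicalAddGroup (F n)]
  [∀ n, ContinuousSMul ℝ (F n)] [TopologicalSpace (TotalSpace VF F)]
  [FiberBundle VF F] [VectorBundle ℝ VF F] [ContMDiffVectorBundle ∞ VF F 𝓘(ℝ, VN)]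
  {ν : ContMDiffMap 𝓘(ℝ, VM) 𝓘(ℝ, VN) M N ∞}
  (A : LieAlgebroid VM M VE E) (B : LieAlgebroid VN N VF F)
  (σ : ContMDiffSection 𝓘(ℝ, VM) VE ∞ E) (η : ContMDiffSection 𝓘(ℝ, VN) VF ∞ F)
  {e : Trivialization VE (TotalSpace.proj : TotalSpace VE E → M)} [MemTrivializationAtlas e]
  {f : Trivialization VF (TotalSpace.proj : TotalSpace VF F → N)} [MemTrivializationAtlas f]
  {m : M} (φ : Cutoff VM m e.baseSet) {n : N} (χ : Cutoff VN n f.baseSet)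

variable (ν)

/-- The flows of `σ` and `η` near `x₀` and `ν x₀`, read in trivializations `e` and `f`: the base
curve `x` through `x₀`, the matrix `a s` of `Ψ_s`, the matrix `b s` of `Φ_s` and its inverse
`c s`. -/
structure FlowFrame (x₀ : M) where
  /-- the base curve -/
  x : ℝ → M
  /-- the matrix of the flow of `σ` -/
  a : ℝ → VE →L[ℝ] VE
  /-- the matrix of the flow of `η` -/
  b : ℝ → VF →L[ℝ] VF
  /-- the inverse of `b` -/
  c : ℝ → VF →L[ℝ] VF
  /-- the flow is defined for times in `(-δ, δ)` -/
  δ : ℝ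
  δ_pos : 0 < δ
  x_zero : x 0 = x₀
  a_zero : a 0 = ContinuousLinearMap.id ℝ VE
  b_zero : b 0 = ContinuousLinearMap.id ℝ VF
  mem : ∀ s ∈ Ioo (-δ) δ, x s ∈ φ.nhd
  map_mem : ∀ s ∈ Ioo (-δ) δ, ν (x s) ∈ χ.nhd
  hasMFDerivAt_x : ∀ s ∈ Ioo (-δ) δ,
    HasMFDerivAt 𝓘(ℝ, ℝ) 𝓘(ℝ, VM) x s ((1 : ℝ →L[ℝ] ℝ).smulRight (A.anchorField σ (x s)))
  hasDerivAt_a : ∀ s ∈ Ioo (-δ) δ,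
    HasDerivAt a (-(christoffel e φ (A.bracket σ) (x s) ∘L a s)) s
  hasDerivAt_b : ∀ s ∈ Ioo (-δ) δ,
    HasDerivAt b (-(christoffel f χ (B.bracket η) (ν (x s)) ∘L b s)) s
  hasDerivAt_c : ∀ s ∈ Ioo (-δ) δ,
    HasDerivAt c (c s ∘L christoffel f χ (B.bracket η) (ν (x s))) s
  b_comp_c : ∀ s ∈ Ioo (-δ) δ, b s ∘L c s = ContinuousLinearMap.id ℝ VF
  c_comp_b : ∀ s ∈ Ioo (-δ) δ, c s ∘L b s = ContinuousLinearMap.id ℝ VF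

theorem clm_comp_eq_id_comm {V : Type*} [NormedAddCommGroup V] [NormedSpace ℝ V]
    [FiniteDimensional ℝ V] {S T : V →L[ℝ] V} (h : S ∘L T = ContinuousLinearMap.id ℝ V) :
    T ∘L S = ContinuousLinearMap.id ℝ V := by
  have h1 : (S : V →ₗ[ℝ] V) ∘ₗ (T : V →ₗ[ℝ] V) = LinearMap.id := congrArg ContinuousLinearMap.toLinearMap h
  have h2 : (T : V →ₗ[ℝ] V) ∘ₗ (S : V →ₗ[ℝ] V) = LinearMap.id := by
    rwa [LinearMap.comp_eq_id_comm]
  ext v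
  exact DFunLike.congr_fun h2 v

theorem eqOn_of_hasDerivAt_zero {W : Type*} [NormedAddCommGroup W] [NormedSpace ℝ W] {g : ℝ → W}
    {δ : ℝ} (hδ : 0 < δ) (h : ∀ s ∈ Ioo (-δ) δ, HasDerivAt g 0 s) {s : ℝ} (hs : s ∈ Ioo (-δ) δ) :
    g s = g 0 := by
  refine isOpen_Ioo.is_const_of_deriv_eq_zero isPreconnected_Ioo
    (fun t ht => (h t ht).differentiableAt.differentiableWithinAt) (fun t ht => (h t ht).deriv) hs
    ⟨neg_lt_zero.2 hδ, hδ⟩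

/-- The matrices `a`, `b`, `c` and the base curve solve one differential equation on the product of
`M` with a vector space; `c` is the inverse of `b` because `(c b)' = 0`. -/
theorem exists_flowFrame {x₀ : M} (h1 : x₀ ∈ φ.nhd) (h2 : ν x₀ ∈ χ.nhd) :
    Nonempty (FlowFrame ν A B σ η φ χ x₀) := by
  let G := (VE →L[ℝ] VE) × (VF →L[ℝ] VF) × (VF →L[ℝ] VF)
  let Γ := christoffel e φ (A.bracket σ)
  let Δ := fun x => christoffel f χ (B.bracket η) (ν x)
  let q : M × G := (x₀, ContinuousLinearMap.id ℝ VE, ContinuousLinearMap.id ℝ VF,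
    ContinuousLinearMap.id ℝ VF)
  let u : M → G → G := fun x g => (-(Γ x ∘L g.1), -(Δ x ∘L g.2.1), g.2.2 ∘L Δ x)
  have hΓ : ContMDiffAt (𝓘(ℝ, VM).prod 𝓘(ℝ, G)) 𝓘(ℝ, VE →L[ℝ] VE) ∞ (fun p : M × G => Γ p.1) q :=
    ContMDiffAt.comp (I' := 𝓘(ℝ, VM)) (f := fun p : M × G => p.1) q
      (contMDiffAt_christoffel e φ (A.bracket σ) (φ.nhd_subset h1)) contMDiffAt_fst
  have hΔ : ContMDiffAt (𝓘(ℝ, VM).prod 𝓘(ℝ, G)) 𝓘(ℝ, VF →L[ℝ] VF) ∞ (fun p : M × G => Δ p.1) q :=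
    ContMDiffAt.comp (I' := 𝓘(ℝ, VN)) (f := fun p : M × G => ν p.1) q
      (contMDiffAt_christoffel f χ (B.bracket η) (χ.nhd_subset h2))
      (ContMDiffAt.comp (I' := 𝓘(ℝ, VM)) (f := fun p : M × G => p.1) q (ν.contMDiff x₀)
        contMDiffAt_fst)
  have hg : ContMDiffAt (𝓘(ℝ, VM).prod 𝓘(ℝ, G)) 𝓘(ℝ, G) ∞ (fun p : M × G => p.2) q :=
    contMDiffAt_snd
  have hg1 : ContMDiffAt (𝓘(ℝ, VM).prod 𝓘(ℝ, G)) 𝓘(ℝ, VE →L[ℝ] VE) ∞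
      (fun p : M × G => p.2.1) q :=
    (contDiff_fst.contMDiff (f := fun g : G => g.1)).contMDiffAt.comp q hg
  have hg2 : ContMDiffAt (𝓘(ℝ, VM).prod 𝓘(ℝ, G)) 𝓘(ℝ, VF →L[ℝ] VF) ∞
      (fun p : M × G => p.2.2.1) q :=
    ((contDiff_fst.comp contDiff_snd).contMDiff (f := fun g : G => g.2.1)).contMDiffAt.comp q hg
  have hg3 : ContMDiffAt (𝓘(ℝ, VM).prod 𝓘(ℝ, G)) 𝓘(ℝ, VF →L[ℝ] VF) ∞
      (fun p : M × G => p.2.2.2) q :=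
    ((contDiff_snd.comp contDiff_snd).contMDiff (f := fun g : G => g.2.2)).contMDiffAt.comp q hg
  have hu : ContMDiffAt (𝓘(ℝ, VM).prod 𝓘(ℝ, G)) 𝓘(ℝ, G) ∞ (fun p : M × G => u p.1 p.2) q :=
    ContMDiffAt.prodMk_space (hΓ.clm_comp hg1).neg
      (ContMDiffAt.prodMk_space (hΔ.clm_comp hg2).neg (hg3.clm_comp hΔ))
  obtain ⟨x, g, hx0, hg0, hxg⟩ := exists_curve_prod (A.contMDiff_anchorField σ) hu
  have hcont : ContinuousAt x 0 := hxg.self_of_nhds.1.continuousAt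
  have hx0' : x 0 = x₀ := hx0
  have hm : ∀ᶠ s in 𝓝 (0 : ℝ), x s ∈ φ.nhd :=
    hcont.preimage_mem_nhds (φ.isOpen.mem_nhds (hx0'.symm ▸ h1))
  have hn : ∀ᶠ s in 𝓝 (0 : ℝ), ν (x s) ∈ χ.nhd :=
    (ν.contMDiff.continuous.continuousAt.comp hcont).preimage_mem_nhds
      (χ.isOpen.mem_nhds (by rw [Function.comp_apply, hx0']; exact h2))
  obtain ⟨δ, hδ, hall⟩ := Metric.eventually_nhds_iff_ball.1 (hxg.and (hm.and hn))
  rw [Real.ball_eq_Ioo, zero_sub, zero_add] at hall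
  have ha : ∀ s ∈ Ioo (-δ) δ, HasDerivAt (fun s => (g s).1) (-(Γ (x s) ∘L (g s).1)) s :=
    fun s hs => (hall s hs).1.2.fst
  have hb : ∀ s ∈ Ioo (-δ) δ, HasDerivAt (fun s => (g s).2.1) (-(Δ (x s) ∘L (g s).2.1)) s :=
    fun s hs => (hall s hs).1.2.snd.fst
  have hc : ∀ s ∈ Ioo (-δ) δ, HasDerivAt (fun s => (g s).2.2) ((g s).2.2 ∘L Δ (x s)) s :=
    fun s hs => (hall s hs).1.2.snd.snd
  have hcb : ∀ s ∈ Ioo (-δ) δ, (g s).2.2 ∘L (g s).2.1 = ContinuousLinearMap.id ℝ VF := by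
    intro s hs
    refine (eqOn_of_hasDerivAt_zero (g := fun s => (g s).2.2 ∘L (g s).2.1) hδ (fun t ht => ?_)
      hs).trans ?_
    · refine ((hc t ht).clm_comp (hb t ht)).congr_deriv ?_
      ext v
      simp
    · rw [hg0]; rfl
  exact ⟨⟨x, fun s => (g s).1, fun s => (g s).2.1, fun s => (g s).2.2, δ, hδ, hx0,
    congrArg (fun g : G => g.1) hg0, congrArg (fun g : G => g.2.1) hg0, fun s hs => (hall s hs).2.1,
    fun s hs => (hall s hs).2.2, fun s hs => (hall s hs).1.1, ha, hb, hc,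
    fun s hs => clm_comp_eq_id_comm (hcb s hs), hcb⟩⟩

end FlowFrames

/-! ### The bundle of linear maps and the trace functions in coordinates -/

theorem mdifferentiableAt_clm_comp {V H P : Type*} [NormedAddCommGroup V] [NormedSpace ℝ V]
    [TopologicalSpace H] {I : ModelWithCorners ℝ V H} [TopologicalSpace P] [ChartedSpace H P]
    {W W' : Type*} [NormedAddCommGroup W] [NormedSpace ℝ W]
    [NormedAddCommGroup W'] [NormedSpace ℝ W'] (L : W →L[ℝ] W') {f : P → W} {x : P}
    (hf : MDifferentiableAt I 𝓘(ℝ, W) f x) : MDifferentiableAt I 𝓘(ℝ, W') (fun y => L (f y)) x :=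
  ((L.hasMFDerivAt (x := f x)).comp x hf.hasMFDerivAt).mdifferentiableAt

section HomCoordinates

variable {VM : Type*} [NormedAddCommGroup VM] [NormedSpace ℝ VM] [FiniteDimensional ℝ VM]
  {M : Type*} [TopologicalSpace M] [T2Space M] [ChartedSpace VM M] [IsManifold 𝓘(ℝ, VM) ∞ M]
  {VN : Type*} [NormedAddCommGroup VN] [NormedSpace ℝ VN] [FiniteDimensional ℝ VN]
  {N : Type*} [TopologicalSpace N] [T2Space N] [ChartedSpace VN N] [IsManifold 𝓘(ℝ, VN) ∞ N]
  {VE : Type*} [NormedAddCommGroup VE] [NormedSpace ℝ VE] [FiniteDimensional ℝ VE]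
  {E : M → Type*} [∀ m, AddCommGroup (E m)] [∀ m, Module ℝ (E m)]
  [∀ m, TopologicalSpace (E m)] [∀ m, IsTopologicalAddGroup (E m)]
  [∀ m, ContinuousSMul ℝ (E m)] [TopologicalSpace (TotalSpace VE E)]
  [FiberBundle VE E] [VectorBundle ℝ VE E] [ContMDiffVectorBundle ∞ VE E 𝓘(ℝ, VM)]
  {VF : Type*} [NormedAddCommGroup VF] [NormedSpace ℝ VF] [FiniteDimensional ℝ VF]
  {F : N → Type*} [∀ n, AddCommGroup (F n)] [∀ n, Module ℝ (F n)]
  [∀ n, TopologicalSpace (F n)] [∀ n, IsTopologicalAddGroup (F n)]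
  [∀ n, ContinuousSMul ℝ (F n)] [TopologicalSpace (TotalSpace VF F)]
  [FiberBundle VF F] [VectorBundle ℝ VF F] [ContMDiffVectorBundle ∞ VF F 𝓘(ℝ, VN)]
  {ν : ContMDiffMap 𝓘(ℝ, VM) 𝓘(ℝ, VN) M N ∞}
  (e : Trivialization VE (TotalSpace.proj : TotalSpace VE E → M)) [MemTrivializationAtlas e]
  (f : Trivialization VF (TotalSpace.proj : TotalSpace VF F → N)) [MemTrivializationAtlas f]

theorem pullback_continuousLinearMapAt {x : M} (hx : ν x ∈ f.baseSet)
    (b : ((ν : M → N) *ᵖ F) x) :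
    (f.pullback ν).continuousLinearMapAt ℝ x b = f.continuousLinearMapAt ℝ (ν x) b := by
  have hx' : x ∈ (f.pullback ν).baseSet := hx
  rw [Trivialization.continuousLinearMapAt_apply, Trivialization.continuousLinearMapAt_apply,
    Trivialization.coe_linearMapAt_of_mem _ hx', Trivialization.coe_linearMapAt_of_mem _ hx]
  rfl

theorem pullback_symmL {x : M} (hx : ν x ∈ f.baseSet) (y : VF) :
    (f.pullback ν).symmL ℝ x y = f.symmL ℝ (ν x) y := by
  have hx' : x ∈ (f.pullback ν).baseSet := hx
  have h := pullback_continuousLinearMapAt f hx (f.symmL ℝ (ν x) y)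
  rw [f.continuousLinearMapAt_symmL hx] at h
  exact (congrArg ((f.pullback ν).symmL ℝ x) h).symm.trans
    (Trivialization.symmL_continuousLinearMapAt (R := ℝ) (E := (ν : M → N) *ᵖ F) (f.pullback ν)
      hx' (f.symmL ℝ (ν x) y))

variable (ν) in
/-- The trivialization of `ℒπ` defined by trivializations of `E` and `F`. -/
abbrev LTriv : Trivialization (VF →L[ℝ] VE) (TotalSpace.proj : LBundle VE E VF F ν → M) :=
  (f.pullback ν).continuousLinearMap (RingHom.id ℝ) e

theorem mem_LTriv_baseSet {x : M} (hx : x ∈ e.baseSet) (hνx : ν x ∈ f.baseSet) :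
    x ∈ (LTriv ν e f).baseSet := ⟨hνx, hx⟩

theorem fiberCoord_LTriv {w : LBundle VE E VF F ν} (hx : w.proj ∈ e.baseSet)
    (hνx : ν w.proj ∈ f.baseSet) (y : VF) :
    fiberCoord (LTriv ν e f) w y =
      e.continuousLinearMapAt ℝ w.proj (LBundle.map w (f.symmL ℝ (ν w.proj) y)) := by
  rw [fiberCoord_eq _ (mem_LTriv_baseSet e f hx hνx), ← pullback_symmL f hνx]
  rfl

theorem map_eq_fiberCoord {w : LBundle VE E VF F ν} (hx : w.proj ∈ e.baseSet)
    (hνx : ν w.proj ∈ f.baseSet) (b : F (ν w.proj)) :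
    LBundle.map w b = e.symmL ℝ w.proj
      (fiberCoord (LTriv ν e f) w (f.continuousLinearMapAt ℝ (ν w.proj) b)) := by
  rw [fiberCoord_LTriv e f hx hνx, f.symmL_continuousLinearMapAt hνx,
    e.symmL_continuousLinearMapAt hx]

theorem LTriv_symmL_fiberCoord {w : LBundle VE E VF F ν} (hx : w.proj ∈ e.baseSet)
    (hνx : ν w.proj ∈ f.baseSet) :
    (⟨w.proj, (LTriv ν e f).symmL ℝ w.proj (fiberCoord (LTriv ν e f) w)⟩ : LBundle VE E VF F ν) =
      w := by
  have := (LTriv ν e f).symmL_continuousLinearMapAt (R := ℝ) (mem_LTriv_baseSet e f hx hνx) w.2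
  exact congrArg (TotalSpace.mk w.proj) this

theorem mem_jetSet_iff {pr : BundleMapOver VE E VF F ν} {w : LBundle VE E VF F ν}
    (hx : w.proj ∈ e.baseSet) (hνx : ν w.proj ∈ f.baseSet) :
    w ∈ jetSet pr ↔
      mapCoord e f pr w.proj ∘L fiberCoord (LTriv ν e f) w = ContinuousLinearMap.id ℝ VF := by
  have key : ∀ b, mapCoord e f pr w.proj (fiberCoord (LTriv ν e f) w
      (f.continuousLinearMapAt ℝ (ν w.proj) b)) =
      f.continuousLinearMapAt ℝ (ν w.proj) (fiberMap pr w.proj (LBundle.map w b)) := fun b => by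
    rw [mapCoord_apply, ← map_eq_fiberCoord e f hx hνx]
  constructor
  · intro h
    ext y
    have h1 := key (f.symmL ℝ (ν w.proj) y)
    rw [h, f.continuousLinearMapAt_symmL hνx] at h1
    exact h1
  · intro h b
    have h1 := key b
    rw [← ContinuousLinearMap.comp_apply, h, ContinuousLinearMap.id_apply] at h1
    have h2 := congrArg (f.symmL ℝ (ν w.proj)) h1
    rw [f.symmL_continuousLinearMapAt hνx, f.symmL_continuousLinearMapAt hνx] at h2
    exact h2.symm

/-- The pairing `(T, W) ↦ tr (T ∘ W)`. -/
def tracePairing (V W : Type*) [NormedAddCommGroup V] [NormedSpace ℝ V]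
    [FiniteDimensional ℝ V] [NormedAddCommGroup W] [NormedSpace ℝ W] [FiniteDimensional ℝ W] :
    (V →L[ℝ] W) →L[ℝ] (W →L[ℝ] V) →L[ℝ] ℝ :=
  (ContinuousLinearMap.compL ℝ (W →L[ℝ] V) (W →L[ℝ] W) ℝ
    (LinearMap.toContinuousLinearMap (LinearMap.trace ℝ W ∘ₗ ContinuousLinearMap.coeLM ℝ))) ∘L
    ContinuousLinearMap.compL ℝ W V W

theorem tracePairing_apply (T : VE →L[ℝ] VF) (W : VF →L[ℝ] VE) :
    tracePairing VE VF T W = LinearMap.trace ℝ VF ((T ∘L W : VF →L[ℝ] VF) : VF →ₗ[ℝ] VF) := rfl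

theorem tracePairing_add_left (T T' : VE →L[ℝ] VF) (W : VF →L[ℝ] VE) :
    tracePairing VE VF (T + T') W = tracePairing VE VF T W + tracePairing VE VF T' W :=
  DFunLike.congr_fun ((tracePairing VE VF).map_add' T T') W

theorem tracePairing_sub_left (T T' : VE →L[ℝ] VF) (W : VF →L[ℝ] VE) :
    tracePairing VE VF (T - T') W = tracePairing VE VF T W - tracePairing VE VF T' W := by
  have h := tracePairing_add_left (T - T') T' W
  rw [sub_add_cancel] at h
  rw [h, add_sub_cancel_right]

theorem tracePairing_comp_right (T : VE →L[ℝ] VF) (W : VF →L[ℝ] VE) (S : VF →L[ℝ] VF) :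
    tracePairing VE VF T (W ∘L S) = tracePairing VE VF (S ∘L T) W := by
  simp only [tracePairing_apply]
  exact LinearMap.trace_mul_comm ℝ ((T ∘L W : VF →L[ℝ] VF) : VF →ₗ[ℝ] VF) (S : VF →ₗ[ℝ] VF)

theorem tracePairing_comp_left (T : VE →L[ℝ] VF) (W : VF →L[ℝ] VE) (S : VE →L[ℝ] VE) :
    tracePairing VE VF T (S ∘L W) = tracePairing VE VF (T ∘L S) W := rfl

theorem eq_zero_of_tracePairing {W : VF →L[ℝ] VE} (h : ∀ T, tracePairing VE VF T W = 0) :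
    W = 0 := by
  ext y
  refine (SeparatingDual.eq_iff_forall_dual_eq (R := ℝ)).2 fun l => ?_
  have h1 := h (l.smulRight y)
  have h2 : (((l.smulRight y) ∘L W : VF →L[ℝ] VF) : VF →ₗ[ℝ] VF) =
      ((l ∘L W : VF →L[ℝ] ℝ) : VF →ₗ[ℝ] ℝ).smulRight y := by
    ext z; rfl
  rw [tracePairing_apply, h2, LinearMap.trace_smulRight] at h1
  simpa using h1

theorem hatFunction_eq (θ : BundleMapOver VE E VF F ν) {w : LBundle VE E VF F ν}
    (hx : w.proj ∈ e.baseSet) (hνx : ν w.proj ∈ f.baseSet) :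
    hatFunction θ w = tracePairing VE VF (mapCoord e f θ w.proj) (fiberCoord (LTriv ν e f) w) := by
  let L : F (ν w.proj) ≃ₗ[ℝ] VF := (f.continuousLinearEquivAt ℝ (ν w.proj) hνx).toLinearEquiv
  rw [hatFunction, tracePairing_apply, ← LinearMap.trace_conj' _ L]
  congr 1
  ext y
  have hL : ∀ z, L z = f.continuousLinearMapAt ℝ (ν w.proj) z := fun z => by
    simp [L, Trivialization.coe_linearMapAt_of_mem _ hνx]
  have hL' : ∀ z, L.symm z = f.symmL ℝ (ν w.proj) z := fun z => by
    rw [LinearEquiv.symm_apply_eq, hL, f.continuousLinearMapAt_symmL hνx]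
  rw [LinearEquiv.conj_apply_apply, hL, hL']
  change f.continuousLinearMapAt ℝ (ν w.proj) (fiberMap θ w.proj
      (LBundle.map w (f.symmL ℝ (ν w.proj) y))) =
    mapCoord e f θ w.proj (fiberCoord (LTriv ν e f) w y)
  rw [fiberCoord_LTriv e f hx hνx, mapCoord_coord e f θ hx]

set_option synthInstance.maxHeartbeats 200000 in
theorem mvfderiv_hatFunction (θ : BundleMapOver VE E VF F ν) {w : LBundle VE E VF F ν}
    (hx : w.proj ∈ e.baseSet) (hνx : ν w.proj ∈ f.baseSet)
    (v : TangentSpace (modelL VM VE VF) w) :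
    mvfderiv (modelL VM VE VF) (hatFunction θ) w v =
      tracePairing VE VF (mapCoord e f θ w.proj)
          (mvfderiv (modelL VM VE VF) (fiberCoord (LTriv ν e f)) w v) +
        tracePairing VE VF (mvfderiv 𝓘(ℝ, VM) (mapCoord e f θ) w.proj
          (mfderiv (modelL VM VE VF) 𝓘(ℝ, VM) (TotalSpace.proj : LBundle VE E VF F ν → M) w v))
          (fiberCoord (LTriv ν e f) w) := by
  have hT : MDifferentiableAt 𝓘(ℝ, VM) 𝓘(ℝ, VE →L[ℝ] VF) (mapCoord e f θ) w.proj :=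
    (contMDiffAt_mapCoord e f θ hx hνx).mdifferentiableAt (by simp)
  have hT' : MDifferentiableAt 𝓘(ℝ, VM) 𝓘(ℝ, (VF →L[ℝ] VE) →L[ℝ] ℝ)
      (fun x => tracePairing VE VF (mapCoord e f θ x)) w.proj :=
    mdifferentiableAt_clm_comp (W := VE →L[ℝ] VF) (W' := (VF →L[ℝ] VE) →L[ℝ] ℝ)
      (tracePairing VE VF) hT
  have h1 := mvfderiv_comp_proj hT' v
  have h2 := mvfderiv_clm_apply
    (T := fun w : LBundle VE E VF F ν => tracePairing VE VF (mapCoord e f θ w.proj))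
    (hT'.comp w (mdifferentiableAt_totalSpace_proj w))
    (mdifferentiableAt_fiberCoord (LTriv ν e f) (mem_LTriv_baseSet e f hx hνx)) v
  have h3 := mvfderiv_clm_comp (W := VE →L[ℝ] VF) (W' := (VF →L[ℝ] VE) →L[ℝ] ℝ)
    (tracePairing VE VF) hT (mfderiv (modelL VM VE VF) 𝓘(ℝ, VM)
      (TotalSpace.proj : LBundle VE E VF F ν → M) w v)
  rw [h1, h3] at h2
  rw [← h2]
  refine mvfderiv_congr ?_ v
  filter_upwards [eventually_proj_mem (LTriv ν e f).open_baseSet (mem_LTriv_baseSet e f hx hνx)]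
    with w' hw'
  exact hatFunction_eq e f θ hw'.2 hw'.1

end HomCoordinates

/-! ### The flow `w ↦ Ψ_s ∘ w ∘ Φ_{-s}` -/

section Transport

variable {VM : Type*} [NormedAddCommGroup VM] [NormedSpace ℝ VM] [FiniteDimensional ℝ VM]
  {M : Type*} [TopologicalSpace M] [T2Space M] [ChartedSpace VM M] [IsManifold 𝓘(ℝ, VM) ∞ M]
  {VN : Type*} [NormedAddCommGroup VN] [NormedSpace ℝ VN] [FiniteDimensional ℝ VN]
  {N : Type*} [TopologicalSpace N] [T2Space N] [ChartedSpace VN N] [IsManifold 𝓘(ℝ, VN) ∞ N]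
  {VE : Type*} [NormedAddCommGroup VE] [NormedSpace ℝ VE] [FiniteDimensional ℝ VE]
  {E : M → Type*} [∀ m, AddCommGroup (E m)] [∀ m, Module ℝ (E m)]
  [∀ m, TopologicalSpace (E m)] [∀ m, IsTopologicalAddGroup (E m)]
  [∀ m, ContinuousSMul ℝ (E m)] [TopologicalSpace (TotalSpace VE E)]
  [FiberBundle VE E] [VectorBundle ℝ VE E] [ContMDiffVectorBundle ∞ VE E 𝓘(ℝ, VM)]
  {VF : Type*} [NormedAddCommGroup VF] [NormedSpace ℝ VF] [FiniteDimensional ℝ VF]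
  {F : N → Type*} [∀ n, AddCommGroup (F n)] [∀ n, Module ℝ (F n)]
  [∀ n, TopologicalSpace (F n)] [∀ n, IsTopologicalAddGroup (F n)]
  [∀ n, ContinuousSMul ℝ (F n)] [TopologicalSpace (TotalSpace VF F)]
  [FiberBundle VF F] [VectorBundle ℝ VF F] [ContMDiffVectorBundle ∞ VF F 𝓘(ℝ, VN)]
  {ν : ContMDiffMap 𝓘(ℝ, VM) 𝓘(ℝ, VN) M N ∞}
  {A : LieAlgebroid VM M VE E} {B : LieAlgebroid VN N VF F} {pr : BundleMapOver VE E VF F ν}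
  {σ : ContMDiffSection 𝓘(ℝ, VM) VE ∞ E} {η : ContMDiffSection 𝓘(ℝ, VN) VF ∞ F}
  {e : Trivialization VE (TotalSpace.proj : TotalSpace VE E → M)} [MemTrivializationAtlas e]
  {f : Trivialization VF (TotalSpace.proj : TotalSpace VF F → N)} [MemTrivializationAtlas f]
  {m : M} {φ : Cutoff VM m e.baseSet} {n : N} {χ : Cutoff VN n f.baseSet} {x₀ : M}

theorem totalSpace_mk_congr {B₁ V : Type*} {Z : B₁ → Type*} {z z' : B₁} (s : ∀ z, V → Z z)
    (h : z = z') {y y' : V} (hy : y = y') :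
    (⟨z, s z y⟩ : TotalSpace V Z) = ⟨z', s z' y'⟩ := by
  subst h hy; rfl

theorem hasDerivAt_comp_curve {W : Type*} [NormedAddCommGroup W] [NormedSpace ℝ W] {T : M → W}
    {x : ℝ → M} {s : ℝ} {p : TangentSpace 𝓘(ℝ, VM) (x s)}
    (hT : MDifferentiableAt 𝓘(ℝ, VM) 𝓘(ℝ, W) T (x s))
    (hx : HasMFDerivAt 𝓘(ℝ, ℝ) 𝓘(ℝ, VM) x s ((1 : ℝ →L[ℝ] ℝ).smulRight p)) :
    HasDerivAt (fun t => T (x t)) (mvfderiv 𝓘(ℝ, VM) T (x s) p) s := by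
  have h1 : HasFDerivAt (fun t => T (x t))
      ((1 : ℝ →L[ℝ] ℝ).smulRight (mvfderiv 𝓘(ℝ, VM) T (x s) p)) s := by
    refine hasMFDerivAt_iff_hasFDerivAt.1 ((hT.hasMFDerivAt.comp s hx).congr_mfderiv
      (ContinuousLinearMap.ext_ring (M₁ := W) ?_))
    change (mfderiv 𝓘(ℝ, VM) 𝓘(ℝ, W) T (x s) : VM → W) ((1 : ℝ) • p) =
      (1 : ℝ) • (mfderiv 𝓘(ℝ, VM) 𝓘(ℝ, W) T (x s) : VM → W) p
    rw [one_smul, one_smul]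
  exact h1.hasDerivAt.congr_deriv (by simp)

namespace FlowFrame

variable (Θ : FlowFrame ν A B σ η φ χ x₀)

theorem zero_mem : (0 : ℝ) ∈ Ioo (-Θ.δ) Θ.δ := ⟨neg_lt_zero.2 Θ.δ_pos, Θ.δ_pos⟩

theorem eventually_mem : ∀ᶠ s in 𝓝 (0 : ℝ), s ∈ Ioo (-Θ.δ) Θ.δ := Ioo_mem_nhds Θ.zero_mem.1 Θ.zero_mem.2

theorem c_zero : Θ.c 0 = ContinuousLinearMap.id ℝ VF := by
  have h := Θ.c_comp_b 0 Θ.zero_mem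
  rwa [Θ.b_zero, ContinuousLinearMap.comp_id] at h

theorem sectionFlowsTo {s : ℝ} (hs : s ∈ Ioo (-Θ.δ) Θ.δ) (y : VE) :
    A.SectionFlowsTo σ s ⟨x₀, e.symmL ℝ x₀ y⟩ ⟨Θ.x s, e.symmL ℝ (Θ.x s) (Θ.a s y)⟩ := by
  obtain ⟨X, hX⟩ := A.exists_isLift σ
  refine ⟨X, hX, fun t => ⟨Θ.x t, e.symmL ℝ (Θ.x t) (Θ.a t y)⟩, -Θ.δ, Θ.δ, Θ.zero_mem, hs,
    fun t ht => HasMFDerivAt.hasMFDerivWithinAt ?_,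
    totalSpace_mk_congr (fun z => e.symmL ℝ z) Θ.x_zero (by simp [Θ.a_zero]), rfl⟩
  have hxt := Θ.mem t ht
  refine hasMFDerivAt_curve_of_coord e (φ.nhd_subset hxt) (y := fun t => Θ.a t y)
    (Θ.hasMFDerivAt_x t ht) ((Θ.hasDerivAt_a t ht).clm_apply (hasDerivAt_const t y)) (hX.2.1 _) ?_
  refine (hX.coord e φ hxt).trans ?_
  have h : fiberCoord e (⟨Θ.x t, e.symmL ℝ (Θ.x t) (Θ.a t y)⟩ : TotalSpace VE E) = Θ.a t y :=
    e.continuousLinearMapAt_symmL (φ.nhd_subset hxt) _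
  rw [h]
  simp

theorem hasMFDerivAt_map (h : IsLieAlgebroidMorphism A B pr) (hση : ProjectsOver pr σ η) {s : ℝ}
    (hs : s ∈ Ioo (-Θ.δ) Θ.δ) :
    HasMFDerivAt 𝓘(ℝ, ℝ) 𝓘(ℝ, VN) (fun t => ν (Θ.x t)) s
      ((1 : ℝ →L[ℝ] ℝ).smulRight (B.anchorField η (ν (Θ.x s)))) := by
  have h1 := ((ν.contMDiff (Θ.x s)).mdifferentiableAt (by simp)).hasMFDerivAt.comp s
    (Θ.hasMFDerivAt_x s hs)
  refine h1.congr_mfderiv (ContinuousLinearMap.ext_ring (M₁ := VN) ?_)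
  rw [← h.mfderiv_anchorField hση]
  change (mfderiv 𝓘(ℝ, VM) 𝓘(ℝ, VN) ν (Θ.x s) : VM → VN) ((1 : ℝ) • A.anchorField σ (Θ.x s)) =
    ((1 : ℝ) • mfderiv 𝓘(ℝ, VM) 𝓘(ℝ, VN) ν (Θ.x s) (A.anchorField σ (Θ.x s)) : VN)
  rw [one_smul, one_smul]

/-- The flow of `η` for time `-s`, from the point over `ν (x s)`, is obtained by shifting the time of
the flow that starts over `ν x₀`. -/
theorem sectionFlowsTo_neg (h : IsLieAlgebroidMorphism A B pr) (hση : ProjectsOver pr σ η) {s : ℝ}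
    (hs : s ∈ Ioo (-Θ.δ) Θ.δ) (y : VF) :
    B.SectionFlowsTo η (-s) ⟨ν (Θ.x s), f.symmL ℝ (ν (Θ.x s)) y⟩
      ⟨ν x₀, f.symmL ℝ (ν x₀) (Θ.c s y)⟩ := by
  obtain ⟨X, hX⟩ := B.exists_isLift η
  have hγ : IsMIntegralCurveOn (fun t => (⟨ν (Θ.x t), f.symmL ℝ (ν (Θ.x t)) (Θ.b t (Θ.c s y))⟩ :
      TotalSpace VF F)) X (Ioo (-Θ.δ) Θ.δ) := by
    refine fun t ht => HasMFDerivAt.hasMFDerivWithinAt ?_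
    have hxt := Θ.map_mem t ht
    refine hasMFDerivAt_curve_of_coord f (x := fun t => ν (Θ.x t)) (χ.nhd_subset hxt)
      (y := fun t => Θ.b t (Θ.c s y)) (Θ.hasMFDerivAt_map h hση ht)
      ((Θ.hasDerivAt_b t ht).clm_apply (hasDerivAt_const t (Θ.c s y))) (hX.2.1 _) ?_
    refine (hX.coord f χ hxt).trans ?_
    have h : fiberCoord f (⟨ν (Θ.x t), f.symmL ℝ (ν (Θ.x t)) (Θ.b t (Θ.c s y))⟩ :
        TotalSpace VF F) = Θ.b t (Θ.c s y) :=
      f.continuousLinearMapAt_symmL (χ.nhd_subset hxt) _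
    rw [h]
    simp
  refine ⟨X, hX, _, -Θ.δ - s, Θ.δ - s, ⟨by linarith [hs.1], by linarith [hs.2]⟩,
    ⟨by linarith [Θ.δ_pos], by linarith [Θ.δ_pos]⟩, (hγ.comp_add s).mono fun t ht =>
      ⟨by linarith [ht.1], by linarith [ht.2]⟩, ?_, ?_⟩
  · refine totalSpace_mk_congr (fun z => f.symmL ℝ z) (by simp only [zero_add]) ?_
    simp only [zero_add]
    exact DFunLike.congr_fun (Θ.b_comp_c s hs) y
  · refine totalSpace_mk_congr (fun z => f.symmL ℝ z) (by simp only [neg_add_cancel, Θ.x_zero]) ?_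
    simp only [neg_add_cancel, Θ.b_zero]
    rfl

theorem hasDerivAt_mapCoord (θ : BundleMapOver VE E VF F ν) {s : ℝ} (hs : s ∈ Ioo (-Θ.δ) Θ.δ) :
    HasDerivAt (fun t => mapCoord e f θ (Θ.x t))
      (mvfderiv 𝓘(ℝ, VM) (mapCoord e f θ) (Θ.x s) (A.anchorField σ (Θ.x s))) s :=
  hasDerivAt_comp_curve ((contMDiffAt_mapCoord e f θ (φ.nhd_subset (Θ.mem s hs))
    (χ.nhd_subset (Θ.map_mem s hs))).mdifferentiableAt (by simp)) (Θ.hasMFDerivAt_x s hs)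

/-- `Φ_{-s} ∘ π ∘ Ψ_s = π`. -/
theorem c_comp_mapCoord_comp_a (h : IsLieAlgebroidMorphism A B pr) (hση : ProjectsOver pr σ η)
    {s : ℝ} (hs : s ∈ Ioo (-Θ.δ) Θ.δ) :
    Θ.c s ∘L mapCoord e f pr (Θ.x s) ∘L Θ.a s = mapCoord e f pr x₀ := by
  refine (eqOn_of_hasDerivAt_zero (g := fun s => Θ.c s ∘L mapCoord e f pr (Θ.x s) ∘L Θ.a s) Θ.δ_pos
    (fun t ht => ?_) hs).trans ?_
  · refine ((Θ.hasDerivAt_c t ht).clm_comp ((Θ.hasDerivAt_mapCoord pr ht).clm_comp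
      (Θ.hasDerivAt_a t ht))).congr_deriv ?_
    ext y
    simp [h.mvfderiv_mapCoord hση e f φ χ (Θ.mem t ht) (Θ.map_mem t ht)]
    abel
  · simp only [Θ.x_zero, Θ.a_zero, Θ.c_zero]
    rfl

end FlowFrame

/-- The flow `Ψ_s ∘ w ∘ Φ_{-s}` is single-valued. -/
theorem IsTransport.unique {s : ℝ} {w w₁ w₂ : LBundle VE E VF F ν}
    (h1 : IsTransport A B σ η s w w₁) (h2 : IsTransport A B σ η s w w₂) : w₁ = w₂ := by
  have hξ := A.contMDiff_anchorField σ
  -- The image of `0` under `Φ_{-s}` and `w` already determines the base point.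
  have hp : w₁.proj = w₂.proj := by
    obtain ⟨_, _, h3⟩ := h1 0
    obtain ⟨_, _, h4⟩ := h2 0
    exact h3.proj.unique hξ h4.proj
  obtain ⟨x, u₁⟩ := w₁
  obtain ⟨x', u₂⟩ := w₂
  obtain rfl : x = x' := hp
  congr 1
  refine ContinuousLinearMap.ext fun b' => ?_
  obtain ⟨b₁, h3, h4⟩ := h1 b'
  obtain ⟨b₂, h5, h6⟩ := h2 b'
  obtain rfl : b₁ = b₂ := eq_of_heq (TotalSpace.mk.inj (h3.unique h5)).2
  exact eq_of_heq (TotalSpace.mk.inj (h4.unique h6)).2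

variable (A B σ η φ χ) in
/-- The fibre component, in the trivializations `e` and `f`, of the vector field that generates
`w ↦ Ψ_s ∘ w ∘ Φ_{-s}`. -/
def transportField (x : M) (W : VF →L[ℝ] VE) : VF →L[ℝ] VE :=
  -(christoffel e φ (A.bracket σ) x ∘L W) + W ∘L christoffel f χ (B.bracket η) (ν x)

variable (A B σ η φ χ) in
/-- The tangent vector `v` of `ℒπ` has the coordinates of a transport velocity in the
trivializations `e` and `f`. -/
def HasTransportCoord (w : LBundle VE E VF F ν) (v : TangentSpace (modelL VM VE VF) w) : Prop :=
  mfderiv (modelL VM VE VF) 𝓘(ℝ, VM) (TotalSpace.proj : LBundle VE E VF F ν → M) w v =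
      A.anchorField σ w.proj ∧
    mvfderiv (modelL VM VE VF) (fiberCoord (LTriv ν e f)) w v =
      transportField A B σ η φ χ (ν := ν) w.proj (fiberCoord (LTriv ν e f) w)

/-- The curve `s ↦ Ψ_s ∘ w ∘ Φ_{-s}` exists, is tangent to the vector field with fibre component
`transportField`, and stays in `𝒥π` if it starts there. -/
theorem exists_transportCurve (h : IsLieAlgebroidMorphism A B pr) (hση : ProjectsOver pr σ η)
    {w : LBundle VE E VF F ν} (hw : w.proj ∈ φ.nhd) (hνw : ν w.proj ∈ χ.nhd) :
    ∃ γ : ℝ → LBundle VE E VF F ν, γ 0 = w ∧ ∀ᶠ s in 𝓝 (0 : ℝ),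
      ((γ s).proj ∈ φ.nhd ∧ ν (γ s).proj ∈ χ.nhd) ∧
      IsTransport A B σ η s w (γ s) ∧ (w ∈ jetSet pr → γ s ∈ jetSet pr) ∧
      ∀ v, HasTransportCoord A B σ η φ χ (γ s) v →
        HasMFDerivAt 𝓘(ℝ, ℝ) (modelL VM VE VF) γ s ((1 : ℝ →L[ℝ] ℝ).smulRight v) := by
  obtain ⟨Θ⟩ := exists_flowFrame ν A B σ η φ χ hw hνw
  have hwe := φ.nhd_subset hw
  have hwf := χ.nhd_subset hνw
  set W := fiberCoord (LTriv ν e f) w with hW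
  let Y : ℝ → VF →L[ℝ] VE := fun s => Θ.a s ∘L W ∘L Θ.c s
  let γ : ℝ → LBundle VE E VF F ν := fun s => ⟨Θ.x s, (LTriv ν e f).symmL ℝ (Θ.x s) (Y s)⟩
  have hcoord : ∀ s ∈ Ioo (-Θ.δ) Θ.δ, fiberCoord (LTriv ν e f) (γ s) = Y s := fun s hs =>
    (LTriv ν e f).continuousLinearMapAt_symmL (R := ℝ)
      (mem_LTriv_baseSet e f (φ.nhd_subset (Θ.mem s hs)) (χ.nhd_subset (Θ.map_mem s hs))) (Y s)
  have hmap : ∀ s ∈ Ioo (-Θ.δ) Θ.δ, ∀ b' : F (ν (Θ.x s)), LBundle.map (γ s) b' =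
      e.symmL ℝ (Θ.x s) (Θ.a s (W (Θ.c s (f.continuousLinearMapAt ℝ (ν (Θ.x s)) b')))) := by
    intro s hs b'
    rw [map_eq_fiberCoord e f (φ.nhd_subset (Θ.mem s hs)) (χ.nhd_subset (Θ.map_mem s hs)),
      hcoord s hs]
    rfl
  have hY : ∀ s ∈ Ioo (-Θ.δ) Θ.δ, HasDerivAt Y
      (transportField A B σ η φ χ (ν := ν) (Θ.x s) (Y s)) s := by
    intro s hs
    refine ((Θ.hasDerivAt_a s hs).clm_comp
      ((hasDerivAt_const s W).clm_comp (Θ.hasDerivAt_c s hs))).congr_deriv ?_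
    ext y
    simp [transportField, Y]
  refine ⟨γ, ?_, ?_⟩
  · refine Eq.trans ?_ (LTriv_symmL_fiberCoord e f hwe hwf)
    refine totalSpace_mk_congr (fun z => (LTriv ν e f).symmL ℝ z) Θ.x_zero ?_
    simp only [Y, Θ.a_zero, Θ.c_zero]
    rfl
  · filter_upwards [Θ.eventually_mem] with s hs
    refine ⟨⟨Θ.mem s hs, Θ.map_mem s hs⟩, fun b' => ?_, fun hjet => ?_, fun v hv => ?_⟩
    · refine ⟨f.symmL ℝ (ν w.proj) (Θ.c s (f.continuousLinearMapAt ℝ (ν (Θ.x s)) b')), ?_, ?_⟩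
      · have h1 := Θ.sectionFlowsTo_neg h hση hs (f.continuousLinearMapAt ℝ (ν (Θ.x s)) b')
        rw [f.symmL_continuousLinearMapAt (χ.nhd_subset (Θ.map_mem s hs))] at h1
        exact h1
      · have h1 := Θ.sectionFlowsTo hs (W (Θ.c s (f.continuousLinearMapAt ℝ (ν (Θ.x s)) b')))
        rw [map_eq_fiberCoord e f hwe hwf, f.continuousLinearMapAt_symmL hwf, hmap s hs]
        exact h1
    · rw [mem_jetSet_iff e f hwe hwf] at hjet
      rw [mem_jetSet_iff e f (φ.nhd_subset (Θ.mem s hs)) (χ.nhd_subset (Θ.map_mem s hs)),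
        hcoord s hs]
      have hQ := Θ.c_comp_mapCoord_comp_a h hση hs
      have hb := Θ.b_comp_c s hs
      ext y
      have h1 := DFunLike.congr_fun hjet (Θ.c s y)
      rw [← hQ] at h1
      have h2 := congrArg (Θ.b s) h1
      have hb' : ∀ z, Θ.b s (Θ.c s z) = z := DFunLike.congr_fun hb
      simpa [hb', Y] using h2
    · refine hasMFDerivAt_curve_of_coord (LTriv ν e f)
        (mem_LTriv_baseSet e f (φ.nhd_subset (Θ.mem s hs)) (χ.nhd_subset (Θ.map_mem s hs)))
        (Θ.hasMFDerivAt_x s hs) (hY s hs) hv.1 (hv.2.trans ?_)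
      rw [hcoord s hs]

end Transport

/-! ### The Lie derivative of sections of `ℒ*π` -/

/-- The chain rule with a continuous linear map for curves in topological vector spaces; the fibres
of a vector bundle carry no norm. -/
theorem HasDerivAt.clm_comp_tvs {V W : Type*} [AddCommGroup V] [Module ℝ V] [TopologicalSpace V]
    [IsTopologicalAddGroup V] [ContinuousSMul ℝ V] [AddCommGroup W] [Module ℝ W]
    [TopologicalSpace W] [IsTopologicalAddGroup W] [ContinuousSMul ℝ W] (L : V →L[ℝ] W)
    {c : ℝ → V} {c' : V} {s : ℝ} (h : HasDerivAt c c' s) :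
    HasDerivAt (fun t => L (c t)) (L c') s :=
  ⟨((L.isBigOTVS_comp).trans_isLittleOTVS h.isLittleOTVS).congr_left fun p => by simp⟩

section LieDerivative

variable {VM : Type*} [NormedAddCommGroup VM] [NormedSpace ℝ VM] [FiniteDimensional ℝ VM]
  {M : Type*} [TopologicalSpace M] [T2Space M] [ChartedSpace VM M] [IsManifold 𝓘(ℝ, VM) ∞ M]
  {VN : Type*} [NormedAddCommGroup VN] [NormedSpace ℝ VN] [FiniteDimensional ℝ VN]
  {N : Type*} [TopologicalSpace N] [T2Space N] [ChartedSpace VN N] [IsManifold 𝓘(ℝ, VN) ∞ N]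
  {VE : Type*} [NormedAddCommGroup VE] [NormedSpace ℝ VE] [FiniteDimensional ℝ VE]
  {E : M → Type*} [∀ m, AddCommGroup (E m)] [∀ m, Module ℝ (E m)]
  [∀ m, TopologicalSpace (E m)] [∀ m, IsTopologicalAddGroup (E m)]
  [∀ m, ContinuousSMul ℝ (E m)] [TopologicalSpace (TotalSpace VE E)]
  [FiberBundle VE E] [VectorBundle ℝ VE E] [ContMDiffVectorBundle ∞ VE E 𝓘(ℝ, VM)]
  {VF : Type*} [NormedAddCommGroup VF] [NormedSpace ℝ VF] [FiniteDimensional ℝ VF]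
  {F : N → Type*} [∀ n, AddCommGroup (F n)] [∀ n, Module ℝ (F n)]
  [∀ n, TopologicalSpace (F n)] [∀ n, IsTopologicalAddGroup (F n)]
  [∀ n, ContinuousSMul ℝ (F n)] [TopologicalSpace (TotalSpace VF F)]
  [FiberBundle VF F] [VectorBundle ℝ VF F] [ContMDiffVectorBundle ∞ VF F 𝓘(ℝ, VN)]
  {ν : ContMDiffMap 𝓘(ℝ, VM) 𝓘(ℝ, VN) M N ∞}
  {A : LieAlgebroid VM M VE E} {B : LieAlgebroid VN N VF F} {pr : BundleMapOver VE E VF F ν}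
  {σ : ContMDiffSection 𝓘(ℝ, VM) VE ∞ E} {η : ContMDiffSection 𝓘(ℝ, VN) VF ∞ F}

variable (A B σ η) in
/-- The linear map `l : E_m → F_{ν(m)}` is the value at `m` of the Lie derivative of `θ` along the
flows of `σ` and `η`. -/
def IsLieDerivAt (θ : BundleMapOver VE E VF F ν) (m : M) (l : E m →L[ℝ] F (ν m)) : Prop :=
  ∀ a : E m, ∃ c : ℝ → F (ν m),
    (∀ᶠ s in 𝓝 (0 : ℝ), ∃ a' : TotalSpace VE E,
      A.SectionFlowsTo σ s ⟨m, a⟩ a' ∧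
      B.SectionFlowsTo η (-s) ⟨ν a'.proj, fiberMap θ a'.proj a'.2⟩ ⟨ν m, c s⟩) ∧
    HasDerivAt c (l a) 0

variable {e : Trivialization VE (TotalSpace.proj : TotalSpace VE E → M)} [MemTrivializationAtlas e]
  {f : Trivialization VF (TotalSpace.proj : TotalSpace VF F → N)} [MemTrivializationAtlas f]
  {m : M} {φ : Cutoff VM m e.baseSet} {n : N} {χ : Cutoff VN n f.baseSet}

variable (A B σ η φ χ) in
/-- The matrix of the Lie derivative of `θ` in the trivializations `e` and `f`. -/
def lieCoord (θ : BundleMapOver VE E VF F ν) (x : M) : VE →L[ℝ] VF :=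
  mvfderiv 𝓘(ℝ, VM) (mapCoord e f θ) x (A.anchorField σ x) -
    mapCoord e f θ x ∘L christoffel e φ (A.bracket σ) x +
    christoffel f χ (B.bracket η) (ν x) ∘L mapCoord e f θ x

/-- The flows being single-valued, the curve in the definition of the Lie derivative is `c T a` in
coordinates, and its derivative at `0` is `lieCoord`. -/
theorem isLieDerivAt_iff (h : IsLieAlgebroidMorphism A B pr) (hση : ProjectsOver pr σ η)
    {θ : BundleMapOver VE E VF F ν} {x : M} (hx : x ∈ φ.nhd) (hνx : ν x ∈ χ.nhd)
    {l : E x →L[ℝ] F (ν x)} :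
    IsLieDerivAt A B σ η θ x l ↔
      f.continuousLinearMapAt ℝ (ν x) ∘L l ∘L e.symmL ℝ x = lieCoord A B σ η φ χ θ x := by
  obtain ⟨Θ⟩ := exists_flowFrame ν A B σ η φ χ hx hνx
  have hxe := φ.nhd_subset hx
  have hxf := χ.nhd_subset hνx
  let g : VE → ℝ → VF := fun y s => Θ.c s (mapCoord e f θ (Θ.x s) (Θ.a s y))
  have hg : ∀ y, HasDerivAt (g y) (lieCoord A B σ η φ χ θ x y) 0 := by
    intro y
    have h1 := (Θ.hasDerivAt_c 0 Θ.zero_mem).clm_apply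
      ((Θ.hasDerivAt_mapCoord θ Θ.zero_mem).clm_apply
        ((Θ.hasDerivAt_a 0 Θ.zero_mem).clm_apply (hasDerivAt_const 0 y)))
    refine h1.congr_deriv ?_
    have h2 : ∀ z, z = x → (Θ.c 0) ((christoffel f χ (B.bracket η) (ν z))
        (mapCoord e f θ z (Θ.a 0 y))) + Θ.c 0 (mvfderiv 𝓘(ℝ, VM) (mapCoord e f θ) z
          (A.anchorField σ z) (Θ.a 0 y) + mapCoord e f θ z
            (-(christoffel e φ (A.bracket σ) z (Θ.a 0 y)))) = lieCoord A B σ η φ χ θ x y := by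
      rintro z rfl
      simp [lieCoord, Θ.a_zero, Θ.c_zero]
      abel
    simpa using h2 _ Θ.x_zero
  have hflow : ∀ y, ∀ s ∈ Ioo (-Θ.δ) Θ.δ, ∃ a' : TotalSpace VE E,
      A.SectionFlowsTo σ s ⟨x, e.symmL ℝ x y⟩ a' ∧
      B.SectionFlowsTo η (-s) ⟨ν a'.proj, fiberMap θ a'.proj a'.2⟩
        ⟨ν x, f.symmL ℝ (ν x) (g y s)⟩ := by
    intro y s hs
    refine ⟨_, Θ.sectionFlowsTo hs y, ?_⟩
    have h1 := Θ.sectionFlowsTo_neg h hση hs (mapCoord e f θ (Θ.x s) (Θ.a s y))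
    rw [mapCoord_apply, f.symmL_continuousLinearMapAt (χ.nhd_subset (Θ.map_mem s hs))] at h1
    exact h1
  constructor
  · intro hl
    ext y
    obtain ⟨c, hc, hc'⟩ := hl (e.symmL ℝ x y)
    have h1 := hc'.clm_comp_tvs (f.continuousLinearMapAt ℝ (ν x))
    refine HasDerivAt.unique (h1.congr_of_eventuallyEq ?_) (hg y)
    filter_upwards [hc, Θ.eventually_mem] with s ⟨a', h2, h3⟩ hs
    obtain ⟨a'', h4, h5⟩ := hflow y s hs
    obtain rfl := h2.unique h4
    rw [eq_of_heq (TotalSpace.mk.inj (h3.unique h5)).2, f.continuousLinearMapAt_symmL hxf]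
  · intro hl a
    have ha : e.symmL ℝ x (e.continuousLinearMapAt ℝ x a) = a := e.symmL_continuousLinearMapAt hxe a
    refine ⟨fun s => f.symmL ℝ (ν x) (g (e.continuousLinearMapAt ℝ x a) s), ?_, ?_⟩
    · filter_upwards [Θ.eventually_mem] with s hs
      have h1 := hflow (e.continuousLinearMapAt ℝ x a) s hs
      rwa [ha] at h1
    · have h1 := (hg (e.continuousLinearMapAt ℝ x a)).clm_comp_tvs (f.symmL ℝ (ν x))
      rw [← hl] at h1
      simp only [ContinuousLinearMap.comp_apply] at h1
      rwa [ha, f.symmL_continuousLinearMapAt hxf] at h1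

theorem contMDiffAt_mvfderiv_apply {W : Type*} [NormedAddCommGroup W] [NormedSpace ℝ W] {T : M → W}
    {x : M} (hT : ContMDiffAt 𝓘(ℝ, VM) 𝓘(ℝ, W) ∞ T x) {ξ : ∀ x : M, TangentSpace 𝓘(ℝ, VM) x}
    (hξ : ContMDiff 𝓘(ℝ, VM) 𝓘(ℝ, VM).tangent ∞ fun x => (⟨x, ξ x⟩ : TangentBundle 𝓘(ℝ, VM) M)) :
    ContMDiffAt 𝓘(ℝ, VM) 𝓘(ℝ, W) ∞ (fun y => mvfderiv 𝓘(ℝ, VM) T y (ξ y)) x := by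
  have h1 := hT.mfderiv_const (m := ∞) (by simp)
  have h2 := ContMDiffAt.clm_apply_of_inCoordinates (b₁ := fun y : M => y) (b₂ := T)
    (E₁ := TangentSpace 𝓘(ℝ, VM)) (E₂ := TangentSpace 𝓘(ℝ, W)) h1 (hξ x) hT
  exact (contMDiff_snd_tangentBundle_modelSpace W 𝓘(ℝ, W)).contMDiffAt.comp x h2

theorem hom_continuousLinearMapAt {x : M} (hx : x ∈ e.baseSet) (hνx : ν x ∈ f.baseSet)
    (l : E x →L[ℝ] ((ν : M → N) *ᵖ F) x) :
    (e.continuousLinearMap (RingHom.id ℝ) (f.pullback ν)).continuousLinearMapAt ℝ x l =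
      f.continuousLinearMapAt ℝ (ν x) ∘L (l : E x →L[ℝ] F (ν x)) ∘L e.symmL ℝ x := by
  have hb : x ∈ (e.continuousLinearMap (RingHom.id ℝ) (f.pullback ν)).baseSet := ⟨hx, hνx⟩
  rw [Trivialization.continuousLinearMapAt_apply, Trivialization.coe_linearMapAt_of_mem _ hb]
  ext y
  exact pullback_continuousLinearMapAt f hνx _

theorem contMDiffAt_lieCoord (θ : BundleMapOver VE E VF F ν) {x : M} (hx : x ∈ e.baseSet)
    (hνx : ν x ∈ f.baseSet) :
    ContMDiffAt 𝓘(ℝ, VM) 𝓘(ℝ, VE →L[ℝ] VF) ∞ (lieCoord A B σ η φ χ θ) x := by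
  have hT := contMDiffAt_mapCoord e f θ hx hνx
  have hΓ := contMDiffAt_christoffel e φ (A.bracket σ) hx
  have hΔ : ContMDiffAt 𝓘(ℝ, VM) 𝓘(ℝ, VF →L[ℝ] VF) ∞
      (fun y => christoffel f χ (B.bracket η) (ν y)) x :=
    ContMDiffAt.comp (I' := 𝓘(ℝ, VN)) (g := christoffel f χ (B.bracket η)) (f := ν) x
      (contMDiffAt_christoffel f χ (B.bracket η) hνx)
      (ν.contMDiff x)
  have hD : ContMDiffAt 𝓘(ℝ, VM) 𝓘(ℝ, VE →L[ℝ] VF) ∞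
      (fun y => mvfderiv 𝓘(ℝ, VM) (mapCoord e f θ) y (A.anchorField σ y)) x :=
    contMDiffAt_mvfderiv_apply hT (A.contMDiff_anchorField σ)
  exact (hD.sub (hT.clm_comp hΓ)).add (hΔ.clm_comp hT)

/-- The Lie derivative of a section of `ℒ*π` along a projectable section exists: its pointwise values
are unique, so they are given by `lieCoord` in every trivialization and depend smoothly on the
point. -/
theorem exists_isLieDerivL (h : IsLieAlgebroidMorphism A B pr) (hση : ProjectsOver pr σ η)
    (θ : BundleMapOver VE E VF F ν) : ∃ θ' : BundleMapOver VE E VF F ν,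
      IsLieDerivL A B σ η θ θ' := by
  have hex : ∀ x : M, ∃ l : E x →L[ℝ] F (ν x), IsLieDerivAt A B σ η θ x l := fun x => by
    refine ⟨(trivializationAt VF F (ν x)).symmL ℝ (ν x) ∘L
      lieCoord A B σ η (stdCutoff VM VE E x) (stdCutoff VN VF F (ν x)) θ x ∘L
        (trivializationAt VE E x).continuousLinearMapAt ℝ x,
      (isLieDerivAt_iff h hση (stdCutoff VM VE E x).mem (stdCutoff VN VF F (ν x)).mem).2 ?_⟩
    ext y
    simp only [ContinuousLinearMap.comp_apply]
    rw [Trivialization.continuousLinearMapAt_symmL _ (FiberBundle.mem_baseSet_trivializationAt' _),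
      Trivialization.continuousLinearMapAt_symmL _ (FiberBundle.mem_baseSet_trivializationAt' _)]
  choose l hl using hex
  refine ⟨⟨l, fun x => ?_⟩, hl⟩
  let e := trivializationAt VE E x
  let f := trivializationAt VF F (ν x)
  have hx : x ∈ e.baseSet := FiberBundle.mem_baseSet_trivializationAt' _
  have hνx : ν x ∈ f.baseSet := FiberBundle.mem_baseSet_trivializationAt' _
  refine contMDiffAt_section_of_coord (e.continuousLinearMap (RingHom.id ℝ) (f.pullback ν))
    ⟨hx, hνx⟩ ((contMDiffAt_lieCoord (A := A) (B := B) (σ := σ) (η := η)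
      (φ := stdCutoff VM VE E x) (χ := stdCutoff VN VF F (ν x)) θ hx hνx).congr_of_eventuallyEq ?_)
  filter_upwards [(stdCutoff VM VE E x).eventually_mem (stdCutoff VM VE E x).mem,
    ν.contMDiff.continuous.continuousAt.preimage_mem_nhds
      ((stdCutoff VN VF F (ν x)).eventually_mem (stdCutoff VN VF F (ν x)).mem)] with y hy hy'
  exact (hom_continuousLinearMapAt ((stdCutoff VM VE E x).nhd_subset hy)
    ((stdCutoff VN VF F (ν x)).nhd_subset hy') (l y)).trans ((isLieDerivAt_iff h hση hy hy').1 (hl y))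

end LieDerivative

/-! ### The complete lift to `𝒥π` -/

section JetLift

variable {VM : Type*} [NormedAddCommGroup VM] [NormedSpace ℝ VM] [FiniteDimensional ℝ VM]
  {M : Type*} [TopologicalSpace M] [T2Space M] [ChartedSpace VM M] [IsManifold 𝓘(ℝ, VM) ∞ M]
  {VN : Type*} [NormedAddCommGroup VN] [NormedSpace ℝ VN] [FiniteDimensional ℝ VN]
  {N : Type*} [TopologicalSpace N] [T2Space N] [ChartedSpace VN N] [IsManifold 𝓘(ℝ, VN) ∞ N]
  {VE : Type*} [NormedAddCommGroup VE] [NormedSpace ℝ VE] [FiniteDimensional ℝ VE]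
  {E : M → Type*} [∀ m, AddCommGroup (E m)] [∀ m, Module ℝ (E m)]
  [∀ m, TopologicalSpace (E m)] [∀ m, IsTopologicalAddGroup (E m)]
  [∀ m, ContinuousSMul ℝ (E m)] [TopologicalSpace (TotalSpace VE E)]
  [FiberBundle VE E] [VectorBundle ℝ VE E] [ContMDiffVectorBundle ∞ VE E 𝓘(ℝ, VM)]
  {VF : Type*} [NormedAddCommGroup VF] [NormedSpace ℝ VF] [FiniteDimensional ℝ VF]
  {F : N → Type*} [∀ n, AddCommGroup (F n)] [∀ n, Module ℝ (F n)]
  [∀ n, TopologicalSpace (F n)] [∀ n, IsTopologicalAddGroup (F n)]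
  [∀ n, ContinuousSMul ℝ (F n)] [TopologicalSpace (TotalSpace VF F)]
  [FiberBundle VF F] [VectorBundle ℝ VF F] [ContMDiffVectorBundle ∞ VF F 𝓘(ℝ, VN)]
  {ν : ContMDiffMap 𝓘(ℝ, VM) 𝓘(ℝ, VN) M N ∞}
  {A : LieAlgebroid VM M VE E} {B : LieAlgebroid VN N VF F} {pr : BundleMapOver VE E VF F ν}
  {σ : ContMDiffSection 𝓘(ℝ, VM) VE ∞ E} {η : ContMDiffSection 𝓘(ℝ, VN) VF ∞ F}

section Coord

variable {e : Trivialization VE (TotalSpace.proj : TotalSpace VE E → M)} [MemTrivializationAtlas e]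
  {f : Trivialization VF (TotalSpace.proj : TotalSpace VF F → N)} [MemTrivializationAtlas f]
  {m : M} {φ : Cutoff VM m e.baseSet} {n : N} {χ : Cutoff VN n f.baseSet}

theorem exists_hasTransportCoord {w : LBundle VE E VF F ν} (hw : w.proj ∈ φ.nhd)
    (hνw : ν w.proj ∈ χ.nhd) : ∃ v, HasTransportCoord A B σ η φ χ w v :=
  exists_vector_of_coord (LTriv ν e f)
    (mem_LTriv_baseSet e f (φ.nhd_subset hw) (χ.nhd_subset hνw)) _ _

/-- The velocity at `0` of any curve `s ↦ Ψ_s ∘ w ∘ Φ_{-s}` has the coordinates of a transport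
velocity, as the curve agrees with the one of `exists_transportCurve`. -/
theorem hasTransportCoord_of_hasMFDerivAt (h : IsLieAlgebroidMorphism A B pr)
    (hση : ProjectsOver pr σ η) {γ : ℝ → LBundle VE E VF F ν} (hw : (γ 0).proj ∈ φ.nhd)
    (hνw : ν (γ 0).proj ∈ χ.nhd) (htr : ∀ᶠ s in 𝓝 (0 : ℝ), IsTransport A B σ η s (γ 0) (γ s))
    {v : TangentSpace (modelL VM VE VF) (γ 0)}
    (hv : HasMFDerivAt 𝓘(ℝ, ℝ) (modelL VM VE VF) γ 0 ((1 : ℝ →L[ℝ] ℝ).smulRight v)) :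
    HasTransportCoord A B σ η φ χ (γ 0) v := by
  obtain ⟨γ₁, h0, h1⟩ := exists_transportCurve h hση hw hνw
  obtain ⟨v₁, hv₁⟩ := exists_hasTransportCoord (A := A) (B := B) (σ := σ) (η := η) hw hνw
  have heq : γ =ᶠ[𝓝 0] γ₁ := by
    filter_upwards [htr, h1] with s hs hs' using hs.unique hs'.2.1
  have key : ∀ w', w' = γ 0 → HasTransportCoord A B σ η φ χ w' v₁ := by
    rintro _ rfl
    exact hv₁
  have h2 := (h1.self_of_nhds.2.2.2 v₁ (key _ h0)).congr_of_eventuallyEq heq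
  have h3 := DFunLike.congr_fun (F := ℝ →L[ℝ] VM × (VF →L[ℝ] VE)) (hasMFDerivAt_unique hv h2) 1
  have h4 : v = v₁ := by
    change ((1 : ℝ) • v : VM × (VF →L[ℝ] VE)) = (1 : ℝ) • v₁ at h3
    rwa [one_smul, one_smul] at h3
  rwa [h4]

/-- The coordinate description of transport velocities does not depend on the trivializations,
because such a vector is the velocity of a curve `s ↦ Ψ_s ∘ w ∘ Φ_{-s}`. -/
theorem HasTransportCoord.change (h : IsLieAlgebroidMorphism A B pr) (hση : ProjectsOver pr σ η)
    {e' : Trivialization VE (TotalSpace.proj : TotalSpace VE E → M)} [MemTrivializationAtlas e']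
    {f' : Trivialization VF (TotalSpace.proj : TotalSpace VF F → N)} [MemTrivializationAtlas f']
    {m' : M} {φ' : Cutoff VM m' e'.baseSet} {n' : N} {χ' : Cutoff VN n' f'.baseSet}
    {w : LBundle VE E VF F ν} (hw : w.proj ∈ φ.nhd) (hνw : ν w.proj ∈ χ.nhd)
    (hw' : w.proj ∈ φ'.nhd) (hνw' : ν w.proj ∈ χ'.nhd) {v : TangentSpace (modelL VM VE VF) w}
    (hv : HasTransportCoord A B σ η φ χ w v) : HasTransportCoord A B σ η φ' χ' w v := by
  obtain ⟨γ, h0, h1⟩ := exists_transportCurve h hση hw hνw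
  subst h0
  exact hasTransportCoord_of_hasMFDerivAt h hση hw' hνw' (h1.mono fun s hs => hs.2.1)
    (h1.self_of_nhds.2.2.2 v hv)

theorem HasTransportCoord.isTangentTo (h : IsLieAlgebroidMorphism A B pr)
    (hση : ProjectsOver pr σ η) {w : LBundle VE E VF F ν} (hw : w.proj ∈ φ.nhd)
    (hνw : ν w.proj ∈ χ.nhd) (hjet : w ∈ jetSet pr) {v : TangentSpace (modelL VM VE VF) w}
    (hv : HasTransportCoord A B σ η φ χ w v) : IsTangentTo (jetSet pr) w v := by
  obtain ⟨γ, h0, h1⟩ := exists_transportCurve h hση hw hνw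
  subst h0
  exact ⟨γ, rfl, h1.mono fun s hs => hs.2.2.1 hjet, h1.self_of_nhds.2.2.2 v hv⟩

/-- A transport velocity maps `θ̂` to `(d_σ θ)^`. -/
theorem HasTransportCoord.mvfderiv_hatFunction (h : IsLieAlgebroidMorphism A B pr)
    (hση : ProjectsOver pr σ η) {θ θ' : BundleMapOver VE E VF F ν}
    (hθ : IsLieDerivL A B σ η θ θ') {w : LBundle VE E VF F ν} (hw : w.proj ∈ φ.nhd)
    (hνw : ν w.proj ∈ χ.nhd) {v : TangentSpace (modelL VM VE VF) w}
    (hv : HasTransportCoord A B σ η φ χ w v) :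
    mfderiv (modelL VM VE VF) 𝓘(ℝ, ℝ) (hatFunction θ) w v = hatFunction θ' w := by
  have hwe := φ.nhd_subset hw
  have hwf := χ.nhd_subset hνw
  have h1 : mapCoord e f θ' w.proj = lieCoord A B σ η φ χ θ w.proj :=
    (isLieDerivAt_iff h hση hw hνw).1 (hθ w.proj)
  refine (_root_.mvfderiv_hatFunction e f θ hwe hwf v).trans ?_
  rw [hatFunction_eq e f θ' hwe hwf, h1, hv.1, hv.2, transportField, lieCoord, map_add, map_neg,
    tracePairing_comp_left, tracePairing_comp_right, tracePairing_add_left, tracePairing_sub_left]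
  ring

/-- A section of `ℒ*π` with prescribed matrix at the point `x`. -/
theorem exists_mapCoord_eq {x : M} (hx : x ∈ e.baseSet) (hνx : ν x ∈ f.baseSet)
    (T : VE →L[ℝ] VF) : ∃ θ : BundleMapOver VE E VF F ν, mapCoord e f θ x = T := by
  have hb : x ∈ (e.continuousLinearMap (RingHom.id ℝ) (f.pullback ν)).baseSet := ⟨hx, hνx⟩
  obtain ⟨ψ⟩ := exists_cutoff (VM := VM)
    ((e.continuousLinearMap (RingHom.id ℝ) (f.pullback ν)).open_baseSet.mem_nhds hb)
  refine ⟨frameSection (e.continuousLinearMap (RingHom.id ℝ) (f.pullback ν)) ψ T, ?_⟩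
  exact (hom_continuousLinearMapAt hx hνx _).symm.trans (coord_frameSection _ ψ T ψ.mem)

end Coord

variable (A B σ η) in
/-- `v` is the velocity at `w` of the flow `w ↦ Ψ_s ∘ w ∘ Φ_{-s}`, characterized by its coordinates
in the preferred trivializations. -/
def IsTransportVelocity (w : LBundle VE E VF F ν) (v : TangentSpace (modelL VM VE VF) w) : Prop :=
  HasTransportCoord A B σ η (stdCutoff VM VE E w.proj) (stdCutoff VN VF F (ν w.proj)) w v

/-- The field of transport velocities is the complete lift. -/
theorem isJetCompleteLift_of_isTransportVelocity (h : IsLieAlgebroidMorphism A B pr)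
    (hση : ProjectsOver pr σ η) {X : ∀ w : LBundle VE E VF F ν, TangentSpace (modelL VM VE VF) w}
    (hX : ∀ w, IsTransportVelocity A B σ η w (X w)) : IsJetCompleteLift A B pr σ η X := by
  have hcoord : ∀ (x : M) (w : LBundle VE E VF F ν), w.proj ∈ (stdCutoff VM VE E x).nhd →
      ν w.proj ∈ (stdCutoff VN VF F (ν x)).nhd →
      HasTransportCoord A B σ η (stdCutoff VM VE E x) (stdCutoff VN VF F (ν x)) w (X w) :=
    fun x w hw hνw => HasTransportCoord.change h hση (stdCutoff VM VE E w.proj).mem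
      (stdCutoff VN VF F (ν w.proj)).mem hw hνw (hX w)
  refine ⟨⟨fun w _ => ContMDiffAt.contMDiffWithinAt ?_, fun w hw => (hX w).isTangentTo h hση
    (stdCutoff VM VE E w.proj).mem (stdCutoff VN VF F (ν w.proj)).mem hw⟩, fun w hw => ?_⟩
  · let e := trivializationAt VE E w.proj
    let f := trivializationAt VF F (ν w.proj)
    let φ := stdCutoff VM VE E w.proj
    let χ := stdCutoff VN VF F (ν w.proj)
    have hx : w.proj ∈ e.baseSet := FiberBundle.mem_baseSet_trivializationAt' _
    have hνx : ν w.proj ∈ f.baseSet := FiberBundle.mem_baseSet_trivializationAt' _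
    refine contMDiffAt_vectorField_of_coord (LTriv ν e f) (A.contMDiff_anchorField σ)
      (u := transportField A B σ η φ χ (ν := ν)) ⟨hνx, hx⟩ ?_ ?_
    · let q : M × (VF →L[ℝ] VE) := (w.proj, fiberCoord (LTriv ν e f) w)
      have hΓ : ContMDiffAt (𝓘(ℝ, VM).prod 𝓘(ℝ, VF →L[ℝ] VE)) 𝓘(ℝ, VE →L[ℝ] VE) ∞
          (fun p : M × (VF →L[ℝ] VE) => christoffel e φ (A.bracket σ) p.1) q :=
        ContMDiffAt.comp (I' := 𝓘(ℝ, VM)) (f := fun p : M × (VF →L[ℝ] VE) => p.1) q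
          (contMDiffAt_christoffel e φ (A.bracket σ) hx) contMDiffAt_fst
      have hΔ : ContMDiffAt (𝓘(ℝ, VM).prod 𝓘(ℝ, VF →L[ℝ] VE)) 𝓘(ℝ, VF →L[ℝ] VF) ∞
          (fun p : M × (VF →L[ℝ] VE) => christoffel f χ (B.bracket η) (ν p.1)) q :=
        ContMDiffAt.comp (I' := 𝓘(ℝ, VN)) (f := fun p : M × (VF →L[ℝ] VE) => ν p.1) q
          (contMDiffAt_christoffel f χ (B.bracket η) hνx)
          (ContMDiffAt.comp (I' := 𝓘(ℝ, VM)) (f := fun p : M × (VF →L[ℝ] VE) => p.1) q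
            (ν.contMDiff w.proj) contMDiffAt_fst)
      have hW : ContMDiffAt (𝓘(ℝ, VM).prod 𝓘(ℝ, VF →L[ℝ] VE)) 𝓘(ℝ, VF →L[ℝ] VE) ∞
          (fun p : M × (VF →L[ℝ] VE) => p.2) q := contMDiffAt_snd
      exact (hΓ.clm_comp hW).neg.add (hW.clm_comp hΔ)
    · filter_upwards [eventually_proj_mem (a := w) φ.isOpen φ.mem,
        eventually_proj_mem (a := w) (χ.isOpen.preimage ν.contMDiff.continuous) χ.mem] with w' h1 h2
      exact hcoord w.proj w' h1 h2
  · obtain ⟨γ, h0, h1⟩ := exists_transportCurve h hση (stdCutoff VM VE E w.proj).mem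
      (stdCutoff VN VF F (ν w.proj)).mem
    exact ⟨γ, h0, h1.mono fun s hs => ⟨hs.2.2.1 hw, hs.2.1⟩,
      h1.mono fun s hs => hs.2.2.2 _ (hcoord w.proj (γ s) hs.1.1 hs.1.2)⟩

/-- On `𝒥π` every complete lift is the field of transport velocities. -/
theorem IsJetCompleteLift.isTransportVelocity (h : IsLieAlgebroidMorphism A B pr)
    (hση : ProjectsOver pr σ η) {X : ∀ w : LBundle VE E VF F ν, TangentSpace (modelL VM VE VF) w}
    (hX : IsJetCompleteLift A B pr σ η X) {w : LBundle VE E VF F ν} (hw : w ∈ jetSet pr) :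
    IsTransportVelocity A B σ η w (X w) := by
  obtain ⟨γ, h0, h1, h2⟩ := hX.2 w hw
  subst h0
  exact hasTransportCoord_of_hasMFDerivAt h hση (stdCutoff VM VE E (γ 0).proj).mem
    (stdCutoff VN VF F (ν (γ 0).proj)).mem (h1.mono fun s hs => hs.2) h2.self_of_nhds

end JetLift

end

theorem proposition4
    {VM : Type*} [NormedAddCommGroup VM] [NormedSpace ℝ VM] [FiniteDimensional ℝ VM]
    {M : Type*} [TopologicalSpace M] [T2Space M] [ChartedSpace VM M] [IsManifold 𝓘(ℝ, VM) ∞ M]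
    {VN : Type*} [NormedAddCommGroup VN] [NormedSpace ℝ VN] [FiniteDimensional ℝ VN]
    {N : Type*} [TopologicalSpace N] [T2Space N] [ChartedSpace VN N] [IsManifold 𝓘(ℝ, VN) ∞ N]
    {VE : Type*} [NormedAddCommGroup VE] [NormedSpace ℝ VE] [FiniteDimensional ℝ VE]
    {E : M → Type*} [∀ m, AddCommGroup (E m)] [∀ m, Module ℝ (E m)]
    [∀ m, TopologicalSpace (E m)] [∀ m, IsTopologicalAddGroup (E m)]
    [∀ m, ContinuousSMul ℝ (E m)] [TopologicalSpace (TotalSpace VE E)]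
    [FiberBundle VE E] [VectorBundle ℝ VE E] [ContMDiffVectorBundle ∞ VE E 𝓘(ℝ, VM)]
    {VF : Type*} [NormedAddCommGroup VF] [NormedSpace ℝ VF] [FiniteDimensional ℝ VF]
    {F : N → Type*} [∀ n, AddCommGroup (F n)] [∀ n, Module ℝ (F n)]
    [∀ n, TopologicalSpace (F n)] [∀ n, IsTopologicalAddGroup (F n)]
    [∀ n, ContinuousSMul ℝ (F n)] [TopologicalSpace (TotalSpace VF F)]
    [FiberBundle VF F] [VectorBundle ℝ VF F] [ContMDiffVectorBundle ∞ VF F 𝓘(ℝ, VN)]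
    (A : LieAlgebroid VM M VE E) (B : LieAlgebroid VN N VF F)
    (ν : ContMDiffMap 𝓘(ℝ, VM) 𝓘(ℝ, VN) M N ∞)
    (pr : BundleMapOver VE E VF F ν)
    (hsurj : ∀ m, Function.Surjective (fiberMap pr m))
    (hmor : IsLieAlgebroidMorphism A B pr)
    (σ : ContMDiffSection 𝓘(ℝ, VM) VE ∞ E) (η : ContMDiffSection 𝓘(ℝ, VN) VF ∞ F)
    (hση : ProjectsOver pr σ η) :
    (∃ X, IsJetCompleteLift A B pr σ η X) ∧
    ∀ X, IsJetCompleteLift A B pr σ η X →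
      (ProjectsToAnchor A pr σ X ∧ ActsByLieDeriv A B pr σ η X) ∧
      ∀ Y, IsJetVectorField pr Y → ProjectsToAnchor A pr σ Y → ActsByLieDeriv A B pr σ η Y →
        ∀ w ∈ jetSet pr, Y w = X w := by
  constructor
  · have hex : ∀ w : LBundle VE E VF F ν, ∃ v, IsTransportVelocity A B σ η w v := fun w =>
      exists_hasTransportCoord (stdCutoff VM VE E w.proj).mem (stdCutoff VN VF F (ν w.proj)).mem
    choose X hX using hex
    exact ⟨X, isJetCompleteLift_of_isTransportVelocity hmor hση hX⟩
  · intro X hX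
    have hXv := fun w (hw : w ∈ jetSet pr) => hX.isTransportVelocity hmor hση hw
    refine ⟨⟨fun w hw => (hXv w hw).1, fun θ => ?_⟩, fun Y _ hYp hYL w hw => ?_⟩
    · obtain ⟨θ', hθ'⟩ := exists_isLieDerivL hmor hση θ
      exact ⟨θ', hθ', fun w hw => (hXv w hw).mvfderiv_hatFunction hmor hση hθ'
        (stdCutoff VM VE E w.proj).mem (stdCutoff VN VF F (ν w.proj)).mem⟩
    · let e := trivializationAt VE E w.proj
      let f := trivializationAt VF F (ν w.proj)
      have hx : w.proj ∈ e.baseSet := FiberBundle.mem_baseSet_trivializationAt' _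
      have hνx : ν w.proj ∈ f.baseSet := FiberBundle.mem_baseSet_trivializationAt' _
      have hp := (hYp w hw).trans (hXv w hw).1.symm
      refine vector_ext_coord (LTriv ν e f) ⟨hνx, hx⟩ hp ?_
      -- The difference of the two vectors is vertical, and `tr (T U)` vanishes on it for all `T`.
      refine sub_eq_zero.1 (eq_zero_of_tracePairing fun T => ?_)
      obtain ⟨θ, hθ⟩ := exists_mapCoord_eq hx hνx T
      obtain ⟨θ', hθ', hY⟩ := hYL θ
      have h1 := (hXv w hw).mvfderiv_hatFunction hmor hση hθ'
        (stdCutoff VM VE E w.proj).mem (stdCutoff VN VF F (ν w.proj)).mem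
      have h2 := (mvfderiv_hatFunction e f θ hx hνx (Y w)).symm.trans
        ((hY w hw).trans (h1.symm.trans (mvfderiv_hatFunction e f θ hx hνx (X w))))
      rw [hp, hθ] at h2
      rw [map_sub, add_right_cancel h2, sub_self]
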